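/- **Setting.** Let $r>0$ and put $\phi=\mathbf 1_{[0,1]}$. Fix a biorthogonal wavelet basis of $L_2(\mathbb R)$ with smoothness parameter $r$, that is, three compactly supported functions $\psi,\tilde\phi,\tilde\psi$ such that $\tilde\phi,\tilde\psi$ belong to the Hölder space $C^{r+1}$, $\psi$ is piecewise constant and orthogonal to all polynomials of degree at most $r$, and such that, with $$\psi_{-1k}(x)=\phi(x-k),\quad \tilde\psi_{-1k}(x)=\tilde\phi(x-k),\quad \psi_{jk}(x)=2^{j/2}\psi(2^jx-k),\quad \tilde\psi_{jk}(x)=2^{j/2}\tilde\psi(2^jx-k)\qquad(j\ge 0,\ k\in\mathbb Z),$$ one has $\int\psi_{jk}\tilde\psi_{j'k'}=\mathbf 1_{(j,k)=(j',k')}$ for all $j,j'\ge-1$, $k,k'\in\mathbb Z$, and $c_1\sum_{j\ge-1,k}\beta_{jk}^2\le\|f\|_2^2\le c_2\sum_{j\ge-1,k}\beta_{jk}^2$ for all $f\in L_2(\mathbb R)$, where $\beta_{jk}=\beta_{jk}(f)=\int f\psi_{jk}$ and $c_1,c_2>0$ do not depend on $f$. For $1\le p,q\le\infty$, $\alpha\in\mathbb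 R$ and $R>0$ let $$\|f\|_{\alpha,p,q}=\|(\beta_{-1k})_k\|_{\ell_p}+\Big\|\big(2^{j(\alpha+\frac12-\frac1p)}\|(\beta_{jk})_k\|_{\ell_p}\big)_{j\ge0}\Big\|_{\ell_q},\qquad \mathcal B^\alpha_{p,q}(R)=\{f\in L_2(\mathbb R):\|f\|_{\alpha,p,q}\le R\},$$ and let $\mathcal L_{2,\infty}(R')$ be the set of probability densities $f$ on $\mathbb R$ with $\|f\|_2\le R'$ and $\|f\|_\infty\le R'$. One observes a sample $X_1,\dots,X_n$ of independent variables with density $f$; an estimator $\hat f$ is a measurable function of the sample (with values in the functions on $\mathbb R$), and $\mathbb E_f$ is the expectation under this sample. Write $$\rho(\alpha,p)=\frac{\alpha}{\alpha+\frac12+\left(\frac12-\frac1p\right)_+},\qquad \mathcal R_n(\mathcal F)=\inf_{\hat f}\sup_{f\in\mathcal F}\mathbb E_f\big[\|\hat f-f\|_2^2\big].$$ **Estimator.** For $c\ge1$ and $\gamma>c$ and $n\ge2$, let $j_0=\lfloor\log_2\lfloor n^c(\ln n)^{-c}\rfloor\rfloor$, $$\hat\beta_{jk}=\frac1n\sum_{i=1}^n\psi_{jk}(X_i),\qquad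 \hat\sigma^2_{jk}=\frac1{n(n-1)}\sum_{i=2}^n\sum_{l=1}^{i-1}(\psi_{jk}(X_i)-\psi_{jk}(X_l))^2,$$ $$\tilde\sigma^2_{jk}=\hat\sigma_{jk}^2+2\|\psi_{jk}\|_\infty\sqrt{2\gamma\hat\sigma^2_{jk}\tfrac{\ln n}n}+8\gamma\|\psi_{jk}\|_\infty^2\tfrac{\ln n}n,\qquad \eta_{jk}=\sqrt{2\gamma\tilde\sigma^2_{jk}\tfrac{\ln n}n}+\frac{2\|\psi_{jk}\|_\infty\gamma\ln n}{3n},$$ $$\tilde f_{n,\gamma}=\sum_{-1\le j\le j_0}\ \sum_{k\in\mathbb Z}\hat\beta_{jk}\mathbf 1_{|\hat\beta_{jk}|\ge\eta_{jk}}\tilde\psi_{jk}.$$ **Theorem.** (i) Let $R,R'>0$, $1\le p,q\le\infty$ (with $R>1$ if $p=1$) and $\max(0,\frac1p-\frac12)<\alpha<r+1$. Then there is a constant $\tilde C>0$, depending only on $R'$, on $\alpha,p,q,R$ and on the wavelet basis, such that $$\liminf_{n\to\infty}\ n^{\rho(\alpha,p)}\,\mathcal R_n\big(\mathcal B^\alpha_{p,q}(R)\cap\mathcal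 L_{2,\infty}(R')\big)\ \ge\ \tilde C .$$ (ii) Let $c\ge1$, $\gamma>c$, $p^*\in[1,\infty]$ and $\alpha^*>0$ satisfy $$\alpha^*\Big(1-\frac1{c(1+2\alpha^*)}\Big)\ge\frac1{p^*}-\frac12 .$$ Then the single procedure $\tilde f_{n,\gamma}$, built with these $c$ and $\gamma$, is adaptive minimax up to a logarithmic factor over the balls $\mathcal B^\alpha_{p,q}(R)\cap\mathcal L_{2,\infty}(R')$ with $R,R'>0$, $\alpha^*\le\alpha<r+1$, $p^*\le p\le\infty$, $1\le q\le\infty$: it is an estimator in the above sense, and for every such ball $\mathcal F$ there is a constant $C>0$ such that for all $n\ge2$ $$\sup_{f\in\mathcal F}\mathbb E_f\big[\|\tilde f_{n,\gamma}-f\|_2^2\big]\le C\Big(\frac{\ln n}n\Big)^{\rho(\alpha,p)}\quad\text{and, if } p>1 \text{ or } R>1,\quad \sup_{f\in\mathcal F}\mathbb E_f\big[\|\tilde f_{n,\gamma}-f\|_2^2\big]\le C(\ln n)^{\rho(\alpha,p)}\,\mathcal R_n(\mathcal F).$$ -/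

import Mathlib

open MeasureTheory Filter Topology
open scoped ENNReal

noncomputable section

/-! ### Biorthogonal wavelet bases -/

/-- The father wavelet `φ = 𝟙_[0,1]` on the decomposition side. -/
def boxFn : ℝ → ℝ := Set.indicator (Set.Icc 0 1) 1

/-- The family of translates of `φ` and of dilated translates of `ψ`. Resolution levels `-1, 0, 1, …`
are numbered from `0`: the index `(0, k)` is `φ (x - k)`, and the index `(j + 1, k)` is
`2^(j/2) ψ (2^j x - k)`. -/
def waveletFamily (φ ψ : ℝ → ℝ) : ℕ × ℤ → ℝ → ℝ
  | (0, k), x => φ (x - k)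
  | (j + 1, k), x => (2 : ℝ) ^ ((j : ℝ) / 2) * ψ (2 ^ j * x - k)

/-- `g` is piecewise constant with finitely many breakpoints: it is constant on every interval
that contains no point of a suitable finite set. -/
def PiecewiseConstant (g : ℝ → ℝ) : Prop :=
  ∃ S : Finset ℝ, ∀ x y : ℝ, x ≤ y → (∀ s ∈ S, s ∉ Set.Icc x y) → g x = g y

/-- Hölder smoothness of order `s > 0`: with `m` the largest integer strictly smaller than `s`,
`g` is `m` times continuously differentiable and its `m`-th derivative is Hölder continuous of
exponent `s - m ∈ (0, 1]`. It is used for compactly supported functions only, so that boundedness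
of the derivatives is automatic. -/
def HolderSmooth (s : ℝ) (g : ℝ → ℝ) : Prop :=
  ContDiff ℝ ((⌈s⌉₊ - 1 : ℕ)) g ∧
    ∃ C : ℝ, ∀ x y : ℝ,
      |iteratedDeriv (⌈s⌉₊ - 1) g x - iteratedDeriv (⌈s⌉₊ - 1) g y|
        ≤ C * |x - y| ^ (s - ((⌈s⌉₊ - 1 : ℕ) : ℝ))

/-- A biorthogonal wavelet basis of `L²(ℝ)` with smoothness parameter `r`, whose decomposition
father wavelet is `𝟙_[0,1]`. The last field (the two-sided frame bound) is what makes the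
biorthogonal family a (Riesz) basis of `L²(ℝ)`. -/
structure BiorthogonalWaveletBasis (r : ℝ) where
  /-- decomposition mother wavelet -/
  ψ : ℝ → ℝ
  /-- reconstruction father wavelet -/
  φt : ℝ → ℝ
  /-- reconstruction mother wavelet -/
  ψt : ℝ → ℝ
  compact_φt : HasCompactSupport φt
  compact_ψt : HasCompactSupport ψt
  smooth_φt : HolderSmooth (r + 1) φt
  smooth_ψt : HolderSmooth (r + 1) ψt
  compact_ψ : HasCompactSupport ψ
  piecewise_ψ : PiecewiseConstant ψ
  vanishing_moments : ∀ d : ℕ, (d : ℝ) ≤ r → ∫ x, x ^ d * ψ x = 0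
  biorthogonal : ∀ i i' : ℕ × ℤ,
    ∫ x, waveletFamily boxFn ψ i x * waveletFamily φt ψt i' x = if i = i' then 1 else 0
  frame : ∃ c₁ c₂ : ℝ, 0 < c₁ ∧ 0 < c₂ ∧ ∀ f : ℝ → ℝ, MemLp f 2 volume →
    ENNReal.ofReal c₁ * ∑' i : ℕ × ℤ, ‖∫ x, f x * waveletFamily boxFn ψ i x‖ₑ ^ 2
        ≤ eLpNorm f 2 volume ^ 2 ∧
    eLpNorm f 2 volume ^ 2
        ≤ ENNReal.ofReal c₂ * ∑' i : ℕ × ℤ, ‖∫ x, f x * waveletFamily boxFn ψ i x‖ₑ ^ 2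

namespace BiorthogonalWaveletBasis

variable {r : ℝ} (W : BiorthogonalWaveletBasis r)

/-- The decomposition wavelets `ψ_{jk}` (level `-1` is the number `0`). -/
def dec : ℕ × ℤ → ℝ → ℝ := waveletFamily boxFn W.ψ

/-- The reconstruction wavelets (level `-1` is the number `0`). -/
def recon : ℕ × ℤ → ℝ → ℝ := waveletFamily W.φt W.ψt

/-- The wavelet coefficients `β_{jk} = ∫ f ψ_{jk}` (level `-1` is the number `0`). -/
def coeff (f : ℝ → ℝ) (i : ℕ × ℤ) : ℝ := ∫ x, f x * W.dec i x

/-- The Besov sequence norm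
`‖(α_k)‖_{ℓ_p} + ‖(2^{j(α+1/2-1/p)} ‖(β_{jk})_k‖_{ℓ_p})_{j ≥ 0}‖_{ℓ_q}`, with values in `[0,∞]`.
The `ℓ_p` and `ℓ_q` norms are `L^p` and `L^q` norms for the counting measure. -/
def besovNorm (α : ℝ) (p q : ℝ≥0∞) (f : ℝ → ℝ) : ℝ≥0∞ :=
  eLpNorm (fun k : ℤ => W.coeff f (0, k)) p Measure.count +
    eLpNorm (fun j : ℕ => (2 : ℝ≥0∞) ^ ((j : ℝ) * (α + 1 / 2 - (p⁻¹).toReal)) *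
      eLpNorm (fun k : ℤ => W.coeff f (j + 1, k)) p Measure.count) q Measure.count

/-- The Besov ball of radius `R`. -/
def besovBall (α : ℝ) (p q : ℝ≥0∞) (R : ℝ) : Set (ℝ → ℝ) :=
  {f | MemLp f 2 volume ∧ W.besovNorm α p q f ≤ ENNReal.ofReal R}

end BiorthogonalWaveletBasis

/-! ### Densities, estimators and risks -/

/-- `f` is a probability density with respect to Lebesgue measure. -/
def IsDensity (f : ℝ → ℝ) : Prop :=
  Measurable f ∧ (∀ x, 0 ≤ f x) ∧ ∫⁻ x, ENNReal.ofReal (f x) = 1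

/-- Densities whose `L²` norm and `L^∞` norm are at most `R`. -/
def boundedDensities (R : ℝ) : Set (ℝ → ℝ) :=
  {f | IsDensity f ∧ eLpNorm f 2 volume ≤ ENNReal.ofReal R ∧
    eLpNorm f ∞ volume ≤ ENNReal.ofReal R}

/-- The law of an `n`-sample of density `f`. -/
def sampleLaw (n : ℕ) (f : ℝ → ℝ) : Measure (Fin n → ℝ) :=
  Measure.pi fun _ => volume.withDensity fun x => ENNReal.ofReal (f x)

/-- An estimator based on `n` observations: a (jointly measurable) function of the sample with
values in the functions on `ℝ`. -/
def IsEstimator (n : ℕ) (fhat : (Fin n → ℝ) → ℝ → ℝ) : Prop :=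
  Measurable (Function.uncurry fhat)

/-- The quadratic risk `E ‖fhat - f‖₂²` under an `n`-sample of density `f`. -/
def risk (n : ℕ) (fhat : (Fin n → ℝ) → ℝ → ℝ) (f : ℝ → ℝ) : ℝ≥0∞ :=
  ∫⁻ X, eLpNorm (fun x => fhat X x - f x) 2 volume ^ 2 ∂(sampleLaw n f)

/-- The maximal risk of an estimator over a class of functions. -/
def maxRisk (n : ℕ) (F : Set (ℝ → ℝ)) (fhat : (Fin n → ℝ) → ℝ → ℝ) : ℝ≥0∞ :=
  ⨆ f ∈ F, risk n fhat f

/-- The minimax risk over a class of functions. -/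
def minimaxRisk (n : ℕ) (F : Set (ℝ → ℝ)) : ℝ≥0∞ :=
  ⨅ (fhat : (Fin n → ℝ) → ℝ → ℝ) (_ : IsEstimator n fhat), maxRisk n F fhat

/-- The exponent `α / (α + 1/2 + (1/2 - 1/p)₊)`. -/
def rateExponent (α : ℝ) (p : ℝ≥0∞) : ℝ :=
  α / (α + 1 / 2 + max (1 / 2 - (p⁻¹).toReal) 0)

/-! ### The thresholding estimator -/

namespace BiorthogonalWaveletBasis

variable {r : ℝ} (W : BiorthogonalWaveletBasis r)

/-- The empirical coefficient `(1/n) ∑ ψ_{jk}(X_i)`. -/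
def empCoeff {n : ℕ} (X : Fin n → ℝ) (i : ℕ × ℤ) : ℝ :=
  1 / (n : ℝ) * ∑ m, W.dec i (X m)

/-- The unbiased estimator of the variance of `ψ_{jk}(X_1)`. -/
def varHat {n : ℕ} (X : Fin n → ℝ) (i : ℕ × ℤ) : ℝ :=
  1 / ((n : ℝ) * ((n : ℝ) - 1)) *
    ∑ m, ∑ l ∈ Finset.univ.filter (fun l => l < m), (W.dec i (X m) - W.dec i (X l)) ^ 2

/-- The sup norm of `ψ_{jk}`. -/
def supNorm (i : ℕ × ℤ) : ℝ := (eLpNorm (W.dec i) ∞ volume).toReal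

/-- The slight overestimate of the variance. -/
def varTilde (γ : ℝ) {n : ℕ} (X : Fin n → ℝ) (i : ℕ × ℤ) : ℝ :=
  W.varHat X i
    + 2 * W.supNorm i * Real.sqrt (2 * γ * W.varHat X i * (Real.log n / n))
    + 8 * γ * W.supNorm i ^ 2 * (Real.log n / n)

/-- The random threshold. -/
def threshold (γ : ℝ) {n : ℕ} (X : Fin n → ℝ) (i : ℕ × ℤ) : ℝ :=
  Real.sqrt (2 * γ * W.varTilde γ X i * (Real.log n / n))
    + 2 * W.supNorm i * γ * Real.log n / (3 * n)

open Classical in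
/-- The thresholded empirical coefficient. -/
def threshCoeff (γ : ℝ) {n : ℕ} (X : Fin n → ℝ) (i : ℕ × ℤ) : ℝ :=
  if W.threshold γ X i ≤ |W.empCoeff X i| then W.empCoeff X i else 0

/-- The highest resolution level `j₀ = ⌊log₂ ⌊n^c (ln n)^c'⌋⌋`. -/
def topLevel (c c' : ℝ) (n : ℕ) : ℕ :=
  Nat.log 2 ⌊(n : ℝ) ^ c * Real.log n ^ c'⌋₊

/-- The thresholding estimator: the sum over the levels `-1, 0, …, j₀` and over all `k ∈ ℤ`.
Because the reconstruction wavelets have compact support, the sum over `k` has only finitely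
many nonzero terms at every point `x`. -/
def estimator (γ c c' : ℝ) (n : ℕ) (X : Fin n → ℝ) (x : ℝ) : ℝ :=
  ∑ j ∈ Finset.range (topLevel c c' n + 2), ∑' k : ℤ,
    W.threshCoeff γ X (j, k) * W.recon (j, k) x

end BiorthogonalWaveletBasis

end

/-! Upper bound. The frame inequality turns the squared `L²` error into the sum over all indices of
the squared coefficient errors, so each coefficient can be treated alone. Write `L = log n / n`, let
`F` be the probability that `ψ_{jk}(X) ≠ 0` and `b` the sup norm of `ψ_{jk}`, so that `b ^ 2` is at
most of order `2 ^ j`. Choose `γ'` with `c < γ' < γ`. Bernstein's inequality at level `γ' log n`,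
for the mean and for the lower tail of the empirical second moment, shows that outside an event of
probability of order `n ^ (-γ')` the inflated empirical variance exceeds the true variance, and the
deviation of the empirical coefficient is at most `√(γ'/γ) < 1` times the random threshold. Hence
thresholding costs at most a constant times `min (β ^ 2) (2 ^ j F L)`. On the exceptional event the
error is still proportional to `F`: if `n F ≤ 1`, a coefficient survives only when at least `4 γ log
n` observations fall in the support of `ψ_{jk}`, because the threshold is at least `4 γ b L`
(`exists_thresholdedMean_risk_bound`). The factor `F` makes the sum over all `k ∈ ℤ` converge
without any assumption on the support of the density. Summed over the levels, the residual is at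
most of order `L (1 + log n) n ^ (-γ') L ^ (-c)`, which is at most of order `L` because `c < γ'`.

It remains to sum `min (β ^ 2) (2 ^ j F L)` over the levels up to `J`, and `β ^ 2` beyond
(`exists_sequence_bound`). Summing `F` over `k` bounds the noise of a level by `L 2 ^ j`. For `p ≤
2`, boundedness of the density gives `2 ^ j F ≤ D`, and the `ℓ_p` norm controls the truncated
energy; the bias beyond `J` is where the condition on `c` enters. For `p > 2`, the coefficients of a
density have an `ℓ_1` norm of order at most `2 ^ (j/2)`, and interpolation with `ℓ_p` gives the
energy bound `2 ^ (-j α / (1 - 1/p))`. In both regimes the increasing and the decreasing bound cross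
at the value `L ^ ρ`.

Lower bound. Assouad's lemma is applied to a hypercube of densities: a slowly varying base density
plus `M` signed, disjointly supported copies of `ψ̃` at one scale `2 ^ j`
(`exists_minimaxRisk_ge_of_scale`). The base density is a combination of the translates of `φ̃` with
two-sided geometric weights, so its coefficients above the father level vanish exactly. It is
positive because these translates form a partition of unity (`tsum_recon_zero`), itself a
consequence of the frame bounds and of `∫ ψ = 0`. A base density of height `h` has a father-level
norm of at most `h ^ (1 - 1/p)`; for `p = 1` this is the total mass `1`, which is why `R > 1` is
needed there. The resulting bound is of order `2 ^ j / n` with `2 ^ j ≈ n ^ (1 - ρ)`. For `p ≤ 2`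
one takes `M = 2 ^ j` bumps on a set of bounded length; for `p > 2` it is better to take `M = n`
bumps, spread over a length `n / 2 ^ j` where the density is low. -/

/-! ### Piecewise constant functions -/

/-- The position of a point relative to the elements of a finite set. -/
noncomputable def breakpointCode (S : Finset ℝ) (x : ℝ) : S → Prop × Prop :=
  fun s => ((s : ℝ) < x, (s : ℝ) ≤ x)

theorem measurable_breakpointCode (S : Finset ℝ) : Measurable (breakpointCode S) := by
  refine measurable_pi_lambda _ fun s => Measurable.prodMk ?_ ?_
  · exact measurableSet_setOfPred.1 measurableSet_Ioi
  · exact measurableSet_setOfPred.1 measurableSet_Ici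

/-- If `x < y` have the same position relative to every breakpoint, then no breakpoint lies in `[x,
y]`. There are finitely many positions, so measurability and boundedness follow together. -/
theorem PiecewiseConstant.exists_factor {g : ℝ → ℝ} (hg : PiecewiseConstant g) :
    ∃ (S : Finset ℝ) (h : (S → Prop × Prop) → ℝ), g = h ∘ breakpointCode S := by
  obtain ⟨S, hS⟩ := hg
  have key : ∀ x y : ℝ, x ≤ y → breakpointCode S x = breakpointCode S y → g x = g y := by
    intro x y hxy h
    rcases hxy.eq_or_lt with rfl | hlt
    · rfl
    refine hS x y hxy fun s hs hmem => ?_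
    have h1 := congrFun h ⟨s, hs⟩
    simp only [breakpointCode, Prod.mk.injEq, eq_iff_iff] at h1
    have h2 : s ≤ x := h1.2.2 hmem.2
    have h3 : s = x := le_antisymm h2 hmem.1
    have h4 := h1.1.2 (by rw [h3]; exact hlt)
    exact absurd h3 h4.ne
  have hf : Function.FactorsThrough g (breakpointCode S) := by
    intro x y h
    rcases le_total x y with hxy | hxy
    · exact key x y hxy h
    · exact (key y x hxy h.symm).symm
  exact ⟨S, Function.extend (breakpointCode S) g fun _ => 0, (hf.extend_comp _).symm⟩

theorem PiecewiseConstant.measurable {g : ℝ → ℝ} (hg : PiecewiseConstant g) : Measurable g := by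
  obtain ⟨S, h, rfl⟩ := hg.exists_factor
  exact (measurable_of_countable h).comp (measurable_breakpointCode S)

theorem PiecewiseConstant.exists_bound {g : ℝ → ℝ} (hg : PiecewiseConstant g) :
    ∃ B : ℝ, ∀ x, |g x| ≤ B := by
  classical
  obtain ⟨S, h, rfl⟩ := hg.exists_factor
  refine ⟨∑ c, |h c|, fun x => ?_⟩
  exact Finset.single_le_sum (f := fun c => |h c|) (fun _ _ => abs_nonneg _) (Finset.mem_univ _)

theorem HasCompactSupport.exists_abs_le_of_ne_zero {g : ℝ → ℝ} (hg : HasCompactSupport g) :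
    ∃ A : ℝ, ∀ x, g x ≠ 0 → |x| ≤ A := by
  obtain ⟨A, hA⟩ := hg.isCompact.isBounded.exists_norm_le
  exact ⟨A, fun x hx => by simpa using hA x (subset_tsupport _ hx)⟩

/-! ### Dilated families -/

theorem two_rpow_half (j : ℕ) : (2 : ℝ) ^ ((j : ℝ) / 2) = √(2 ^ j) := by
  rw [Real.sqrt_eq_rpow, ← Real.rpow_natCast, ← Real.rpow_mul (by norm_num)]
  congr 1; ring

theorem waveletFamily_zero (φ ψ : ℝ → ℝ) (k : ℤ) (x : ℝ) :
    waveletFamily φ ψ (0, k) x = φ (x - k) := rfl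

theorem waveletFamily_succ (φ ψ : ℝ → ℝ) (j : ℕ) (k : ℤ) (x : ℝ) :
    waveletFamily φ ψ (j + 1, k) x = √(2 ^ j) * ψ (2 ^ j * x - k) := by
  rw [← two_rpow_half]; rfl

/-- Truncated subtraction makes `2 ^ (i.1 - 1)` the scale of every index: the father level (number
`0`) and the first mother level (number `1`) both have scale `1`. This convention is used for all
level bounds below. -/
theorem abs_waveletFamily_le {φ ψ : ℝ → ℝ} {B : ℝ} (hφ : ∀ x, |φ x| ≤ B) (hψ : ∀ x, |ψ x| ≤ B)
    (i : ℕ × ℤ) (x : ℝ) : |waveletFamily φ ψ i x| ≤ B * √(2 ^ (i.1 - 1)) := by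
  obtain ⟨_ | j, k⟩ := i
  · simpa [waveletFamily_zero] using hφ (x - k)
  · rw [waveletFamily_succ, abs_mul, abs_of_nonneg (Real.sqrt_nonneg _), mul_comm]
    exact mul_le_mul_of_nonneg_right (hψ _) (Real.sqrt_nonneg _)

theorem abs_le_of_waveletFamily_ne_zero {φ ψ : ℝ → ℝ} {A : ℝ} (hφ : ∀ x, φ x ≠ 0 → |x| ≤ A)
    (hψ : ∀ x, ψ x ≠ 0 → |x| ≤ A) (i : ℕ × ℤ) (x : ℝ) (h : waveletFamily φ ψ i x ≠ 0) :
    |2 ^ (i.1 - 1) * x - i.2| ≤ A := by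
  obtain ⟨_ | j, k⟩ := i
  · simpa using hφ (x - k) h
  · rw [waveletFamily_succ] at h
    exact hψ _ (right_ne_zero_of_mul h)

theorem measurable_waveletFamily {φ ψ : ℝ → ℝ} (hφ : Measurable φ) (hψ : Measurable ψ)
    (i : ℕ × ℤ) : Measurable (waveletFamily φ ψ i) := by
  obtain ⟨_ | j, k⟩ := i
  · exact hφ.comp (measurable_id.sub_const _)
  · exact (hψ.comp ((measurable_id.const_mul _).sub_const _)).const_mul _

theorem measurable_boxFn : Measurable boxFn := measurable_one.indicator measurableSet_Icc

theorem HolderSmooth.continuous {s : ℝ} {g : ℝ → ℝ} (hg : HolderSmooth s g) : Continuous g :=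
  hg.1.continuous

namespace BiorthogonalWaveletBasis

variable {r : ℝ} (W : BiorthogonalWaveletBasis r)

theorem exists_bounds : ∃ (A : ℕ) (B : ℝ), 1 ≤ A ∧ 1 ≤ B ∧
    (∀ i x, |W.dec i x| ≤ B * √(2 ^ (i.1 - 1))) ∧
    (∀ i x, W.dec i x ≠ 0 → |2 ^ (i.1 - 1) * x - i.2| ≤ A) ∧
    (∀ i x, |W.recon i x| ≤ B * √(2 ^ (i.1 - 1))) ∧
    (∀ i x, W.recon i x ≠ 0 → |2 ^ (i.1 - 1) * x - i.2| ≤ A) := by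
  obtain ⟨B₁, h₁⟩ := W.piecewise_ψ.exists_bound
  obtain ⟨B₂, h₂⟩ := W.smooth_φt.continuous.bounded_above_of_compact_support W.compact_φt
  obtain ⟨B₃, h₃⟩ := W.smooth_ψt.continuous.bounded_above_of_compact_support W.compact_ψt
  obtain ⟨A₁, g₁⟩ := W.compact_ψ.exists_abs_le_of_ne_zero
  obtain ⟨A₂, g₂⟩ := W.compact_φt.exists_abs_le_of_ne_zero
  obtain ⟨A₃, g₃⟩ := W.compact_ψt.exists_abs_le_of_ne_zero
  have hbox : ∀ x, |boxFn x| ≤ 1 := fun x => by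
    unfold boxFn; by_cases hx : x ∈ Set.Icc (0 : ℝ) 1 <;> simp [hx]
  have hboxs : ∀ x, boxFn x ≠ 0 → |x| ≤ 1 := fun x hx => by
    have : x ∈ Set.Icc (0 : ℝ) 1 := Set.mem_of_indicator_ne_zero hx
    rw [abs_of_nonneg this.1]; exact this.2
  obtain ⟨A, hA⟩ := exists_nat_ge (max 1 (max A₁ (max A₂ A₃)))
  simp only [max_le_iff] at hA
  set B := max 1 (max B₁ (max B₂ B₃)) with hB
  have hB1 : 1 ≤ B := le_max_left _ _
  have hB2 : B₁ ≤ B := (le_max_left _ _).trans (le_max_right _ _)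
  have hB3 : B₂ ≤ B := (le_max_left _ _).trans ((le_max_right _ _).trans (le_max_right _ _))
  have hB4 : B₃ ≤ B := (le_max_right _ _).trans ((le_max_right _ _).trans (le_max_right _ _))
  refine ⟨A, B, by exact_mod_cast hA.1, hB1, ?_, ?_, ?_, ?_⟩
  · exact abs_waveletFamily_le (fun x => (hbox x).trans hB1) (fun x => (h₁ x).trans hB2)
  · exact abs_le_of_waveletFamily_ne_zero (fun x hx => (hboxs x hx).trans hA.1)
      (fun x hx => (g₁ x hx).trans hA.2.1)
  · exact abs_waveletFamily_le (fun x => (h₂ x).trans hB3) (fun x => (h₃ x).trans hB4)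
  · exact abs_le_of_waveletFamily_ne_zero (fun x hx => (g₂ x hx).trans hA.2.2.1)
      (fun x hx => (g₃ x hx).trans hA.2.2.2)

theorem measurable_dec (i : ℕ × ℤ) : Measurable (W.dec i) :=
  measurable_waveletFamily measurable_boxFn W.piecewise_ψ.measurable i

theorem measurable_recon (i : ℕ × ℤ) : Measurable (W.recon i) :=
  measurable_waveletFamily W.smooth_φt.continuous.measurable W.smooth_ψt.continuous.measurable i

theorem dec_succ (j : ℕ) (k : ℤ) (x : ℝ) :
    W.dec (j + 1, k) x = √(2 ^ j) * W.ψ (2 ^ j * x - k) := waveletFamily_succ _ _ _ _ _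

theorem recon_succ (j : ℕ) (k : ℤ) (x : ℝ) :
    W.recon (j + 1, k) x = √(2 ^ j) * W.ψt (2 ^ j * x - k) := waveletFamily_succ _ _ _ _ _

theorem recon_zero (k : ℤ) (x : ℝ) : W.recon (0, k) x = W.φt (x - k) := rfl

end BiorthogonalWaveletBasis

/-! ### Dyadic windows with bounded overlap -/

/-- The dyadic interval of relative radius `A` around the position of an index. -/
def dyadicWindow (A : ℕ) (i : ℕ × ℤ) : Set ℝ := {x | |2 ^ (i.1 - 1) * x - i.2| ≤ A}

theorem dyadicWindow_eq (A : ℕ) (i : ℕ × ℤ) : dyadicWindow A i =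
    Set.Icc ((i.2 - A) / 2 ^ (i.1 - 1) : ℝ) ((i.2 + A) / 2 ^ (i.1 - 1)) := by
  ext x
  have h : (0 : ℝ) < 2 ^ (i.1 - 1) := by positivity
  simp only [dyadicWindow, Set.mem_ofPred_eq, Set.mem_Icc, abs_le, div_le_iff₀ h, le_div_iff₀ h]
  constructor <;> rintro ⟨h1, h2⟩ <;> constructor <;> linarith

theorem measurableSet_dyadicWindow (A : ℕ) (i : ℕ × ℤ) : MeasurableSet (dyadicWindow A i) := by
  rw [dyadicWindow_eq]; exact measurableSet_Icc

theorem volume_dyadicWindow (A : ℕ) (i : ℕ × ℤ) :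
    volume (dyadicWindow A i) = ENNReal.ofReal (2 * A / 2 ^ (i.1 - 1)) := by
  rw [dyadicWindow_eq, Real.volume_Icc]; congr 1; ring

theorem finite_windows (A : ℕ) (j : ℕ) (x : ℝ) : {k : ℤ | x ∈ dyadicWindow A (j, k)}.Finite := by
  refine (Set.finite_Icc ⌈2 ^ (j - 1) * x - A⌉ ⌊2 ^ (j - 1) * x + A⌋).subset fun k hk => ?_
  simp only [dyadicWindow, Set.mem_ofPred_eq, abs_le] at hk
  exact ⟨Int.ceil_le.2 (by linarith), Int.le_floor.2 (by linarith)⟩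

/-- At most `2 * A + 1` integers lie within `A` of a given point. Integrated against a probability,
this bounded overlap controls the sum over all `k` of the masses of the windows. -/
theorem tsum_indicator_dyadicWindow_le (A : ℕ) (j : ℕ) (x : ℝ) :
    ∑' k : ℤ, (dyadicWindow A (j, k)).indicator (1 : ℝ → ℝ≥0∞) x ≤ 2 * A + 1 := by
  set s := Finset.Icc ⌈2 ^ (j - 1) * x - A⌉ ⌊2 ^ (j - 1) * x + A⌋ with hs
  rw [tsum_eq_sum (s := s)]
  · calc ∑ k ∈ s, (dyadicWindow A (j, k)).indicator (1 : ℝ → ℝ≥0∞) x ≤ ∑ k ∈ s, 1 := by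
          refine Finset.sum_le_sum fun k _ => ?_
          exact Set.indicator_le_self' (by simp) x
      _ = (s.card : ℝ≥0∞) := by simp
      _ ≤ ((2 * A + 1 : ℕ) : ℝ≥0∞) := by
          rw [Nat.cast_le, hs, Int.card_Icc, Int.toNat_le]
          have h1 := Int.floor_le (2 ^ (j - 1) * x + (A : ℝ))
          have h2 := Int.le_ceil (2 ^ (j - 1) * x - (A : ℝ))
          have : ((⌊2 ^ (j - 1) * x + (A : ℝ)⌋ + 1 - ⌈2 ^ (j - 1) * x - (A : ℝ)⌉ : ℤ) : ℝ)
              ≤ ((2 * A + 1 : ℕ) : ℤ) := by push_cast; linarith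
          exact_mod_cast this
      _ = 2 * A + 1 := by push_cast; rfl
  · intro k hk
    refine Set.indicator_of_notMem (fun hx => hk ?_) _
    simp only [dyadicWindow, Set.mem_ofPred_eq, abs_le] at hx
    exact Finset.mem_Icc.2 ⟨Int.ceil_le.2 (by linarith), Int.le_floor.2 (by linarith)⟩

theorem eLpNorm_two_sq {Ω : Type*} [MeasurableSpace Ω] (μ : Measure Ω) (f : Ω → ℝ) :
    eLpNorm f 2 μ ^ 2 = ∫⁻ x, ‖f x‖ₑ ^ 2 ∂μ := by
  have h := eLpNorm_nnreal_pow_eq_lintegral (f := f) (μ := μ) (p := 2) (by norm_num)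
  simpa using h

/-! ### Frame bounds, biorthogonality and means of the wavelets -/

namespace BiorthogonalWaveletBasis

variable {r : ℝ} (W : BiorthogonalWaveletBasis r)

theorem memLp_of_window {g : ℝ → ℝ} (hg : Measurable g) {A : ℕ} {C : ℝ} {i : ℕ × ℤ}
    (hC : ∀ x, |g x| ≤ C) (hA : ∀ x, g x ≠ 0 → x ∈ dyadicWindow A i) (p : ℝ≥0∞) :
    MemLp g p volume := by
  have h := memLp_indicator_const (μ := (volume : Measure ℝ)) p (measurableSet_dyadicWindow A i) C
    (Or.inr (by rw [volume_dyadicWindow]; exact ENNReal.ofReal_ne_top))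
  refine h.mono hg.aestronglyMeasurable (ae_of_all _ fun x => ?_)
  by_cases hx : g x = 0
  · simp [hx]
  · rw [Set.indicator_of_mem (hA x hx), Real.norm_eq_abs]
    exact (hC x).trans (le_abs_self _)

theorem memLp_dec (i : ℕ × ℤ) (p : ℝ≥0∞) : MemLp (W.dec i) p volume := by
  obtain ⟨A, B, -, -, h1, h2, -, -⟩ := W.exists_bounds
  exact memLp_of_window (W.measurable_dec i) (h1 i) (h2 i) p

theorem memLp_recon (i : ℕ × ℤ) (p : ℝ≥0∞) : MemLp (W.recon i) p volume := by
  obtain ⟨A, B, -, -, -, -, h1, h2⟩ := W.exists_bounds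
  exact memLp_of_window (W.measurable_recon i) (h1 i) (h2 i) p

theorem integrable_mul_dec {f : ℝ → ℝ} (hf : MemLp f 2 volume) (i : ℕ × ℤ) :
    Integrable (fun x => f x * W.dec i x) volume :=
  hf.integrable_mul (W.memLp_dec i 2)

theorem integral_dec_mul_recon (i i' : ℕ × ℤ) :
    ∫ x, W.dec i x * W.recon i' x = if i = i' then 1 else 0 := W.biorthogonal i i'

theorem coeff_recon (i i' : ℕ × ℤ) : W.coeff (W.recon i) i' = if i' = i then 1 else 0 := by
  rw [← W.integral_dec_mul_recon i' i, coeff]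
  simp_rw [mul_comm]

theorem coeff_sub {f g : ℝ → ℝ} (hf : MemLp f 2 volume) (hg : MemLp g 2 volume) (i : ℕ × ℤ) :
    W.coeff (fun x => f x - g x) i = W.coeff f i - W.coeff g i := by
  simp only [coeff, sub_mul]
  exact integral_sub (W.integrable_mul_dec hf i) (W.integrable_mul_dec hg i)

theorem coeff_add {f g : ℝ → ℝ} (hf : MemLp f 2 volume) (hg : MemLp g 2 volume) (i : ℕ × ℤ) :
    W.coeff (fun x => f x + g x) i = W.coeff f i + W.coeff g i := by
  simp only [coeff, add_mul]
  exact integral_add (W.integrable_mul_dec hf i) (W.integrable_mul_dec hg i)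

theorem memLp_sum_recon (s : Finset (ℕ × ℤ)) (b : ℕ × ℤ → ℝ) (p : ℝ≥0∞) :
    MemLp (fun x => ∑ i ∈ s, b i * W.recon i x) p volume :=
  memLp_finsetSum s fun i _ => (W.memLp_recon i p).const_mul (b i)

theorem coeff_sum_recon (s : Finset (ℕ × ℤ)) (b : ℕ × ℤ → ℝ) (i' : ℕ × ℤ) :
    W.coeff (fun x => ∑ i ∈ s, b i * W.recon i x) i' = if i' ∈ s then b i' else 0 := by
  have h : ∀ i, ∫ x, b i * W.recon i x * W.dec i' x = b i * if i' = i then 1 else 0 := by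
    intro i
    rw [← W.coeff_recon i i', coeff, ← integral_const_mul]
    simp_rw [mul_assoc]
  simp only [coeff, Finset.sum_mul]
  rw [integral_finsetSum s fun i _ =>
    W.integrable_mul_dec ((W.memLp_recon i 2).const_mul (b i)) i']
  simp [h]

/-- The second inequality is the upper frame bound for a finite expansion minus `f`, whose
coefficients are known by biorthogonality. No expansion of `f` itself is required. -/
theorem exists_riesz_bounds : ∃ c₁ c₂ : ℝ, 0 < c₁ ∧ 0 < c₂ ∧
    (∀ f : ℝ → ℝ, MemLp f 2 volume →
      ENNReal.ofReal c₁ * ∑' i, ‖W.coeff f i‖ₑ ^ 2 ≤ eLpNorm f 2 volume ^ 2) ∧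
    ∀ f : ℝ → ℝ, MemLp f 2 volume → ∀ (s : Finset (ℕ × ℤ)) (b : ℕ × ℤ → ℝ),
      eLpNorm (fun x => ∑ i ∈ s, b i * W.recon i x - f x) 2 volume ^ 2 ≤
        ENNReal.ofReal c₂ * ∑' i, ‖(if i ∈ s then b i else 0) - W.coeff f i‖ₑ ^ 2 := by
  obtain ⟨c₁, c₂, h1, h2, h⟩ := W.frame
  refine ⟨c₁, c₂, h1, h2, fun f hf => (h f hf).1, fun f hf s b => ?_⟩
  have := (h _ ((W.memLp_sum_recon s b 2).sub hf)).2
  refine this.trans_eq ?_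
  congr 2
  ext i
  rw [← W.coeff_sum_recon, ← W.coeff_sub (W.memLp_sum_recon s b 2) hf]
  rfl

theorem integral_ψ (hr : 0 < r) : ∫ x, W.ψ x = 0 := by
  simpa using W.vanishing_moments 0 (by simpa using hr.le)

theorem integral_comp_dilation (g : ℝ → ℝ) (j : ℕ) (k : ℤ) :
    ∫ x, g (2 ^ j * x - k) = (2 ^ j)⁻¹ * ∫ x, g x := by
  rw [Measure.integral_comp_mul_left (fun y => g (y - k)) (2 ^ j),
    integral_sub_right_eq_self, smul_eq_mul, abs_of_pos (by positivity)]

theorem integral_dec (hr : 0 < r) (i : ℕ × ℤ) :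
    ∫ x, W.dec i x = if i.1 = 0 then 1 else 0 := by
  obtain ⟨_ | j, k⟩ := i
  · have : ∀ x, W.dec (0, k) x = boxFn (x - k) := fun x => rfl
    simp_rw [this]
    rw [integral_sub_right_eq_self (fun x => boxFn x)]
    simp [boxFn, integral_indicator]
  · simp_rw [dec_succ, integral_const_mul]
    rw [integral_comp_dilation, W.integral_ψ hr]
    simp

theorem integral_sq_recon_succ (j : ℕ) (k : ℤ) :
    ∫ x, W.recon (j + 1, k) x ^ 2 = ∫ x, W.ψt x ^ 2 := by
  simp_rw [recon_succ, mul_pow, integral_const_mul]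
  rw [integral_comp_dilation (fun x => W.ψt x ^ 2), Real.sq_sqrt (by positivity), ← mul_assoc,
    mul_inv_cancel₀ (by positivity), one_mul]

/-- If `ψ̃` vanished almost everywhere, its pairing with `ψ` could not be `1`. -/
theorem integral_sq_ψt_pos : 0 < ∫ x, W.ψt x ^ 2 := by
  have hrec : ∀ x, W.recon (1, 0) x = W.ψt x := fun x => by simpa using W.recon_succ 0 0 x
  have h2 : Integrable (fun x => W.ψt x ^ 2) volume := by
    simpa [hrec] using (W.memLp_recon (1, 0) 2).integrable_sq
  refine lt_of_le_of_ne (integral_nonneg fun x => sq_nonneg _) fun h => ?_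
  have h3 := (integral_eq_zero_iff_of_nonneg (fun x => sq_nonneg (W.ψt x)) h2).1 h.symm
  have h4 := W.integral_dec_mul_recon (1, 0) (1, 0)
  rw [integral_eq_zero_of_ae] at h4
  · simp at h4
  · filter_upwards [h3] with x hx
    simp only [Pi.zero_apply, pow_eq_zero_iff, ne_eq, OfNat.ofNat_ne_zero, not_false_eq_true] at hx
    simp [hrec, hx]

/-- The boxes are closed and overlap at the integers, so the identity is only claimed almost
everywhere. -/
theorem sum_boxFn_ae (N : ℕ) : ∀ᵐ x : ℝ, |x| ≤ N →
    ∑ k ∈ Finset.Ico (-N : ℤ) N, W.dec (0, k) x = 1 := by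
  have hc : (Set.range ((↑) : ℤ → ℝ)).Countable := Set.countable_range _
  filter_upwards [hc.ae_notMem (volume : Measure ℝ)] with x hx hxN
  rw [abs_le] at hxN
  have hne : ∀ k : ℤ, (k : ℝ) ≠ x := fun k hk => hx ⟨k, hk⟩
  have h1 : ⌊x⌋ ∈ Finset.Ico (-N : ℤ) N := by
    rw [Finset.mem_Ico, Int.le_floor, Int.floor_lt]
    push_cast
    exact ⟨hxN.1, lt_of_le_of_ne hxN.2 fun h => hne N (by simpa using h.symm)⟩
  rw [Finset.sum_eq_single_of_mem _ h1]
  · change boxFn (x - ⌊x⌋) = 1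
    have : x - ⌊x⌋ ∈ Set.Icc (0 : ℝ) 1 :=
      ⟨by linarith [Int.floor_le x], by linarith [Int.lt_floor_add_one x]⟩
    rw [boxFn, Set.indicator_of_mem this, Pi.one_apply]
  · intro k _ hk
    change boxFn (x - k) = 0
    refine Set.indicator_of_notMem (fun h => hk ?_) _
    refine (Int.floor_eq_iff.2 ⟨by linarith [h.1], lt_of_le_of_ne (by linarith [h.2]) fun h' => ?_⟩).symm
    exact hne (k + 1) (by push_cast; exact h'.symm)

/-- On the support of the reconstruction wavelet the constant `1` is a finite sum of boxes, so the
integral is a sum of biorthogonality relations. -/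
theorem integral_recon (i : ℕ × ℤ) : ∫ x, W.recon i x = if i.1 = 0 then 1 else 0 := by
  obtain ⟨A, B, -, -, -, -, -, h2⟩ := W.exists_bounds
  -- The first bound makes `[-N, N]` contain the support; the second puts `i.2` into the half-open
  -- range of summation.
  obtain ⟨N, hN⟩ := exists_nat_ge (max (|(i.2 : ℝ)| + A) (|(i.2 : ℝ)| + 1))
  rw [max_le_iff] at hN
  have hx : ∀ x, W.recon i x ≠ 0 → |x| ≤ N := by
    intro x hx
    have h := h2 i x hx
    have h1 : (1 : ℝ) ≤ 2 ^ (i.1 - 1) := one_le_pow₀ (by norm_num)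
    have h3 : |x| ≤ |2 ^ (i.1 - 1) * x| := by
      rw [abs_mul, abs_of_nonneg (by positivity : (0 : ℝ) ≤ 2 ^ (i.1 - 1))]
      nlinarith [abs_nonneg x]
    have h4 := abs_sub_abs_le_abs_sub (2 ^ (i.1 - 1) * x) (i.2 : ℝ)
    linarith [hN.1]
  have h : ∫ x, W.recon i x
      = ∫ x, ∑ k ∈ Finset.Ico (-N : ℤ) N, W.dec (0, k) x * W.recon i x := by
    refine integral_congr_ae ?_
    filter_upwards [W.sum_boxFn_ae N] with x h
    rw [← Finset.sum_mul]
    by_cases h0 : W.recon i x = 0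
    · simp [h0]
    · rw [h (hx x h0), one_mul]
  rw [h, integral_finsetSum]
  swap
  · exact fun k _ => (W.memLp_dec (0, k) 2).integrable_mul (W.memLp_recon i 2)
  simp_rw [integral_dec_mul_recon]
  obtain ⟨j, k⟩ := i
  rcases j with _ | j
  · have hk : k ∈ Finset.Ico (-N : ℤ) N := by
      have := abs_le.1 (show |(k : ℝ)| ≤ N - 1 by linarith [hN.2])
      rw [Finset.mem_Ico]
      constructor
      · have : ((-N : ℤ) : ℝ) ≤ k := by push_cast; linarith
        exact_mod_cast this
      · have : (k : ℝ) < (N : ℤ) := by push_cast; linarith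
        exact_mod_cast this
    simp only [Prod.mk.injEq, true_and, Finset.sum_ite_eq', if_true]
    rw [if_pos hk]
  · simp

/-! ### The reconstruction father wavelet generates a partition of unity -/

/-- Seen from `[-1, 1]`, the coefficients of a long indicator `g` are those of the constant `1`: one
on the father level, zero on the others because `∫ ψ = 0`. Every large partial expansion of `g`
therefore agrees there with the sum `P` of translates of `φ̃`, while the frame bound forces these
expansions to converge to `g` in `L²`. So `P = 1` almost everywhere on `[-1, 1]`, and continuity
removes the exceptional set. -/
theorem sum_recon_zero_local (hr : 0 < r) {A : ℕ} (hA : 1 ≤ A)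
    (hd : ∀ i x, W.dec i x ≠ 0 → |2 ^ (i.1 - 1) * x - i.2| ≤ A)
    (hre : ∀ i x, W.recon i x ≠ 0 → |2 ^ (i.1 - 1) * x - i.2| ≤ A) (x : ℝ)
    (hx : x ∈ Set.Ioo (-1 : ℝ) 1) :
    ∑ k ∈ Finset.Icc (-(A + 1) : ℤ) (A + 1), W.recon (0, k) x = 1 := by
  set K := Finset.Icc (-(A + 1) : ℤ) (A + 1) with hK
  -- If a reconstruction wavelet meets `[-1, 1]`, the decomposition wavelet of the same index lives
  -- within `2 * A` of that point.
  set g : ℝ → ℝ := Set.indicator (Set.Icc (-(2 * A + 1) : ℝ) (2 * A + 1)) 1 with hg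
  have hgL : MemLp g 2 volume := memLp_indicator_const (c := (1 : ℝ)) 2 measurableSet_Icc
    (Or.inr (by rw [Real.volume_Icc]; exact ENNReal.ofReal_ne_top))
  have hcoeff : ∀ i y, |y| ≤ 1 → W.recon i y ≠ 0 → W.coeff g i = if i.1 = 0 then 1 else 0 := by
    intro i y hy hi
    rw [← W.integral_dec hr i, coeff]
    congr 1; ext z
    by_cases hz : W.dec i z = 0
    · simp [hz]
    · have h1 := hd i z hz
      have h2 := hre i y hi
      have h3 : (1 : ℝ) ≤ 2 ^ (i.1 - 1) := one_le_pow₀ (by norm_num)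
      have h4 : |2 ^ (i.1 - 1) * (z - y)| ≤ 2 * A := by
        have := abs_sub (2 ^ (i.1 - 1) * z - (i.2 : ℝ)) (2 ^ (i.1 - 1) * y - i.2)
        rw [show 2 ^ (i.1 - 1) * (z - y)
          = (2 ^ (i.1 - 1) * z - (i.2 : ℝ)) - (2 ^ (i.1 - 1) * y - i.2) by ring]
        linarith
      have h5 : |z - y| ≤ 2 * A := by
        rw [abs_mul, abs_of_nonneg (by positivity : (0 : ℝ) ≤ 2 ^ (i.1 - 1))] at h4
        nlinarith [abs_nonneg (z - y)]
      have : z ∈ Set.Icc (-(2 * A + 1) : ℝ) (2 * A + 1) := by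
        rw [abs_le] at h5 hy
        exact ⟨by linarith [h5.1, hy.1], by linarith [h5.2, hy.2]⟩
      rw [hg, Set.indicator_of_mem this, Pi.one_apply, one_mul]
  have hvan : ∀ k : ℤ, k ∉ K → ∀ y, |y| ≤ 1 → W.recon (0, k) y = 0 := by
    intro k hk y hy
    by_contra hne
    have h := abs_le.1 (hre (0, k) y hne)
    rw [abs_le] at hy
    simp only [zero_tsub, pow_zero, one_mul] at h
    apply hk
    rw [hK, Finset.mem_Icc]
    constructor
    · have : ((-(A + 1) : ℤ) : ℝ) ≤ k := by push_cast; linarith [h.2, hy.1]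
      exact_mod_cast this
    · have : (k : ℝ) ≤ ((A + 1 : ℤ) : ℝ) := by push_cast; linarith [h.1, hy.2]
      exact_mod_cast this
  set P : ℝ → ℝ := fun y => ∑ k ∈ K, W.recon (0, k) y with hP
  set s₀ : Finset (ℕ × ℤ) := K.map ⟨fun k => (0, k), fun a b h => by simpa using h⟩ with hs₀
  have hpart : ∀ s : Finset (ℕ × ℤ), s₀ ⊆ s → ∀ y, |y| ≤ 1 →
      ∑ i ∈ s, W.coeff g i * W.recon i y = P y := by
    intro s hs y hy
    rw [hP, ← Finset.sum_subset hs]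
    · rw [hs₀, Finset.sum_map]
      refine Finset.sum_congr rfl fun k _ => ?_
      change W.coeff g (0, k) * W.recon (0, k) y = _
      by_cases h0 : W.recon (0, k) y = 0
      · simp [h0]
      · rw [hcoeff _ y hy h0]; simp
    · rintro ⟨j, k⟩ _ hi
      by_cases h0 : W.recon (j, k) y = 0
      · simp [h0]
      · rw [hcoeff _ y hy h0]
        rcases j with _ | j
        · exfalso
          apply h0
          refine hvan k (fun hk => hi ?_) y hy
          rw [hs₀, Finset.mem_map]
          exact ⟨k, hk, rfl⟩
        · simp
  obtain ⟨c₁, c₂, hc₁, hc₂, hlow, hup⟩ := W.exists_riesz_bounds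
  have hsum : ∑' i, ‖W.coeff g i‖ₑ ^ 2 ≠ ∞ := by
    intro htop
    have h := hlow g hgL
    rw [htop, ENNReal.mul_top (by simpa using hc₁), top_le_iff] at h
    exact (ENNReal.pow_ne_top hgL.2.ne) h
  have hbound : ∀ s : Finset (ℕ × ℤ), s₀ ⊆ s →
      ∫⁻ y in Set.Icc (-1 : ℝ) 1, ‖P y - 1‖ₑ ^ 2 ≤
        ENNReal.ofReal c₂ * ∑' i : {i // i ∉ s}, ‖W.coeff g i‖ₑ ^ 2 := by
    intro s hs
    have h1 := hup g hgL s (W.coeff g)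
    have h2 : ∑' i, ‖(if i ∈ s then W.coeff g i else 0) - W.coeff g i‖ₑ ^ 2
        = ∑' i : {i // i ∉ s}, ‖W.coeff g i‖ₑ ^ 2 := by
      rw [← Function.Injective.tsum_eq (g := fun i : {i // i ∉ s} => (i : ℕ × ℤ))
        Subtype.val_injective (f := fun i : ℕ × ℤ =>
        ‖(if i ∈ s then W.coeff g i else 0) - W.coeff g i‖ₑ ^ 2)]
      · exact tsum_congr fun i => by simp [i.2]
      · intro i hi
        by_cases his : i ∈ s
        · simp [his] at hi
        · exact ⟨⟨i, his⟩, rfl⟩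
    rw [h2] at h1
    refine le_trans ?_ h1
    rw [eLpNorm_two_sq]
    refine le_trans (le_of_eq ?_) (setLIntegral_le_lintegral (Set.Icc (-1 : ℝ) 1) _)
    refine setLIntegral_congr_fun measurableSet_Icc fun y hy => ?_
    have hy1 : |y| ≤ 1 := abs_le.2 hy
    have hgy : g y = 1 := by
      have : y ∈ Set.Icc (-(2 * A + 1) : ℝ) (2 * A + 1) := by
        have : (0 : ℝ) ≤ A := by positivity
        exact ⟨by linarith [hy.1], by linarith [hy.2]⟩
      rw [hg, Set.indicator_of_mem this, Pi.one_apply]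
    simp only [hpart s hs y hy1, hgy]
  -- The integral does not depend on `s`, and the tail of the square-summable coefficients tends to
  -- zero.
  have hzero : ∫⁻ y in Set.Icc (-1 : ℝ) 1, ‖P y - 1‖ₑ ^ 2 = 0 := by
    have ht := ENNReal.Tendsto.const_mul (a := ENNReal.ofReal c₂)
      (ENNReal.tendsto_tsum_compl_atTop_zero hsum) (Or.inr ENNReal.ofReal_ne_top)
    rw [mul_zero] at ht
    refine le_antisymm (ge_of_tendsto ht ?_) zero_le
    filter_upwards [eventually_ge_atTop s₀] with s hs using hbound s hs
  have hPc : Continuous P := continuous_finsetSum _ fun k _ =>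
    W.smooth_φt.continuous.comp (continuous_id.sub continuous_const)
  rw [lintegral_eq_zero_iff (by fun_prop)] at hzero
  have hae : P =ᵐ[volume.restrict (Set.Ioo (-1 : ℝ) 1)] fun _ => 1 := by
    filter_upwards [ae_restrict_of_ae_restrict_of_subset Set.Ioo_subset_Icc_self hzero] with y hy
    simpa [sub_eq_zero] using hy
  exact Measure.eqOn_open_of_ae_eq hae isOpen_Ioo hPc.continuousOn continuousOn_const hx

/-- Translation by `⌊x⌋` permutes the father indices and reduces to the fractional part of `x`,
which lies in the interval already treated. -/
theorem tsum_recon_zero (hr : 0 < r) (x : ℝ) : ∑' k : ℤ, W.recon (0, k) x = 1 := by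
  obtain ⟨A, B, hA, -, -, hd, -, hre⟩ := W.exists_bounds
  have hfr : Int.fract x ∈ Set.Ioo (-1 : ℝ) 1 :=
    ⟨by linarith [Int.fract_nonneg x], Int.fract_lt_one x⟩
  rw [← W.sum_recon_zero_local hr hA hd hre _ hfr,
    ← (Equiv.addRight ⌊x⌋).tsum_eq (fun k : ℤ => W.recon (0, k) x)]
  have : ∀ k : ℤ, W.recon (0, Equiv.addRight ⌊x⌋ k) x = W.recon (0, k) (Int.fract x) := by
    intro k
    simp only [recon_zero, Equiv.coe_addRight, Int.cast_add, Int.fract]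
    congr 1; ring
  simp_rw [this]
  refine tsum_eq_sum fun k hk => ?_
  by_contra hne
  have h := abs_le.1 (hre (0, k) _ hne)
  simp only [zero_tsub, pow_zero, one_mul] at h
  apply hk
  rw [Finset.mem_Icc]
  constructor
  · have : ((-(A + 1) : ℤ) : ℝ) ≤ k := by push_cast; linarith [h.2, hfr.1]
    exact_mod_cast this
  · have : (k : ℝ) ≤ ((A + 1 : ℤ) : ℝ) := by push_cast; linarith [h.1, hfr.2]
    exact_mod_cast this

end BiorthogonalWaveletBasis

/-! ### Integrals of products over product spaces -/

theorem lintegral_pi_prod {Ω : Type*} [MeasurableSpace Ω] (μ : Measure Ω) [SigmaFinite μ] :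
    ∀ (n : ℕ) (f : Fin n → Ω → ℝ≥0∞), (∀ i, Measurable (f i)) →
      ∫⁻ x, ∏ i, f i (x i) ∂(Measure.pi fun _ : Fin n => μ) = ∏ i, ∫⁻ x, f i x ∂μ := by
  intro n
  induction n with
  | zero =>
    intro f _
    simp
  | succ n ih =>
    intro f hf
    have hmp := (measurePreserving_piFinSuccAbove (fun _ : Fin (n + 1) => μ) 0).symm
    rw [← hmp.lintegral_comp_emb (MeasurableEquiv.measurableEmbedding _)]
    simp only [Fin.prod_univ_succ]
    have h1 : ∀ a : Ω × (Fin n → Ω),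
        f 0 (((MeasurableEquiv.piFinSuccAbove (fun _ : Fin (n + 1) => Ω) 0).symm a) 0) *
          ∏ i : Fin n, f i.succ
            (((MeasurableEquiv.piFinSuccAbove (fun _ : Fin (n + 1) => Ω) 0).symm a) i.succ)
        = f 0 a.1 * ∏ i : Fin n, f i.succ (a.2 i) := fun a => rfl
    simp_rw [h1]
    have hm : Measurable fun y : Fin n → Ω => ∏ i : Fin n, f i.succ (y i) :=
      Finset.measurable_fun_prod _ fun i _ => (hf i.succ).comp (measurable_pi_apply i)
    rw [← ih (fun i => f i.succ) fun i => hf i.succ]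
    exact lintegral_prod_mul (hf 0).aemeasurable hm.aemeasurable

/-! ### Exponential moments and deviation bounds -/

/-- From the second order on, `(k + 2)! ≥ 2 * 3 ^ k` bounds the exponential series by a geometric
one of ratio `b / 3`. -/
theorem Real.exp_le_bernstein {x b : ℝ} (hx : |x| ≤ b) (hb : b < 3) :
    Real.exp x ≤ 1 + x + x ^ 2 / (2 * (1 - b / 3)) := by
  have hb0 : 0 ≤ b := (abs_nonneg x).trans hx
  have hs := Real.summable_pow_div_factorial x
  have hexp : Real.exp x = ∑' k : ℕ, x ^ k / (k.factorial : ℝ) := by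
    rw [Real.exp_eq_exp_ℝ, NormedSpace.exp_eq_tsum_div]
  have hs2 : Summable fun k : ℕ => x ^ (k + 2) / ((k + 2).factorial : ℝ) :=
    (summable_nat_add_iff 2).2 hs
  have hg : Summable fun k : ℕ => x ^ 2 / 2 * (b / 3) ^ k :=
    (summable_geometric_of_lt_one (by positivity) (by linarith)).mul_left _
  rw [hexp, ← hs.sum_add_tsum_nat_add 2]
  have hle : ∑' k : ℕ, x ^ (k + 2) / ((k + 2).factorial : ℝ) ≤ ∑' k : ℕ, x ^ 2 / 2 * (b / 3) ^ k := by
    refine hs2.tsum_le_tsum (fun k => ?_) hg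
    have hfac : (2 : ℝ) * 3 ^ k ≤ ((k + 2).factorial : ℝ) := by
      have := Nat.factorial_mul_pow_le_factorial (m := 2) (n := k)
      rw [add_comm k 2]
      exact_mod_cast this
    calc x ^ (k + 2) / ((k + 2).factorial : ℝ) ≤ |x ^ (k + 2) / ((k + 2).factorial : ℝ)| :=
          le_abs_self _
      _ = x ^ 2 * |x| ^ k / ((k + 2).factorial : ℝ) := by
          rw [abs_div, abs_pow, Nat.abs_cast, pow_add, sq_abs, mul_comm]
      _ ≤ x ^ 2 * b ^ k / (2 * 3 ^ k) := by gcongr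
      _ = x ^ 2 / 2 * (b / 3) ^ k := by rw [div_pow]; ring
  rw [tsum_mul_left, tsum_geometric_of_lt_one (by positivity) (by linarith)] at hle
  have h3 : x ^ 2 / 2 * (1 - b / 3)⁻¹ = x ^ 2 / (2 * (1 - b / 3)) := by
    rw [← div_eq_mul_inv, div_div]
  rw [h3] at hle
  have h4 : ∑ k ∈ Finset.range 2, x ^ k / (k.factorial : ℝ) = 1 + x := by
    simp [Finset.sum_range_succ]
  rw [h4]
  linarith

section Deviation

variable {Ω : Type*} [MeasurableSpace Ω] {μ : Measure Ω} [IsProbabilityMeasure μ]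

theorem Measurable.integrable_of_ae_bound {Y : Ω → ℝ} (hY : Measurable Y) {B : ℝ}
    (hB : ∀ᵐ x ∂μ, |Y x| ≤ B) : Integrable Y μ :=
  Integrable.of_bound hY.aestronglyMeasurable B hB

/-- Integrating the pointwise inequality removes the linear term, since `Y` is centred; `1 + y ≤ exp
y` does the rest. -/
theorem lintegral_exp_le {Y : Ω → ℝ} (hY : Measurable Y) {B v t : ℝ} (hB : ∀ᵐ x ∂μ, |Y x| ≤ B)
    (h0 : ∫ x, Y x ∂μ = 0) (hv : ∫ x, Y x ^ 2 ∂μ ≤ v) (ht : |t| * B < 3) :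
    ∫⁻ x, ENNReal.ofReal (Real.exp (t * Y x)) ∂μ
      ≤ ENNReal.ofReal (Real.exp (v * t ^ 2 / (2 * (1 - |t| * B / 3)))) := by
  have hYi := hY.integrable_of_ae_bound hB
  have hY2 : Integrable (fun x => Y x ^ 2) μ := by
    refine (hY.pow_const 2).integrable_of_ae_bound (B := B ^ 2) ?_
    filter_upwards [hB] with x hx
    rw [abs_pow]
    exact pow_le_pow_left₀ (abs_nonneg _) hx 2
  have hpos : 0 < 1 - |t| * B / 3 := by linarith
  set K := t ^ 2 / (2 * (1 - |t| * B / 3)) with hK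
  have hK0 : 0 ≤ K := by positivity
  have hle : ∀ᵐ x ∂μ, Real.exp (t * Y x) ≤ 1 + t * Y x + K * Y x ^ 2 := by
    filter_upwards [hB] with x hx
    have h1 : |t * Y x| ≤ |t| * B := by
      rw [abs_mul]; exact mul_le_mul_of_nonneg_left hx (abs_nonneg _)
    refine (Real.exp_le_bernstein h1 ht).trans_eq ?_
    rw [hK]; ring
  have hint : Integrable (fun x => 1 + t * Y x + K * Y x ^ 2) μ :=
    ((integrable_const 1).add (hYi.const_mul t)).add (hY2.const_mul K)
  calc ∫⁻ x, ENNReal.ofReal (Real.exp (t * Y x)) ∂μ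
      ≤ ∫⁻ x, ENNReal.ofReal (1 + t * Y x + K * Y x ^ 2) ∂μ := by
        refine lintegral_mono_ae ?_
        filter_upwards [hle] with x hx using ENNReal.ofReal_le_ofReal hx
    _ = ENNReal.ofReal (∫ x, 1 + t * Y x + K * Y x ^ 2 ∂μ) := by
        refine (ofReal_integral_eq_lintegral_ofReal hint ?_).symm
        filter_upwards [hle] with x hx using (Real.exp_pos _).le.trans hx
    _ ≤ _ := by
        refine ENNReal.ofReal_le_ofReal ?_
        have hI : ∫ x, 1 + t * Y x + K * Y x ^ 2 ∂μ
            = ∫ _, (1 : ℝ) ∂μ + ∫ x, t * Y x ∂μ + ∫ x, K * Y x ^ 2 ∂μ := by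
          rw [← integral_add (integrable_const 1) (hYi.const_mul t)]
          exact integral_add ((integrable_const 1).add (hYi.const_mul t)) (hY2.const_mul K)
        rw [hI, integral_const_mul, integral_const_mul, h0]
        have h2 := Real.add_one_le_exp (K * v)
        have h3 : K * ∫ x, Y x ^ 2 ∂μ ≤ K * v := mul_le_mul_of_nonneg_left hv hK0
        have h4 : v * t ^ 2 / (2 * (1 - |t| * B / 3)) = K * v := by rw [hK]; ring
        rw [h4]
        simp only [integral_const, probReal_univ, smul_eq_mul, mul_one, mul_zero, add_zero]
        linarith

theorem measure_pi_sum_ge_le (n : ℕ) {h : Ω → ℝ} (hh : Measurable h) {s : ℝ} (a : ℝ)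
    (hs : ∫⁻ x, ENNReal.ofReal (Real.exp (h x)) ∂μ ≤ ENNReal.ofReal (Real.exp s)) :
    (Measure.pi fun _ : Fin n => μ) {X | a ≤ ∑ i, h (X i)} ≤ ENNReal.ofReal (Real.exp (n * s - a)) := by
  have hsum : Measurable fun X : Fin n → Ω => ∑ i, h (X i) :=
    Finset.measurable_fun_sum _ fun i _ => hh.comp (measurable_pi_apply i)
  have h1 := mul_meas_ge_le_lintegral (μ := Measure.pi fun _ : Fin n => μ)
    (f := fun X => ENNReal.ofReal (Real.exp (∑ i, h (X i))))
    (hsum.exp.ennreal_ofReal) (ENNReal.ofReal (Real.exp a))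
  have h2 : ∫⁻ X, ENNReal.ofReal (Real.exp (∑ i, h (X i))) ∂(Measure.pi fun _ : Fin n => μ)
      ≤ ENNReal.ofReal (Real.exp (n * s)) := by
    have : ∀ X : Fin n → Ω, ENNReal.ofReal (Real.exp (∑ i, h (X i)))
        = ∏ i, ENNReal.ofReal (Real.exp (h (X i))) := fun X => by
      rw [Real.exp_sum, ENNReal.ofReal_prod_of_nonneg fun i _ => (Real.exp_pos _).le]
    simp_rw [this]
    rw [lintegral_pi_prod μ n (fun _ x => ENNReal.ofReal (Real.exp (h x)))
      fun _ => hh.exp.ennreal_ofReal]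
    simp only [Finset.prod_const, Finset.card_univ, Fintype.card_fin]
    calc _ ≤ (ENNReal.ofReal (Real.exp s)) ^ n := by gcongr
      _ = _ := by rw [← ENNReal.ofReal_pow (Real.exp_pos _).le, ← Real.exp_nat_mul]
  have h3 : {X : Fin n → Ω | a ≤ ∑ i, h (X i)}
      ⊆ {X | ENNReal.ofReal (Real.exp a) ≤ ENNReal.ofReal (Real.exp (∑ i, h (X i)))} := by
    intro X hX
    exact ENNReal.ofReal_le_ofReal (Real.exp_le_exp.2 hX)
  have hpos : ENNReal.ofReal (Real.exp a) ≠ 0 := by simpa using Real.exp_pos a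
  rw [Real.exp_sub, ENNReal.ofReal_div_of_pos (Real.exp_pos a), ENNReal.le_div_iff_mul_le
    (Or.inl hpos) (Or.inl ENNReal.ofReal_ne_top), mul_comm]
  exact (mul_le_mul_right (measure_mono h3) _).trans (h1.trans h2)

/-- Chernoff's method; the optimal parameter involves a division by the variance, hence the separate
treatment of zero variance. -/
theorem bernstein_upper {n : ℕ} (hn : 0 < n) {Y : Ω → ℝ} (hY : Measurable Y) {B v u : ℝ} (hB0 : 0 < B)
    (hB : ∀ᵐ x ∂μ, |Y x| ≤ B) (h0 : ∫ x, Y x ∂μ = 0) (hv : ∫ x, Y x ^ 2 ∂μ = v) (hu : 0 < u) :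
    (Measure.pi fun _ : Fin n => μ) {X | √(2 * n * v * u) + B * u / 3 ≤ ∑ i, Y (X i)}
      ≤ ENNReal.ofReal (Real.exp (-u)) := by
  have hv0 : 0 ≤ v := hv ▸ integral_nonneg fun x => sq_nonneg _
  have hY2 : Integrable (fun x => Y x ^ 2) μ := by
    refine (hY.pow_const 2).integrable_of_ae_bound (B := B ^ 2) ?_
    filter_upwards [hB] with x hx
    rw [abs_pow]
    exact pow_le_pow_left₀ (abs_nonneg _) hx 2
  have chern : ∀ t : ℝ, 0 < t → ∀ s : ℝ,
      ∫⁻ x, ENNReal.ofReal (Real.exp (t * Y x)) ∂μ ≤ ENNReal.ofReal (Real.exp s) →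
      n * s - t * (√(2 * n * v * u) + B * u / 3) ≤ -u →
      (Measure.pi fun _ : Fin n => μ) {X | √(2 * n * v * u) + B * u / 3 ≤ ∑ i, Y (X i)}
      ≤ ENNReal.ofReal (Real.exp (-u)) := by
    intro t ht s hs hle
    refine (measure_mono fun X hX => ?_).trans
      ((measure_pi_sum_ge_le n (hY.const_mul t) (t * (√(2 * n * v * u) + B * u / 3)) hs).trans
        (ENNReal.ofReal_le_ofReal (Real.exp_le_exp.2 hle)))
    simp only [Set.mem_ofPred_eq] at hX ⊢
    rw [← Finset.mul_sum]
    exact mul_le_mul_of_nonneg_left hX ht.le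
  rcases eq_or_lt_of_le hv0 with hv1 | hv1
  · have hz : ∀ᵐ x ∂μ, Y x = 0 := by
      have := (integral_eq_zero_iff_of_nonneg (fun x => sq_nonneg (Y x)) hY2).1 (by rw [hv, ← hv1])
      filter_upwards [this] with x hx
      simpa using hx
    -- Here `Y` vanishes almost surely, every `t` is admissible with `s = 0`, and `3 / B` makes the
    -- exponent exactly `-u`.
    refine chern (3 / B) (by positivity) 0 ?_ ?_
    · have : ∫⁻ x, ENNReal.ofReal (Real.exp (3 / B * Y x)) ∂μ = ∫⁻ _, 1 ∂μ := by
        refine lintegral_congr_ae ?_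
        filter_upwards [hz] with x hx
        simp [hx]
      rw [this]; simp
    · rw [← hv1]
      simp only [mul_zero, zero_mul, Real.sqrt_zero, zero_add, zero_sub]
      rw [neg_le_neg_iff]
      apply le_of_eq; field_simp
  · have hn' : (0 : ℝ) < n := by exact_mod_cast hn
    set w := √(2 * u / (n * v)) with hw
    have hw0 : 0 < w := Real.sqrt_pos.2 (by positivity)
    have hw2 : n * v * w ^ 2 = 2 * u := by
      rw [hw, Real.sq_sqrt (by positivity)]; field_simp
    have hsq : √(2 * n * v * u) = n * v * w := by
      rw [Real.sqrt_eq_iff_mul_self_eq (by positivity) (by positivity)]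
      linear_combination (-(n * v)) * hw2
    set D := 1 + B / 3 * w with hD
    have hD0 : 0 < D := by positivity
    -- With this `t`, `1 - t * B / 3 = 1 / D`, and the Chernoff exponent `u / D - (u / D + u)`
    -- equals `-u`.
    set t := w / D with ht
    have ht0 : 0 < t := by positivity
    have htB : 1 - |t| * B / 3 = 1 / D := by
      rw [abs_of_pos ht0, ht]; field_simp; rw [hD]; ring
    have htB3 : |t| * B < 3 := by
      have : 0 < 1 - |t| * B / 3 := by rw [htB]; positivity
      linarith
    refine chern t ht0 _ (lintegral_exp_le hY hB h0 hv.le htB3) (le_of_eq ?_)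
    rw [htB, hsq, ht]
    field_simp
    rw [hD]
    nlinarith [hw2]
end Deviation

/-! ### Thresholded sample means -/

/-- The sample mean of `g`. -/
noncomputable def sampleMean {Ω : Type*} (g : Ω → ℝ) {n : ℕ} (X : Fin n → Ω) : ℝ :=
  1 / (n : ℝ) * ∑ m, g (X m)

/-- The unbiased estimator of the variance of `g`. -/
noncomputable def sampleVar {Ω : Type*} (g : Ω → ℝ) {n : ℕ} (X : Fin n → Ω) : ℝ :=
  1 / ((n : ℝ) * ((n : ℝ) - 1)) *
    ∑ m, ∑ l ∈ Finset.univ.filter (fun l => l < m), (g (X m) - g (X l)) ^ 2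

/-- An overestimate of the variance of a function bounded by `b`. -/
noncomputable def inflatedVar {Ω : Type*} (γ b : ℝ) (g : Ω → ℝ) {n : ℕ} (X : Fin n → Ω) : ℝ :=
  sampleVar g X + 2 * b * √(2 * γ * sampleVar g X * (Real.log n / n))
    + 8 * γ * b ^ 2 * (Real.log n / n)

/-- The data-driven threshold for a function bounded by `b`. -/
noncomputable def meanThreshold {Ω : Type*} (γ b : ℝ) (g : Ω → ℝ) {n : ℕ} (X : Fin n → Ω) : ℝ :=
  √(2 * γ * inflatedVar γ b g X * (Real.log n / n)) + 2 * b * γ * Real.log n / (3 * n)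

open Classical in
/-- The thresholded sample mean. -/
noncomputable def thresholdedMean {Ω : Type*} (γ b : ℝ) (g : Ω → ℝ) {n : ℕ} (X : Fin n → Ω) : ℝ :=
  if meanThreshold γ b g X ≤ |sampleMean g X| then sampleMean g X else 0

theorem sum_sum_lt_sq_sub {n : ℕ} (z : Fin n → ℝ) :
    ∑ m, ∑ l ∈ Finset.univ.filter (fun l => l < m), (z m - z l) ^ 2
      = n * ∑ m, z m ^ 2 - (∑ m, z m) ^ 2 := by
  have h1 : ∑ m, ∑ l, (z m - z l) ^ 2 = 2 * (n * ∑ m, z m ^ 2 - (∑ m, z m) ^ 2) := by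
    have : ∀ m l, (z m - z l) ^ 2 = z m ^ 2 + z l ^ 2 - 2 * (z m * z l) := fun m l => by ring
    simp_rw [this, Finset.sum_sub_distrib, Finset.sum_add_distrib, ← Finset.mul_sum,
      ← Finset.sum_mul]
    simp only [Finset.sum_const, Finset.card_univ, Fintype.card_fin, nsmul_eq_mul,
      ← Finset.mul_sum]
    ring
  have h2 : ∑ m, ∑ l, (z m - z l) ^ 2
      = ∑ m, ∑ l ∈ Finset.univ.filter (fun l => l < m), (z m - z l) ^ 2
        + ∑ m, ∑ l ∈ Finset.univ.filter (fun l => m < l), (z m - z l) ^ 2 := by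
    rw [← Finset.sum_add_distrib]
    refine Finset.sum_congr rfl fun m _ => ?_
    simp_rw [Finset.sum_filter, ← Finset.sum_add_distrib]
    refine Finset.sum_congr rfl fun l _ => ?_
    rcases lt_trichotomy l m with h | h | h
    · simp [h, h.not_gt]
    · simp [h]
    · simp [h, h.not_gt]
  have h3 : ∑ m, ∑ l ∈ Finset.univ.filter (fun l => m < l), (z m - z l) ^ 2
      = ∑ m, ∑ l ∈ Finset.univ.filter (fun l => l < m), (z m - z l) ^ 2 := by
    simp_rw [Finset.sum_filter]
    rw [Finset.sum_comm]
    refine Finset.sum_congr rfl fun m _ => Finset.sum_congr rfl fun l _ => ?_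
    split_ifs
    · ring
    · rfl
  linarith

theorem sampleVar_nonneg {Ω : Type*} (g : Ω → ℝ) {n : ℕ} (hn : 2 ≤ n) (X : Fin n → Ω) :
    0 ≤ sampleVar g X := by
  have : (2 : ℝ) ≤ n := by exact_mod_cast hn
  refine mul_nonneg (one_div_nonneg.2 (mul_nonneg (by linarith) (by linarith)))
    (Finset.sum_nonneg fun m _ => Finset.sum_nonneg fun l _ => sq_nonneg _)

theorem sampleVar_eq {Ω : Type*} (g : Ω → ℝ) {n : ℕ} (X : Fin n → Ω) (a : ℝ) :
    sampleVar g X = 1 / ((n : ℝ) * ((n : ℝ) - 1)) *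
      (n * ∑ m, (g (X m) - a) ^ 2 - (∑ m, (g (X m) - a)) ^ 2) := by
  rw [← sum_sum_lt_sq_sub, sampleVar]
  simp

/-- The left side is `(n - 1) / n` times the sample variance, for any centre `a`. With the true mean
as centre, it remains to control an average of independent squares and the deviation of the sample
mean. -/
theorem sampleVar_ge {Ω : Type*} (g : Ω → ℝ) {n : ℕ} (hn : 2 ≤ n) (X : Fin n → Ω) (a : ℝ) :
    1 / (n : ℝ) * ∑ m, (g (X m) - a) ^ 2 - (sampleMean g X - a) ^ 2 ≤ sampleVar g X := by
  have h2 : (2 : ℝ) ≤ n := by exact_mod_cast hn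
  have h0 := sampleVar_nonneg g hn X
  have h1 := sampleVar_eq g X a
  have hm : sampleMean g X - a = 1 / (n : ℝ) * ∑ m, (g (X m) - a) := by
    rw [sampleMean, Finset.sum_sub_distrib]
    simp only [Finset.sum_const, Finset.card_univ, Fintype.card_fin, nsmul_eq_mul]
    field_simp
  have h3 : 1 / (n : ℝ) * ∑ m, (g (X m) - a) ^ 2 - (sampleMean g X - a) ^ 2
      = (n - 1) / n * sampleVar g X := by
    have hn1 : (n : ℝ) - 1 ≠ 0 := by linarith
    have hn0 : (n : ℝ) ≠ 0 := by linarith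
    rw [hm, h1]
    field_simp
  rw [h3]
  have : ((n : ℝ) - 1) / n ≤ 1 := by rw [div_le_one (by linarith)]; linarith
  nlinarith

theorem sampleVar_le {Ω : Type*} (g : Ω → ℝ) {n : ℕ} (hn : 2 ≤ n) (X : Fin n → Ω) :
    sampleVar g X ≤ 2 / (n : ℝ) * ∑ m, g (X m) ^ 2 := by
  have h2 : (2 : ℝ) ≤ n := by exact_mod_cast hn
  have hn1 : 0 < (n : ℝ) - 1 := by linarith
  have hn0 : 0 < (n : ℝ) := by linarith
  have hS : 0 ≤ ∑ m, g (X m) ^ 2 := Finset.sum_nonneg fun m _ => sq_nonneg _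
  rw [sampleVar_eq g X 0]
  simp only [sub_zero]
  rw [div_mul_eq_mul_div, div_mul_eq_mul_div, div_le_div_iff₀ (by positivity) hn0]
  have h3 : 0 ≤ (∑ m, g (X m)) ^ 2 := sq_nonneg _
  have h4 : (n : ℝ) * n * ∑ m, g (X m) ^ 2 ≤ 2 * (∑ m, g (X m) ^ 2) * (n * (n - 1)) := by
    have : (n : ℝ) * n ≤ 2 * (n * (n - 1)) := by nlinarith
    nlinarith
  nlinarith

/-- The deterministic reason why the inflated variance dominates the true one. The hypotheses give a
quadratic inequality `σ ^ 2 - 2 b σ y ≤ S ^ 2 + b ^ 2 y ^ 4` with `y = x + x ^ 2`. Completing the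
square bounds `σ` by `S + b y (2 + y ^ 2 / 2)`, and substituting this back into the linear term
gives the claim. The higher-order terms in `x` are absorbed by the gap between `x` and `q`. -/
theorem sq_le_inflated {σ b x q S2 s Z : ℝ} (hσ : 0 ≤ σ) (hb : 0 < b) (hσb : σ ≤ b) (hx : 0 ≤ x)
    (hq : 0 ≤ q) (hxq : (x + x ^ 2) ^ 2 * (1 + (x + x ^ 2) ^ 2 / 2) ≤ q ^ 2) (hS2 : 0 ≤ S2)
    (h1 : s - Z ^ 2 ≤ S2) (h2 : σ ^ 2 - 2 * b * σ * x ≤ s) (h3 : |Z| ≤ σ * x + b * x ^ 2 / 3) :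
    σ ^ 2 ≤ S2 + 2 * b * √(q ^ 2 * S2) + 4 * b ^ 2 * q ^ 2 := by
  obtain ⟨S, hS, rfl⟩ : ∃ S, 0 ≤ S ∧ S2 = S ^ 2 := ⟨√S2, Real.sqrt_nonneg _, (Real.sq_sqrt hS2).symm⟩
  rw [← mul_pow, Real.sqrt_sq (by positivity)]
  have hZ : Z ^ 2 ≤ 2 * b * σ * x ^ 2 + b ^ 2 * x ^ 4 := by
    have e1 : Z ^ 2 ≤ (σ * x + b * x ^ 2 / 3) ^ 2 := by
      rw [← sq_abs]; exact pow_le_pow_left₀ (abs_nonneg _) h3 2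
    have e2 : σ * σ * x ^ 2 ≤ b * σ * x ^ 2 :=
      mul_le_mul_of_nonneg_right (mul_le_mul_of_nonneg_right hσb hσ) (sq_nonneg _)
    nlinarith [sq_nonneg (σ * x - b * x ^ 2 / 3), sq_nonneg (b * x ^ 2)]
  set y := x + x ^ 2 with hy
  have hy0 : 0 ≤ y := by positivity
  have hxy : x ≤ y := by rw [hy]; nlinarith
  have hx4 : x ^ 4 ≤ y ^ 4 := pow_le_pow_left₀ hx hxy 4
  have hyq : y ≤ q := by
    have : y ^ 2 ≤ q ^ 2 := by nlinarith [sq_nonneg y, sq_nonneg (y ^ 2)]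
    exact (sq_le_sq₀ hy0 hq).1 this
  have hmain : σ ^ 2 - 2 * b * σ * y ≤ S ^ 2 + b ^ 2 * y ^ 4 := by
    have : b ^ 2 * x ^ 4 ≤ b ^ 2 * y ^ 4 := mul_le_mul_of_nonneg_left hx4 (sq_nonneg _)
    rw [hy] at *
    nlinarith
  have hσle : σ ≤ S + b * y * (2 + y ^ 2 / 2) := by
    have h5 : (σ - b * y) ^ 2 ≤ (S + b * y * (1 + y ^ 2 / 2)) ^ 2 := by
      have p1 : 0 ≤ S * (b * y * (1 + y ^ 2 / 2)) := by positivity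
      have p2 : 0 ≤ (b * y) ^ 2 * y ^ 4 := by positivity
      nlinarith
    have h6 := abs_le_of_sq_le_sq h5 (by positivity)
    have := (le_abs_self _).trans h6
    linarith
  have h7 : b * y * σ ≤ b * y * (S + b * y * (2 + y ^ 2 / 2)) :=
    mul_le_mul_of_nonneg_left hσle (by positivity)
  have h8 : b * S * y ≤ b * S * q := mul_le_mul_of_nonneg_left hyq (by positivity)
  have h9 : b ^ 2 * (y ^ 2 * (1 + y ^ 2 / 2)) ≤ b ^ 2 * q ^ 2 :=
    mul_le_mul_of_nonneg_left hxq (sq_nonneg _)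
  nlinarith

/-- If the coefficient is kept, the error is at most `η` and, thanks to `κ < 1`, also `(1 - κ) η ≤
|m|`; if it is killed, then `|m| ≤ 2 η`. Either way the error is comparable with the smaller of
`|m|` and `η`. -/
theorem sq_threshold_sub_le_of_le {κ η β m : ℝ} (hκ : κ < 1) (hη : 0 ≤ η)
    (h : |β - m| ≤ κ * η) :
    ((if η ≤ |β| then β else 0) - m) ^ 2 ≤ (4 + 1 / (1 - κ) ^ 2) * min (m ^ 2) (η ^ 2) := by
  have h1 : 0 < 1 - κ := by linarith
  have hinv : 0 < 1 / (1 - κ) ^ 2 := by positivity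
  have hκη : |β - m| ≤ η := h.trans (by nlinarith)
  split_ifs with hk
  · have h2 : (1 - κ) * η ≤ |m| := by
      have := abs_sub_abs_le_abs_sub β m
      nlinarith
    have h3 : (β - m) ^ 2 ≤ η ^ 2 := by
      rw [← sq_abs]; exact pow_le_pow_left₀ (abs_nonneg _) hκη 2
    have h4 : η ^ 2 ≤ 1 / (1 - κ) ^ 2 * m ^ 2 := by
      rw [div_mul_eq_mul_div, one_mul, le_div_iff₀ (by positivity), ← sq_abs m]
      calc η ^ 2 * (1 - κ) ^ 2 = ((1 - κ) * η) ^ 2 := by ring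
        _ ≤ _ := pow_le_pow_left₀ (by positivity) h2 2
    rcases le_total (m ^ 2) (η ^ 2) with hm | hm
    · rw [min_eq_left hm]; nlinarith [sq_nonneg m]
    · rw [min_eq_right hm]; nlinarith [sq_nonneg η]
  · push Not at hk
    have h2 : |m| ≤ 2 * η := by
      have := abs_sub_abs_le_abs_sub m β
      rw [abs_sub_comm m β] at this
      linarith
    have h3 : m ^ 2 ≤ 4 * η ^ 2 := by
      rw [← sq_abs]
      calc |m| ^ 2 ≤ (2 * η) ^ 2 := pow_le_pow_left₀ (abs_nonneg _) h2 2
        _ = _ := by ring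
    rw [zero_sub, neg_sq]
    rcases le_total (m ^ 2) (η ^ 2) with hm | hm
    · rw [min_eq_left hm]; nlinarith [sq_nonneg m]
    · rw [min_eq_right hm]; nlinarith [sq_nonneg η]

theorem sq_threshold_sub_le (η β m : ℝ) :
    ((if η ≤ |β| then β else 0) - m) ^ 2 ≤ m ^ 2 + if η ≤ |β| then (β - m) ^ 2 else 0 := by
  split_ifs
  · nlinarith [sq_nonneg m]
  · nlinarith

section Deviation

variable {Ω : Type*} [MeasurableSpace Ω] {μ : Measure Ω}

/-- The standard deviation of `g`. -/
noncomputable def stdDev (μ : Measure Ω) (g : Ω → ℝ) : ℝ := √(∫ x, (g x - ∫ y, g y ∂μ) ^ 2 ∂μ)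

theorem stdDev_nonneg (g : Ω → ℝ) : 0 ≤ stdDev μ g := Real.sqrt_nonneg _

theorem sq_stdDev (g : Ω → ℝ) : stdDev μ g ^ 2 = ∫ x, (g x - ∫ y, g y ∂μ) ^ 2 ∂μ :=
  Real.sq_sqrt (integral_nonneg fun _ => sq_nonneg _)

variable [IsProbabilityMeasure μ]

theorem integrable_sq_of_ae_bound {g : Ω → ℝ} (hg : Measurable g) {b : ℝ}
    (hb : ∀ᵐ x ∂μ, |g x| ≤ b) : Integrable (fun x => g x ^ 2) μ := by
  refine (hg.pow_const 2).integrable_of_ae_bound (B := b ^ 2) ?_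
  filter_upwards [hb] with x hx
  rw [abs_pow]
  exact pow_le_pow_left₀ (abs_nonneg _) hx 2

theorem abs_integral_le_of_ae_bound {g : Ω → ℝ} {b : ℝ}
    (hb : ∀ᵐ x ∂μ, |g x| ≤ b) : |∫ x, g x ∂μ| ≤ b := by
  have := norm_integral_le_of_norm_le_const (μ := μ) (f := g) (C := b) (by simpa using hb)
  simpa using this

theorem ae_abs_sub_integral_le {g : Ω → ℝ} {b : ℝ}
    (hb : ∀ᵐ x ∂μ, |g x| ≤ b) : ∀ᵐ x ∂μ, |g x - ∫ y, g y ∂μ| ≤ 2 * b := by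
  filter_upwards [hb] with x hx
  have := abs_sub (g x) (∫ y, g y ∂μ)
  have h := abs_integral_le_of_ae_bound hb
  linarith

theorem integral_sub_integral {g : Ω → ℝ} (hg : Measurable g) {b : ℝ}
    (hb : ∀ᵐ x ∂μ, |g x| ≤ b) : ∫ x, (g x - ∫ y, g y ∂μ) ∂μ = 0 := by
  rw [integral_sub (hg.integrable_of_ae_bound hb) (integrable_const _)]
  simp

theorem sq_stdDev_le {g : Ω → ℝ} (hg : Measurable g) {b : ℝ}
    (hb : ∀ᵐ x ∂μ, |g x| ≤ b) : stdDev μ g ^ 2 ≤ ∫ x, g x ^ 2 ∂μ := by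
  rw [sq_stdDev]
  have h : ∀ x, (g x - ∫ y, g y ∂μ) ^ 2
      = g x ^ 2 - 2 * (∫ y, g y ∂μ) * g x + (∫ y, g y ∂μ) ^ 2 := fun x => by ring
  have hi := hg.integrable_of_ae_bound hb
  simp_rw [h]
  have hI : ∫ x, g x ^ 2 - 2 * (∫ y, g y ∂μ) * g x + (∫ y, g y ∂μ) ^ 2 ∂μ
      = ∫ x, g x ^ 2 ∂μ - ∫ x, 2 * (∫ y, g y ∂μ) * g x ∂μ + ∫ _, (∫ y, g y ∂μ) ^ 2 ∂μ := by
    rw [← integral_sub (integrable_sq_of_ae_bound hg hb) (hi.const_mul _)]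
    exact integral_add ((integrable_sq_of_ae_bound hg hb).sub (hi.const_mul _)) (integrable_const _)
  rw [hI, integral_const_mul]
  simp only [integral_const, probReal_univ, smul_eq_mul, one_mul]
  nlinarith [sq_nonneg (∫ y, g y ∂μ)]

theorem integral_sq_le_mul_real {g : Ω → ℝ} (hg : Measurable g) {b : ℝ}
    (hb : ∀ᵐ x ∂μ, |g x| ≤ b) : ∫ x, g x ^ 2 ∂μ ≤ b ^ 2 * μ.real {x | g x ≠ 0} := by
  have hs : MeasurableSet {x | g x ≠ 0} := hg (measurableSet_singleton 0).compl
  calc ∫ x, g x ^ 2 ∂μ ≤ ∫ x, Set.indicator {x | g x ≠ 0} (fun _ => b ^ 2) x ∂μ := by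
        refine integral_mono_ae (integrable_sq_of_ae_bound hg hb)
          ((integrable_const _).indicator hs) ?_
        filter_upwards [hb] with x hx
        by_cases h : g x = 0
        · simp [h]
        · rw [Set.indicator_of_mem (show x ∈ {x | g x ≠ 0} from h)]
          rw [← sq_abs]
          exact pow_le_pow_left₀ (abs_nonneg _) hx 2
    _ = b ^ 2 * μ.real {x | g x ≠ 0} := by
        rw [integral_indicator hs, setIntegral_const, smul_eq_mul, mul_comm]

theorem abs_integral_le_mul_real {g : Ω → ℝ} (hg : Measurable g) {b : ℝ}
    (hb : ∀ᵐ x ∂μ, |g x| ≤ b) : |∫ x, g x ∂μ| ≤ b * μ.real {x | g x ≠ 0} := by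
  have hs : MeasurableSet {x | g x ≠ 0} := hg (measurableSet_singleton 0).compl
  calc |∫ x, g x ∂μ| ≤ ∫ x, |g x| ∂μ := abs_integral_le_integral_abs
    _ ≤ ∫ x, Set.indicator {x | g x ≠ 0} (fun _ => b) x ∂μ := by
        refine integral_mono_ae (hg.integrable_of_ae_bound hb).abs
          ((integrable_const _).indicator hs) ?_
        filter_upwards [hb] with x hx
        by_cases h : g x = 0
        · simp [h]
        · rwa [Set.indicator_of_mem (show x ∈ {x | g x ≠ 0} from h)]
    _ = b * μ.real {x | g x ≠ 0} := by
        rw [integral_indicator hs, setIntegral_const, smul_eq_mul, mul_comm]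

theorem stdDev_le {g : Ω → ℝ} (hg : Measurable g) {b : ℝ}
    (hb : ∀ᵐ x ∂μ, |g x| ≤ b) : stdDev μ g ≤ |b| := by
  refine abs_le_of_sq_le_sq' ?_ (abs_nonneg b) |>.2
  refine (sq_stdDev_le hg hb).trans ((integral_sq_le_mul_real hg hb).trans ?_)
  rw [sq_abs]
  exact mul_le_of_le_one_right (sq_nonneg _) measureReal_le_one

/-- Bernstein's inequality for `g` and `-g` after centring, which doubles the bound `b`. In terms of
`x = √(2 * u / n)` the radius is `σ x + b x ^ 2 / 3`. -/
theorem measure_sampleMean_deviation {g : Ω → ℝ} (hg : Measurable g) {b : ℝ}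
    (hb : ∀ᵐ x ∂μ, |g x| ≤ b) (hb0 : 0 < b) {n : ℕ} (hn : 0 < n) {u : ℝ} (hu : 0 < u) :
    (Measure.pi fun _ : Fin n => μ) {X | stdDev μ g * √(2 * u / n) + b * √(2 * u / n) ^ 2 / 3
        < |sampleMean g X - ∫ x, g x ∂μ|} ≤ ENNReal.ofReal (2 * Real.exp (-u)) := by
  set m := ∫ x, g x ∂μ
  have hn' : (0 : ℝ) < n := by exact_mod_cast hn
  have hY : Measurable fun x => g x - m := hg.sub_const m
  have hB := ae_abs_sub_integral_le hb
  have h0 := integral_sub_integral hg hb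
  have hV := sq_stdDev (μ := μ) g
  have hthr : √(2 * n * stdDev μ g ^ 2 * u) + 2 * b * u / 3
      = n * (stdDev μ g * √(2 * u / n) + b * √(2 * u / n) ^ 2 / 3) := by
    have h1 : √(2 * n * stdDev μ g ^ 2 * u) = n * (stdDev μ g * √(2 * u / n)) := by
      have e : 2 * n * stdDev μ g ^ 2 * u = (n * stdDev μ g) ^ 2 * (2 * u / n) := by field_simp
      rw [e, Real.sqrt_mul (sq_nonneg _), Real.sqrt_sq (mul_nonneg hn'.le (stdDev_nonneg g)),
        mul_assoc]
    rw [h1, Real.sq_sqrt (by positivity)]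
    field_simp
  have hup := bernstein_upper hn hY (by positivity) hB h0 hV.symm hu
  have hlow := bernstein_upper hn hY.neg (B := 2 * b) (by positivity)
    (by filter_upwards [hB] with x hx; simpa only [Pi.neg_apply, abs_neg] using hx)
    (by simp only [Pi.neg_apply, integral_neg]; rw [h0, neg_zero]) (v := stdDev μ g ^ 2)
    (by simpa only [Pi.neg_apply, neg_sq] using hV.symm) hu
  rw [two_mul (Real.exp (-u)), ENNReal.ofReal_add (Real.exp_pos _).le (Real.exp_pos _).le]
  refine le_trans (measure_mono ?_) ((measure_union_le _ _).trans (add_le_add hup hlow))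
  intro X hX
  simp only [Set.mem_ofPred_eq, Set.mem_union, Pi.neg_apply, Finset.sum_neg_distrib] at hX ⊢
  have hmean : ∑ i, (g (X i) - m) = n * (sampleMean g X - m) := by
    rw [sampleMean, Finset.sum_sub_distrib]
    simp only [Finset.sum_const, Finset.card_univ, Fintype.card_fin, nsmul_eq_mul]
    field_simp
  rw [hthr, hmean, ← mul_neg]
  rcases lt_abs.1 hX with h | h
  · exact Or.inl (mul_le_mul_of_nonneg_left h.le hn'.le)
  · exact Or.inr (mul_le_mul_of_nonneg_left h.le hn'.le)

/-- The lower tail of an average of nonnegative variables is sub-Gaussian, with no linear Bernstein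
term. The squares are at most `4 * b ^ 2`, so their second moment is at most `4 * b ^ 2 * σ ^ 2`. -/
theorem measure_mean_sq_deviation_le {g : Ω → ℝ} (hg : Measurable g) {b : ℝ}
    (hb : ∀ᵐ x ∂μ, |g x| ≤ b) (hb0 : 0 < b) (hσ : 0 < stdDev μ g) {n : ℕ} (hn : 0 < n)
    {u : ℝ} (hu : 0 < u) :
    (Measure.pi fun _ : Fin n => μ) {X | 1 / (n : ℝ) * ∑ i, (g (X i) - ∫ x, g x ∂μ) ^ 2
        ≤ stdDev μ g ^ 2 - 2 * b * stdDev μ g * √(2 * u / n)} ≤ ENNReal.ofReal (Real.exp (-u)) := by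
  set m := ∫ x, g x ∂μ with hm
  set σ := stdDev μ g with hσd
  set x := √(2 * u / n) with hx
  have hn' : (0 : ℝ) < n := by exact_mod_cast hn
  have hx0 : 0 < x := Real.sqrt_pos.2 (by positivity)
  have hx2 : n * x ^ 2 = 2 * u := by
    rw [hx, Real.sq_sqrt (by positivity)]; field_simp
  have hY : Measurable fun x => g x - m := hg.sub_const m
  have hB := ae_abs_sub_integral_le hb
  have hY2 := integrable_sq_of_ae_bound hY hB
  have hV : σ ^ 2 = ∫ x, (g x - m) ^ 2 ∂μ := sq_stdDev (μ := μ) g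
  -- The minimiser of `2 t ^ 2 b ^ 2 σ ^ 2 - 2 t b σ x`; the minimum `-x ^ 2 / 2`, multiplied by
  -- `n`, is `-u`.
  set t := x / (2 * b * σ) with ht
  have ht0 : 0 < t := by positivity
  have hexp : ∫⁻ y, ENNReal.ofReal (Real.exp (-t * (g y - m) ^ 2)) ∂μ
      ≤ ENNReal.ofReal (Real.exp (-t * σ ^ 2 + 2 * t ^ 2 * b ^ 2 * σ ^ 2)) := by
    have hle : ∀ᵐ y ∂μ, Real.exp (-t * (g y - m) ^ 2)
        ≤ 1 + (-t + 2 * t ^ 2 * b ^ 2) * (g y - m) ^ 2 := by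
      filter_upwards [hB] with y hy
      set Z := (g y - m) ^ 2 with hZ
      have hZ0 : 0 ≤ Z := sq_nonneg _
      have hZb : Z ≤ 4 * b ^ 2 := by
        rw [hZ, ← sq_abs]
        calc |g y - m| ^ 2 ≤ (2 * b) ^ 2 := pow_le_pow_left₀ (abs_nonneg _) hy 2
          _ = _ := by ring
      -- Follows from `exp y ≥ 1 + y + y ^ 2 / 2` and `(1 + y + y ^ 2 / 2) * (1 - y + y ^ 2 / 2) = 1
      -- + y ^ 4 / 4`.
      have h1 : Real.exp (-(t * Z)) ≤ 1 - t * Z + (t * Z) ^ 2 / 2 := by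
        have hq := Real.quadratic_le_exp_of_nonneg (x := t * Z) (by positivity)
        have hpos : 0 < 1 + t * Z + (t * Z) ^ 2 / 2 := by positivity
        rw [Real.exp_neg]
        refine (inv_anti₀ hpos hq).trans ?_
        rw [inv_le_iff_one_le_mul₀ hpos]
        nlinarith [sq_nonneg ((t * Z) ^ 2)]
      have h2 : (t * Z) ^ 2 / 2 ≤ 2 * t ^ 2 * b ^ 2 * Z := by
        have : t ^ 2 * (Z * Z) ≤ t ^ 2 * (4 * b ^ 2 * Z) :=
          mul_le_mul_of_nonneg_left (mul_le_mul_of_nonneg_right hZb hZ0) (sq_nonneg _)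
        nlinarith
      rw [neg_mul]
      nlinarith
    have hint : Integrable (fun y => 1 + (-t + 2 * t ^ 2 * b ^ 2) * (g y - m) ^ 2) μ :=
      (integrable_const 1).add (hY2.const_mul _)
    calc ∫⁻ y, ENNReal.ofReal (Real.exp (-t * (g y - m) ^ 2)) ∂μ
        ≤ ∫⁻ y, ENNReal.ofReal (1 + (-t + 2 * t ^ 2 * b ^ 2) * (g y - m) ^ 2) ∂μ := by
          refine lintegral_mono_ae ?_
          filter_upwards [hle] with y hy using ENNReal.ofReal_le_ofReal hy
      _ = ENNReal.ofReal (∫ y, 1 + (-t + 2 * t ^ 2 * b ^ 2) * (g y - m) ^ 2 ∂μ) := by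
          refine (ofReal_integral_eq_lintegral_ofReal hint ?_).symm
          filter_upwards [hle] with y hy using (Real.exp_pos _).le.trans hy
      _ ≤ _ := by
          refine ENNReal.ofReal_le_ofReal ?_
          rw [integral_add (integrable_const 1) (hY2.const_mul _), integral_const_mul, ← hV]
          simp only [integral_const, probReal_univ, smul_eq_mul, mul_one]
          have := Real.add_one_le_exp (-t * σ ^ 2 + 2 * t ^ 2 * b ^ 2 * σ ^ 2)
          linarith
  have hch := measure_pi_sum_ge_le n ((hY.pow_const 2).const_mul (-t))
    (-t * (n * (σ ^ 2 - 2 * b * σ * x))) hexp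
  refine (measure_mono fun X hX => ?_).trans (hch.trans_eq ?_)
  · simp only [Set.mem_ofPred_eq] at hX ⊢
    rw [← Finset.mul_sum]
    rw [one_div, inv_mul_le_iff₀ hn'] at hX
    exact mul_le_mul_of_nonpos_left hX (by linarith)
  · congr 2
    rw [ht]
    field_simp
    nlinarith [hx2]

end Deviation

section Measurability

variable {Ω : Type*} [MeasurableSpace Ω] {g : Ω → ℝ} {n : ℕ}

theorem measurable_sampleMean (hg : Measurable g) :
    Measurable fun X : Fin n → Ω => sampleMean g X :=
  (Finset.measurable_fun_sum _ fun i _ => hg.comp (measurable_pi_apply i)).const_mul _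

theorem measurable_sampleVar (hg : Measurable g) :
    Measurable fun X : Fin n → Ω => sampleVar g X :=
  (Finset.measurable_fun_sum _ fun m _ => Finset.measurable_fun_sum _ fun l _ =>
    ((hg.comp (measurable_pi_apply m)).sub (hg.comp (measurable_pi_apply l))).pow_const 2).const_mul _

theorem measurable_meanThreshold (hg : Measurable g) (γ b : ℝ) :
    Measurable fun X : Fin n → Ω => meanThreshold γ b g X := by
  have h := measurable_sampleVar (n := n) hg
  have h1 : Measurable fun X : Fin n → Ω => inflatedVar γ b g X := by
    unfold inflatedVar; fun_prop
  unfold meanThreshold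
  fun_prop

theorem measurable_thresholdedMean (hg : Measurable g) (γ b : ℝ) :
    Measurable fun X : Fin n → Ω => thresholdedMean γ b g X :=
  Measurable.ite (measurableSet_le (measurable_meanThreshold hg γ b) (measurable_sampleMean hg).abs)
    (measurable_sampleMean hg) measurable_const

end Measurability

/-! ### Size of the random threshold and risk of one thresholded mean -/

theorem sq_meanThreshold_le {Ω : Type*} (g : Ω → ℝ) {n : ℕ} (hn : 2 ≤ n) {γ b : ℝ} (hγ : 1 ≤ γ)
    (hb : 0 ≤ b) (X : Fin n → Ω) : meanThreshold γ b g X ^ 2 ≤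
      41 * γ ^ 2 * (sampleVar g X * (Real.log n / n) + b ^ 2 * (Real.log n / n) ^ 2) := by
  have hS := sampleVar_nonneg g hn X
  have hL : 0 ≤ Real.log n / n := by positivity
  have he : 2 * b * γ * Real.log n / (3 * n) = 2 / 3 * b * γ * (Real.log n / n) := by ring
  rw [meanThreshold, inflatedVar, he]
  set S := sampleVar g X
  set L := Real.log n / n
  have hV : S + 2 * b * √(2 * γ * S * L) + 8 * γ * b ^ 2 * L ≤ 2 * S + 10 * γ * b ^ 2 * L := by
    have h1 : √(2 * γ * S * L) = √S * √(2 * γ * L) := by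
      rw [← Real.sqrt_mul hS]; congr 1; ring
    have h2 := Real.sq_sqrt hS
    have h3 : √(2 * γ * L) ^ 2 = 2 * γ * L := Real.sq_sqrt (by positivity)
    rw [h1]
    nlinarith [sq_nonneg (√S - b * √(2 * γ * L))]
  have hV0 : 0 ≤ S + 2 * b * √(2 * γ * S * L) + 8 * γ * b ^ 2 * L := by positivity
  set V := S + 2 * b * √(2 * γ * S * L) + 8 * γ * b ^ 2 * L
  have h4 : √(2 * γ * V * L) ^ 2 = 2 * γ * V * L := Real.sq_sqrt (by positivity)
  have h5 : (√(2 * γ * V * L) + 2 / 3 * b * γ * L) ^ 2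
      ≤ 2 * (2 * γ * V * L) + 2 * (2 / 3 * b * γ * L) ^ 2 := by
    nlinarith [sq_nonneg (√(2 * γ * V * L) - 2 / 3 * b * γ * L)]
  have h6 : γ * L * V ≤ γ * L * (2 * S + 10 * γ * b ^ 2 * L) :=
    mul_le_mul_of_nonneg_left hV (by positivity)
  have h7 : γ * (S * L) ≤ γ ^ 2 * (S * L) :=
    mul_le_mul_of_nonneg_right (by nlinarith) (by positivity)
  have h8 : 0 ≤ γ ^ 2 * (b ^ 2 * L ^ 2) := by positivity
  have h9 : 0 ≤ γ ^ 2 * (S * L) := by positivity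
  nlinarith

/-- The last term of the inflated variance alone gives `16 γ ^ 2 b ^ 2 L ^ 2` under the root.
Consequently a sample mean passes the threshold only if at least `4 γ log n` observations fall where
`g ≠ 0`. -/
theorem meanThreshold_ge {Ω : Type*} (g : Ω → ℝ) {n : ℕ} (hn : 2 ≤ n) {γ b : ℝ} (hγ : 1 ≤ γ)
    (hb : 0 ≤ b) (X : Fin n → Ω) : 4 * γ * b * (Real.log n / n) ≤ meanThreshold γ b g X := by
  have hS := sampleVar_nonneg g hn X
  have hL : 0 ≤ Real.log n / n := by positivity
  rw [meanThreshold, inflatedVar]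
  have h1 : 0 ≤ 2 * b * γ * Real.log n / (3 * n) := by positivity
  set S := sampleVar g X
  set L := Real.log n / n
  have h2 : 4 * γ * b * L ≤ √(2 * γ * (S + 2 * b * √(2 * γ * S * L) + 8 * γ * b ^ 2 * L) * L) := by
    refine Real.le_sqrt_of_sq_le ?_
    have : 0 ≤ 2 * γ * (S + 2 * b * √(2 * γ * S * L)) * L := by positivity
    nlinarith
  linarith

section Deviation

variable {Ω : Type*} [MeasurableSpace Ω] {μ : Measure Ω} [IsProbabilityMeasure μ]

theorem lintegral_pi_eval {n : ℕ} (i : Fin n) {h : Ω → ℝ≥0∞} (hh : Measurable h) :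
    ∫⁻ X, h (X i) ∂(Measure.pi fun _ : Fin n => μ) = ∫⁻ x, h x ∂μ :=
  (measurePreserving_eval (fun _ : Fin n => μ) i).lintegral_comp hh

theorem lintegral_mean_sq_le {g : Ω → ℝ} (hg : Measurable g) {b : ℝ} (hb : ∀ᵐ x ∂μ, |g x| ≤ b)
    {n : ℕ} (hn : 0 < n) :
    ∫⁻ X, ENNReal.ofReal (1 / n * ∑ m, g (X m) ^ 2) ∂(Measure.pi fun _ : Fin n => μ)
      ≤ ENNReal.ofReal (b ^ 2 * μ.real {x | g x ≠ 0}) := by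
  have hn' : (0 : ℝ) < n := by exact_mod_cast hn
  have hm : Measurable fun x => ENNReal.ofReal (g x ^ 2) := (hg.pow_const 2).ennreal_ofReal
  have h1 : ∀ X : Fin n → Ω, ENNReal.ofReal (1 / n * ∑ m, g (X m) ^ 2)
      = ENNReal.ofReal (1 / n) * ∑ m, ENNReal.ofReal (g (X m) ^ 2) := fun X => by
    rw [ENNReal.ofReal_mul (by positivity), ENNReal.ofReal_sum_of_nonneg fun i _ => sq_nonneg _]
  simp_rw [h1]
  have hmi : ∀ i : Fin n, Measurable fun X : Fin n → Ω => ENNReal.ofReal (g (X i) ^ 2) :=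
    fun i => hm.comp (measurable_pi_apply i)
  rw [lintegral_const_mul _ (Finset.measurable_fun_sum _ fun i _ => hmi i),
    lintegral_finsetSum _ fun i _ => hmi i]
  simp_rw [lintegral_pi_eval _ hm]
  rw [← ofReal_integral_eq_lintegral_ofReal (integrable_sq_of_ae_bound hg hb)
    (ae_of_all _ fun x => sq_nonneg _)]
  simp only [Finset.sum_const, Finset.card_univ, Fintype.card_fin, nsmul_eq_mul]
  rw [← ENNReal.ofReal_natCast n, ← mul_assoc, ← ENNReal.ofReal_mul (by positivity),
    one_div_mul_cancel hn'.ne', ENNReal.ofReal_one, one_mul]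
  exact ENNReal.ofReal_le_ofReal (integral_sq_le_mul_real hg hb)

theorem lintegral_sq_meanThreshold_le {g : Ω → ℝ} (hg : Measurable g) {b : ℝ}
    (hb : ∀ᵐ x ∂μ, |g x| ≤ b) (hb0 : 0 ≤ b) {n : ℕ} (hn : 2 ≤ n) {γ : ℝ} (hγ : 1 ≤ γ) :
    ∫⁻ X, ENNReal.ofReal (meanThreshold γ b g X ^ 2) ∂(Measure.pi fun _ : Fin n => μ) ≤
      ENNReal.ofReal (41 * γ ^ 2 * (2 * (b ^ 2 * μ.real {x | g x ≠ 0}) * (Real.log n / n)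
        + b ^ 2 * (Real.log n / n) ^ 2)) := by
  have hL : 0 ≤ Real.log n / n := by positivity
  set L := Real.log n / n with hLdef
  set F := μ.real {x | g x ≠ 0}
  have hF : 0 ≤ F := measureReal_nonneg
  have hpt : ∀ X : Fin n → Ω, ENNReal.ofReal (meanThreshold γ b g X ^ 2) ≤
      ENNReal.ofReal (41 * γ ^ 2 * (2 * L)) * ENNReal.ofReal (1 / n * ∑ m, g (X m) ^ 2)
      + ENNReal.ofReal (41 * γ ^ 2 * (b ^ 2 * L ^ 2)) := by
    intro X
    rw [← ENNReal.ofReal_mul (by positivity), ← ENNReal.ofReal_add]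
    · refine ENNReal.ofReal_le_ofReal ((sq_meanThreshold_le g hn hγ hb0 X).trans ?_)
      have h1 := sampleVar_le g hn X
      have h2 : sampleVar g X * L ≤ 2 / (n : ℝ) * (∑ m, g (X m) ^ 2) * L :=
        mul_le_mul_of_nonneg_right h1 hL
      have h3 : 2 / (n : ℝ) * (∑ m, g (X m) ^ 2) * L = 2 * L * (1 / n * ∑ m, g (X m) ^ 2) := by ring
      rw [h3] at h2
      have h4 : 41 * γ ^ 2 * (sampleVar g X * L) ≤ 41 * γ ^ 2 * (2 * L * (1 / n * ∑ m, g (X m) ^ 2)) :=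
        mul_le_mul_of_nonneg_left h2 (by positivity)
      linarith
    · have : 0 ≤ ∑ m, g (X m) ^ 2 := Finset.sum_nonneg fun m _ => sq_nonneg _
      positivity
    · positivity
  have hmeas : Measurable fun X : Fin n → Ω => ENNReal.ofReal (1 / n * ∑ m, g (X m) ^ 2) :=
    ((Finset.measurable_fun_sum _ fun i _ =>
      (hg.comp (measurable_pi_apply i)).pow_const 2).const_mul _).ennreal_ofReal
  calc _ ≤ ∫⁻ X, (ENNReal.ofReal (41 * γ ^ 2 * (2 * L)) * ENNReal.ofReal (1 / n * ∑ m, g (X m) ^ 2)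
      + ENNReal.ofReal (41 * γ ^ 2 * (b ^ 2 * L ^ 2))) ∂(Measure.pi fun _ : Fin n => μ) :=
        lintegral_mono hpt
    _ ≤ ENNReal.ofReal (41 * γ ^ 2 * (2 * L)) * ENNReal.ofReal (b ^ 2 * F)
      + ENNReal.ofReal (41 * γ ^ 2 * (b ^ 2 * L ^ 2)) := by
        rw [lintegral_add_right _ measurable_const, lintegral_const_mul _ hmeas]
        simp only [lintegral_const, measure_univ, mul_one]
        gcongr
        exact lintegral_mean_sq_le hg hb (by omega)
    _ = _ := by
        rw [← ENNReal.ofReal_mul (by positivity), ← ENNReal.ofReal_add (by positivity) (by positivity)]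
        congr 1; ring

/-- The deterministic part `b ^ 2 L ^ 2` of the squared threshold is not proportional to the mass
`F` of the support. When `L ≤ F` it is at most `b ^ 2 F L`; when `F ≤ L` it is not needed, because
the squared mean is at most `b ^ 2 F ^ 2 ≤ b ^ 2 F L`. -/
theorem lintegral_min_sq_meanThreshold_le {g : Ω → ℝ} (hg : Measurable g) {b : ℝ}
    (hb : ∀ᵐ x ∂μ, |g x| ≤ b) (hb0 : 0 ≤ b) {n : ℕ} (hn : 2 ≤ n) {γ : ℝ} (hγ : 1 ≤ γ) :
    ∫⁻ X, ENNReal.ofReal (min ((∫ x, g x ∂μ) ^ 2) (meanThreshold γ b g X ^ 2))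
      ∂(Measure.pi fun _ : Fin n => μ) ≤
      ENNReal.ofReal (123 * γ ^ 2 * min ((∫ x, g x ∂μ) ^ 2)
        (b ^ 2 * μ.real {x | g x ≠ 0} * (Real.log n / n))) := by
  have hL : 0 ≤ Real.log n / n := by positivity
  have hm := abs_integral_le_mul_real hg hb
  have h2 := lintegral_sq_meanThreshold_le hg hb hb0 hn hγ
  set L := Real.log n / n with hLdef
  set F := μ.real {x | g x ≠ 0}
  set m := ∫ x, g x ∂μ
  have hF : 0 ≤ F := measureReal_nonneg
  have h1 : ∫⁻ X, ENNReal.ofReal (min (m ^ 2) (meanThreshold γ b g X ^ 2))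
      ∂(Measure.pi fun _ : Fin n => μ) ≤ ENNReal.ofReal (m ^ 2) := by
    calc _ ≤ ∫⁻ _, ENNReal.ofReal (m ^ 2) ∂(Measure.pi fun _ : Fin n => μ) :=
          lintegral_mono fun X => ENNReal.ofReal_le_ofReal (min_le_left _ _)
      _ = _ := by simp
  have h3 := (lintegral_mono fun X : Fin n → Ω => ENNReal.ofReal_le_ofReal
    (min_le_right (m ^ 2) (meanThreshold γ b g X ^ 2))).trans h2
  have hγ2 : 1 ≤ γ ^ 2 := by nlinarith
  have hm2 : m ^ 2 ≤ b ^ 2 * F ^ 2 := by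
    rw [← sq_abs, ← mul_pow]; exact pow_le_pow_left₀ (abs_nonneg _) hm 2
  have h4 : m ^ 2 ≤ 123 * γ ^ 2 * m ^ 2 := by nlinarith [sq_nonneg m]
  rcases le_total (m ^ 2) (b ^ 2 * F * L) with h | h
  · rw [min_eq_left h]
    exact h1.trans (ENNReal.ofReal_le_ofReal h4)
  · rw [min_eq_right h]
    rcases le_total L F with hLF | hLF
    · refine h3.trans (ENNReal.ofReal_le_ofReal ?_)
      have : b ^ 2 * L * L ≤ b ^ 2 * L * F := mul_le_mul_of_nonneg_left hLF (by positivity)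
      have h6 : 41 * γ ^ 2 * (2 * (b ^ 2 * F) * L + b ^ 2 * L ^ 2)
        ≤ 41 * γ ^ 2 * (3 * (b ^ 2 * F * L)) :=
        mul_le_mul_of_nonneg_left (by nlinarith) (by positivity)
      linarith
    · refine h1.trans (ENNReal.ofReal_le_ofReal ?_)
      have : b ^ 2 * F * F ≤ b ^ 2 * F * L := mul_le_mul_of_nonneg_left hLF (by positivity)
      have h5 : 0 ≤ b ^ 2 * F * L := by positivity
      nlinarith

/-- The constant of `setLIntegral_sq_sampleMean_deviation`. -/
noncomputable def layerConst : ℝ := ∑' k : ℕ, ((k : ℝ) + 2) ^ 2 * (1 / 2) ^ k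

theorem summable_layerConst : Summable fun k : ℕ => ((k : ℝ) + 2) ^ 2 * (1 / 2 : ℝ) ^ k := by
  have h2 := summable_pow_mul_geometric_of_norm_lt_one (R := ℝ) 2 (r := 1 / 2) (by norm_num)
  have h1 := summable_pow_mul_geometric_of_norm_lt_one (R := ℝ) 1 (r := 1 / 2) (by norm_num)
  have h0 := summable_pow_mul_geometric_of_norm_lt_one (R := ℝ) 0 (r := 1 / 2) (by norm_num)
  refine ((h2.add (h1.mul_left 4)).add (h0.mul_left 4)).congr fun k => ?_
  ring

theorem layerConst_nonneg : 0 ≤ layerConst := tsum_nonneg fun k => by positivity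

/-- The deviation is cut into layers between multiples of `z`. Exceeding `(k + 1) z` implies
exceeding the Bernstein radius for `(k + 1) u`, because the square root grows more slowly than
linearly. The layer probabilities thus decay like `exp (-u) ^ (k + 1)` and beat the factor `(k + 2)
^ 2`. -/
theorem setLIntegral_sq_sampleMean_deviation {g : Ω → ℝ} (hg : Measurable g) {b : ℝ}
    (hb : ∀ᵐ x ∂μ, |g x| ≤ b) (hb0 : 0 < b) {n : ℕ} (hn : 0 < n) {u : ℝ} (hu : 0 < u)
    (hu2 : Real.exp (-u) ≤ 1 / 2) {z : ℝ}
    (hz : z = stdDev μ g * √(2 * u / n) + b * √(2 * u / n) ^ 2 / 3) :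
    ∫⁻ X in {X | z < |sampleMean g X - ∫ x, g x ∂μ|},
      ENNReal.ofReal ((sampleMean g X - ∫ x, g x ∂μ) ^ 2) ∂(Measure.pi fun _ : Fin n => μ)
    ≤ ENNReal.ofReal (2 * layerConst * (z ^ 2 * Real.exp (-u))) := by
  have hn' : (0 : ℝ) < n := by exact_mod_cast hn
  set P := Measure.pi fun _ : Fin n => μ
  set m := ∫ x, g x ∂μ
  have hσ := stdDev_nonneg (μ := μ) g
  have hz0 : 0 < z := by
    have : 0 < √(2 * u / n) := Real.sqrt_pos.2 (by positivity)
    rw [hz]; positivity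
  have hmeas : Measurable fun X : Fin n → Ω => |sampleMean g X - m| :=
    ((measurable_sampleMean hg).sub_const m).abs
  have hset : ∀ a : ℝ, MeasurableSet {X : Fin n → Ω | a < |sampleMean g X - m|} := fun a =>
    measurableSet_lt measurable_const hmeas
  have hprob : ∀ k : ℕ, P {X | (k + 1 : ℝ) * z < |sampleMean g X - m|}
      ≤ ENNReal.ofReal (2 * Real.exp (-((k + 1 : ℝ) * u))) := by
    intro k
    have hk : (0 : ℝ) < k + 1 := by positivity
    refine (measure_mono fun X hX => ?_).trans
      (measure_sampleMean_deviation hg hb hb0 hn (mul_pos hk hu))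
    simp only [Set.mem_ofPred_eq] at hX ⊢
    refine lt_of_le_of_lt ?_ hX
    have h1 : √(2 * ((k + 1 : ℝ) * u) / n) ^ 2 = (k + 1) * √(2 * u / n) ^ 2 := by
      rw [Real.sq_sqrt (by positivity), Real.sq_sqrt (by positivity)]; ring
    have h2 : √(2 * ((k + 1 : ℝ) * u) / n) ≤ (k + 1) * √(2 * u / n) := by
      rw [Real.sqrt_le_left (by positivity), mul_pow, Real.sq_sqrt (by positivity)]
      have h3 : 0 ≤ 2 * u / n := by positivity
      have h4 : 2 * ((k + 1 : ℝ) * u) / n = (k + 1) * (2 * u / n) := by ring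
      rw [h4]
      have : (k + 1 : ℝ) ≤ (k + 1) ^ 2 := by nlinarith [(Nat.cast_nonneg k : (0 : ℝ) ≤ k)]
      exact mul_le_mul_of_nonneg_right this h3
    have h5 := mul_le_mul_of_nonneg_left h2 hσ
    rw [h1, hz]
    linarith
  have hpt : ∀ X ∈ {X : Fin n → Ω | z < |sampleMean g X - m|},
      ENNReal.ofReal ((sampleMean g X - m) ^ 2) ≤
        ∑' k : ℕ, Set.indicator {X : Fin n → Ω | (k + 1 : ℝ) * z < |sampleMean g X - m|}
          (fun _ => ENNReal.ofReal (((k : ℝ) + 2) ^ 2 * z ^ 2)) X := by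
    intro X hX
    simp only [Set.mem_ofPred_eq] at hX
    set t := |sampleMean g X - m| with ht
    have h1 : 1 < t / z := (one_lt_div hz0).2 hX
    have hceil : 2 ≤ ⌈t / z⌉₊ := by
      have : 1 < ⌈t / z⌉₊ := Nat.lt_ceil.2 (by exact_mod_cast h1)
      omega
    obtain ⟨k, hk⟩ := Nat.exists_eq_add_of_le hceil
    have h2 : t ≤ (k + 2) * z := by
      have := Nat.le_ceil (t / z)
      rw [hk, div_le_iff₀ hz0] at this
      push_cast at this
      linarith
    have h3 : (k + 1 : ℝ) * z < t := by
      have : ((k + 1 : ℕ) : ℝ) < t / z := Nat.lt_ceil.1 (by omega)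
      rw [lt_div_iff₀ hz0] at this
      push_cast at this
      exact this
    refine le_trans ?_ (ENNReal.le_tsum k)
    rw [Set.indicator_of_mem (show X ∈ {X : Fin n → Ω | (k + 1 : ℝ) * z < |sampleMean g X - m|}
      from h3)]
    refine ENNReal.ofReal_le_ofReal ?_
    rw [← sq_abs, ← mul_pow]
    exact pow_le_pow_left₀ (abs_nonneg _) h2 2
  calc _ ≤ ∫⁻ X in {X | z < |sampleMean g X - m|},
        ∑' k : ℕ, Set.indicator {X : Fin n → Ω | (k + 1 : ℝ) * z < |sampleMean g X - m|}
          (fun _ => ENNReal.ofReal (((k : ℝ) + 2) ^ 2 * z ^ 2)) X ∂P :=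
        setLIntegral_mono' (hset z) hpt
    _ ≤ ∫⁻ X, ∑' k : ℕ, Set.indicator {X : Fin n → Ω | (k + 1 : ℝ) * z < |sampleMean g X - m|}
          (fun _ => ENNReal.ofReal (((k : ℝ) + 2) ^ 2 * z ^ 2)) X ∂P := setLIntegral_le_lintegral _ _
    _ = ∑' k : ℕ, ENNReal.ofReal (((k : ℝ) + 2) ^ 2 * z ^ 2)
          * P {X : Fin n → Ω | (k + 1 : ℝ) * z < |sampleMean g X - m|} := by
        rw [lintegral_tsum fun k => (measurable_const.indicator (hset _)).aemeasurable]
        simp_rw [lintegral_indicator_const (hset _)]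
    _ ≤ ∑' k : ℕ, ENNReal.ofReal (2 * (z ^ 2 * Real.exp (-u)) * (((k : ℝ) + 2) ^ 2 * (1 / 2) ^ k)) := by
        refine ENNReal.tsum_le_tsum fun k => ?_
        refine (mul_le_mul_right (hprob k) _).trans ?_
        rw [← ENNReal.ofReal_mul (by positivity)]
        refine ENNReal.ofReal_le_ofReal ?_
        have h1 : Real.exp (-((k + 1 : ℝ) * u)) = Real.exp (-u) * Real.exp (-u) ^ k := by
          rw [← Real.exp_nat_mul, ← Real.exp_add]; congr 1; ring
        have h2 : Real.exp (-u) ^ k ≤ (1 / 2) ^ k := pow_le_pow_left₀ (Real.exp_pos _).le hu2 k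
        rw [h1]
        calc ((k : ℝ) + 2) ^ 2 * z ^ 2 * (2 * (Real.exp (-u) * Real.exp (-u) ^ k))
            = 2 * (z ^ 2 * Real.exp (-u)) * (((k : ℝ) + 2) ^ 2 * Real.exp (-u) ^ k) := by ring
          _ ≤ _ := by gcongr
    _ = ENNReal.ofReal (2 * layerConst * (z ^ 2 * Real.exp (-u))) := by
        rw [← ENNReal.ofReal_tsum_of_nonneg (fun k => by positivity)
          (summable_layerConst.mul_left _), tsum_mul_left]
        congr 1
        rw [layerConst]; ring

/-- The number of sample points in `s`. -/
noncomputable def sampleCount (s : Set Ω) {n : ℕ} (X : Fin n → Ω) : ℝ :=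
  ∑ i, s.indicator (fun _ => (1 : ℝ)) (X i)

theorem sampleCount_nonneg {Ω : Type*} (s : Set Ω) {n : ℕ} (X : Fin n → Ω) : 0 ≤ sampleCount s X :=
  Finset.sum_nonneg fun _ _ => Set.indicator_nonneg (fun _ _ => zero_le_one) _

/-- Subtracting `1` before integrating keeps the factor `n * μ.real s`: a nonzero count is itself a
rare event. -/
theorem lintegral_exp_sampleCount_sub_one_le {s : Set Ω} (hs : MeasurableSet s) {n : ℕ}
    (hnF : n * μ.real s ≤ 1) :
    ∫⁻ X, ENNReal.ofReal (Real.exp (3 * sampleCount s X) - 1) ∂(Measure.pi fun _ : Fin n => μ)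
      ≤ ENNReal.ofReal (Real.exp 3 * Real.exp (Real.exp 3) * (n * μ.real s)) := by
  set F := μ.real s
  have hF : 0 ≤ F := measureReal_nonneg
  set a := Real.exp 3 - 1 with ha
  have ha0 : 0 ≤ a := by have := Real.add_one_le_exp (3 : ℝ); linarith
  have hind : Measurable (s.indicator fun _ => (1 : ℝ)) := measurable_const.indicator hs
  have h1 : ∫⁻ x, ENNReal.ofReal (Real.exp (3 * s.indicator (fun _ => (1 : ℝ)) x)) ∂μ
      = ENNReal.ofReal (1 + a * F) := by
    have h : ∀ x, Real.exp (3 * s.indicator (fun _ => (1 : ℝ)) x) = 1 + s.indicator (fun _ => a) x := by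
      intro x
      by_cases hx : x ∈ s <;> simp [hx, ha]
    have hi : Integrable (s.indicator fun _ => a) μ := (integrable_const a).indicator hs
    have hi1 : Integrable (fun x => 1 + s.indicator (fun _ => a) x) μ := (integrable_const 1).add hi
    simp_rw [h]
    rw [← ofReal_integral_eq_lintegral_ofReal hi1
      (ae_of_all _ fun x => add_nonneg zero_le_one (Set.indicator_nonneg (fun _ _ => ha0) x)),
      integral_add (integrable_const 1) hi, integral_indicator hs, setIntegral_const]
    simp only [integral_const, probReal_univ, smul_eq_mul, one_mul]
    rw [mul_comm]
  have h2 : ∫⁻ X, ENNReal.ofReal (Real.exp (3 * sampleCount s X)) ∂(Measure.pi fun _ : Fin n => μ)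
      = ENNReal.ofReal ((1 + a * F) ^ n) := by
    have : ∀ X : Fin n → Ω, ENNReal.ofReal (Real.exp (3 * sampleCount s X))
        = ∏ i, ENNReal.ofReal (Real.exp (3 * s.indicator (fun _ => (1 : ℝ)) (X i))) := fun X => by
      rw [sampleCount, Finset.mul_sum, Real.exp_sum,
        ENNReal.ofReal_prod_of_nonneg fun i _ => (Real.exp_pos _).le]
    simp_rw [this]
    rw [lintegral_pi_prod μ n
      (fun _ x => ENNReal.ofReal (Real.exp (3 * s.indicator (fun _ => (1 : ℝ)) x)))
      fun _ => (hind.const_mul 3).exp.ennreal_ofReal]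
    simp only [h1, Finset.prod_const, Finset.card_univ, Fintype.card_fin]
    rw [ENNReal.ofReal_pow (by positivity)]
  have h3 : ∫⁻ X, ENNReal.ofReal (Real.exp (3 * sampleCount s X) - 1)
      ∂(Measure.pi fun _ : Fin n => μ) = ENNReal.ofReal ((1 + a * F) ^ n - 1) := by
    simp_rw [ENNReal.ofReal_sub _ zero_le_one]
    rw [lintegral_sub measurable_const, h2]
    · simp
    · simp
    · refine ae_of_all _ fun X => ENNReal.ofReal_le_ofReal ?_
      exact Real.one_le_exp (mul_nonneg (by norm_num) (sampleCount_nonneg s X))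
  rw [h3]
  refine ENNReal.ofReal_le_ofReal ?_
  set y := a * (n * F) with hy
  have hy0 : 0 ≤ y := by positivity
  have hya : y ≤ a := mul_le_of_le_one_right ha0 hnF
  have h4 : (1 + a * F) ^ n ≤ Real.exp y := by
    calc (1 + a * F) ^ n ≤ Real.exp (a * F) ^ n := by
          refine pow_le_pow_left₀ (by positivity) ?_ n
          have := Real.add_one_le_exp (a * F); linarith
      _ = Real.exp y := by rw [← Real.exp_nat_mul]; congr 1; rw [hy]; ring
  have h5 : Real.exp y - 1 ≤ y * Real.exp y := by
    have h6 := Real.add_one_le_exp (-y)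
    have h7 : Real.exp (-y) * Real.exp y = 1 := by rw [← Real.exp_add]; simp
    nlinarith [Real.exp_pos y]
  have h8 : Real.exp y ≤ Real.exp (Real.exp 3) := Real.exp_le_exp.2 (by linarith)
  calc (1 + a * F) ^ n - 1 ≤ y * Real.exp y := by linarith
    _ ≤ y * Real.exp (Real.exp 3) := mul_le_mul_of_nonneg_left h8 hy0
    _ = a * Real.exp (Real.exp 3) * (n * F) := by rw [hy]; ring
    _ ≤ _ := by
        have : a ≤ Real.exp 3 := by linarith
        gcongr

theorem ae_forall_abs_le {g : Ω → ℝ} {b : ℝ} (hb : ∀ᵐ x ∂μ, |g x| ≤ b) (n : ℕ) :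
    ∀ᵐ X ∂(Measure.pi fun _ : Fin n => μ), ∀ i, |g (X i)| ≤ b := by
  rw [ae_all_iff]
  intro i
  exact (measurePreserving_eval (fun _ : Fin n => μ) i).quasiMeasurePreserving.ae hb

/-- If the support of `g` is rarely hit, a kept mean forces the count `N` of hits to reach `4 γ log
n`. The error is then at most `2 b N / n`, and inserting the factor `exp (N - 4 γ log n) ≥ 1` yields
both the decay in `n` and, through the exponential moment of the count, the mass of the support. -/
theorem setLIntegral_sq_large_mean_le {g : Ω → ℝ} (hg : Measurable g) {b : ℝ}
    (hb : ∀ᵐ x ∂μ, |g x| ≤ b) (hb0 : 0 < b) {n : ℕ} (hn : 2 ≤ n) {γ : ℝ} (hγ : 1 ≤ γ)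
    (hnF : n * μ.real {x | g x ≠ 0} ≤ 1) :
    ∫⁻ X in {X | meanThreshold γ b g X ≤ |sampleMean g X|},
      ENNReal.ofReal ((sampleMean g X - ∫ x, g x ∂μ) ^ 2) ∂(Measure.pi fun _ : Fin n => μ)
    ≤ ENNReal.ofReal (4 * (Real.exp 3 * Real.exp (Real.exp 3)) *
        (b ^ 2 * μ.real {x | g x ≠ 0} / n * Real.exp (-(4 * γ * Real.log n)))) := by
  have hn2 : (2 : ℝ) ≤ n := by exact_mod_cast hn
  have hn' : (0 : ℝ) < n := by linarith
  set s := {x | g x ≠ 0} with hsdef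
  have hs : MeasurableSet s := hg (measurableSet_singleton 0).compl
  set F := μ.real s
  have hF : 0 ≤ F := measureReal_nonneg
  set m := ∫ x, g x ∂μ
  have hm : |m| ≤ b * F := abs_integral_le_mul_real hg hb
  set c := 4 * b ^ 2 / n ^ 2 * Real.exp (-(4 * γ * Real.log n)) with hc
  have hc0 : 0 ≤ c := by positivity
  have hlog : 1 / 2 ≤ Real.log n := by
    have h1 := Real.log_two_gt_d9
    have h2 := Real.log_le_log (by norm_num) hn2
    linarith
  have hset : MeasurableSet {X : Fin n → Ω | meanThreshold γ b g X ≤ |sampleMean g X|} :=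
    measurableSet_le (measurable_meanThreshold hg γ b) (measurable_sampleMean hg).abs
  have hpt : ∀ᵐ X ∂(Measure.pi fun _ : Fin n => μ), meanThreshold γ b g X ≤ |sampleMean g X| →
      ENNReal.ofReal ((sampleMean g X - m) ^ 2)
        ≤ ENNReal.ofReal c * ENNReal.ofReal (Real.exp (3 * sampleCount s X) - 1) := by
    filter_upwards [ae_forall_abs_le hb n] with X hX hthr
    set N := sampleCount s X with hN
    have hmean : |sampleMean g X| ≤ b * N / n := by
      rw [sampleMean, abs_mul, abs_of_nonneg (by positivity : (0 : ℝ) ≤ 1 / n), one_div,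
        inv_mul_le_iff₀ hn']
      calc |∑ i, g (X i)| ≤ ∑ i, |g (X i)| := Finset.abs_sum_le_sum_abs _ _
        _ ≤ ∑ i, b * s.indicator (fun _ => (1 : ℝ)) (X i) := by
            refine Finset.sum_le_sum fun i _ => ?_
            by_cases hx : g (X i) = 0
            · rw [hx, abs_zero]
              exact mul_nonneg hb0.le (Set.indicator_nonneg (fun _ _ => zero_le_one) _)
            · rw [Set.indicator_of_mem (show X i ∈ s from hx), mul_one]
              exact hX i
        _ = n * (b * N / n) := by
            rw [← Finset.mul_sum, hN, sampleCount]; field_simp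
    have hge := meanThreshold_ge g hn hγ hb0.le X
    have hNge : 4 * γ * Real.log n ≤ N := by
      have h1 := (hge.trans hthr).trans hmean
      rw [le_div_iff₀ hn'] at h1
      have h2 : 4 * γ * b * (Real.log n / n) * n = b * (4 * γ * Real.log n) := by field_simp
      rw [h2] at h1
      exact le_of_mul_le_mul_left h1 hb0
    have hN1 : 1 ≤ N := by nlinarith
    rw [← ENNReal.ofReal_mul hc0]
    refine ENNReal.ofReal_le_ofReal ?_
    have hZ : |sampleMean g X - m| ≤ 2 * b * N / n := by
      have h1 := abs_sub (sampleMean g X) m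
      have h2 : b * F ≤ b * N / n := by
        rw [le_div_iff₀ hn']; nlinarith
      have h3 : 2 * b * N / n = b * N / n + b * N / n := by ring
      linarith
    have hexp1 : 1 ≤ Real.exp N * Real.exp (-(4 * γ * Real.log n)) := by
      rw [← Real.exp_add]; exact Real.one_le_exp (by linarith)
    have hexp2 : N ^ 2 * Real.exp N ≤ Real.exp (3 * N) - 1 := by
      have h1 : Real.exp (3 * N) = Real.exp N * Real.exp (2 * N) := by
        rw [← Real.exp_add]; congr 1; ring
      have h2 := Real.quadratic_le_exp_of_nonneg (x := 2 * N) (by linarith)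
      have h3 : 1 ≤ Real.exp N := Real.one_le_exp (by linarith)
      rw [h1]
      nlinarith
    calc (sampleMean g X - m) ^ 2 ≤ (2 * b * N / n) ^ 2 := by
          rw [← sq_abs]; exact pow_le_pow_left₀ (abs_nonneg _) hZ 2
      _ = 4 * b ^ 2 / n ^ 2 * N ^ 2 * 1 := by ring
      _ ≤ 4 * b ^ 2 / n ^ 2 * N ^ 2 * (Real.exp N * Real.exp (-(4 * γ * Real.log n))) :=
          mul_le_mul_of_nonneg_left hexp1 (by positivity)
      _ = c * (N ^ 2 * Real.exp N) := by rw [hc]; ring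
      _ ≤ c * (Real.exp (3 * N) - 1) := mul_le_mul_of_nonneg_left hexp2 hc0
  calc _ ≤ ∫⁻ X in {X | meanThreshold γ b g X ≤ |sampleMean g X|},
        ENNReal.ofReal c * ENNReal.ofReal (Real.exp (3 * sampleCount s X) - 1)
          ∂(Measure.pi fun _ : Fin n => μ) := by
        refine lintegral_mono_ae ((ae_restrict_iff' hset).2 hpt)
    _ ≤ ∫⁻ X, ENNReal.ofReal c * ENNReal.ofReal (Real.exp (3 * sampleCount s X) - 1)
          ∂(Measure.pi fun _ : Fin n => μ) := setLIntegral_le_lintegral _ _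
    _ ≤ ENNReal.ofReal c * ENNReal.ofReal (Real.exp 3 * Real.exp (Real.exp 3) * (n * F)) := by
        rw [lintegral_const_mul' _ _ ENNReal.ofReal_ne_top]
        exact mul_le_mul_right (lintegral_exp_sampleCount_sub_one_le hs hnF) _
    _ = _ := by
        rw [← ENNReal.ofReal_mul hc0]
        congr 1
        rw [hc]; field_simp

/-- As `x` tends to `0` the ratio of the left side to `x ^ 2` tends to `1`. Applied with `a = γ /
γ'`, this is why the oracle inequality needs `n` large. -/
theorem exists_small_deviation_scale {a : ℝ} (ha : 1 < a) :
    ∃ δ > 0, ∀ x : ℝ, 0 ≤ x → x ≤ δ → (x + x ^ 2) ^ 2 * (1 + (x + x ^ 2) ^ 2 / 2) ≤ a * x ^ 2 := by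
  have hc : ContinuousAt (fun x : ℝ => (1 + x) ^ 2 * (1 + (x + x ^ 2) ^ 2 / 2)) 0 := by fun_prop
  have hlt : (fun x : ℝ => (1 + x) ^ 2 * (1 + (x + x ^ 2) ^ 2 / 2)) 0 < a := by simpa using ha
  obtain ⟨δ, hδ, h⟩ := Metric.eventually_nhds_iff.1 (hc.eventually_lt continuousAt_const hlt)
  refine ⟨δ / 2, by positivity, fun x hx0 hx => ?_⟩
  have h1 := h (y := x) (by rw [Real.dist_eq, sub_zero, abs_of_nonneg hx0]; linarith)
  have h2 : (x + x ^ 2) ^ 2 * (1 + (x + x ^ 2) ^ 2 / 2)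
      = (1 + x) ^ 2 * (1 + (x + x ^ 2) ^ 2 / 2) * x ^ 2 := by ring
  rw [h2]
  exact mul_le_mul_of_nonneg_right h1.le (sq_nonneg _)

/-- Including `0 < stdDev μ g` in the event makes it empty in the degenerate case. -/
theorem measure_mean_sq_deviation_le' {g : Ω → ℝ} (hg : Measurable g) {b : ℝ}
    (hb : ∀ᵐ x ∂μ, |g x| ≤ b) (hb0 : 0 < b) {n : ℕ} (hn : 0 < n) {u : ℝ} (hu : 0 < u) :
    (Measure.pi fun _ : Fin n => μ) {X | 0 < stdDev μ g ∧
      1 / (n : ℝ) * ∑ i, (g (X i) - ∫ x, g x ∂μ) ^ 2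
        ≤ stdDev μ g ^ 2 - 2 * b * stdDev μ g * √(2 * u / n)} ≤ ENNReal.ofReal (Real.exp (-u)) := by
  by_cases hσ : 0 < stdDev μ g
  · simpa [hσ] using measure_mean_sq_deviation_le hg hb hb0 hσ hn hu
  · simp [hσ]

/-- Outside both bad events the inflated variance dominates `σ ^ 2`, so the Bernstein radius built
with `γ'` is smaller than the threshold built with `γ`: by the factor `√(γ' / γ)` in the main term
and by `γ' / γ` in the linear one. -/
theorem abs_sampleMean_sub_le_threshold {g : Ω → ℝ} (hg : Measurable g) {b : ℝ}
    (hb : ∀ᵐ x ∂μ, |g x| ≤ b) (hb0 : 0 < b) {n : ℕ} (hn : 2 ≤ n) {γ γ' x : ℝ} (hγ' : 0 < γ')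
    (hγ : γ' < γ) (hx : x = √(2 * (γ' * Real.log n) / n))
    (hsmall : (x + x ^ 2) ^ 2 * (1 + (x + x ^ 2) ^ 2 / 2) ≤ γ / γ' * x ^ 2) {X : Fin n → Ω}
    (h1 : |sampleMean g X - ∫ x, g x ∂μ| ≤ stdDev μ g * x + b * x ^ 2 / 3)
    (h2 : ¬ (0 < stdDev μ g ∧ 1 / (n : ℝ) * ∑ i, (g (X i) - ∫ x, g x ∂μ) ^ 2
        ≤ stdDev μ g ^ 2 - 2 * b * stdDev μ g * x)) :
    |sampleMean g X - ∫ x, g x ∂μ| ≤ √(γ' / γ) * meanThreshold γ b g X := by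
  have hn2 : (2 : ℝ) ≤ n := by exact_mod_cast hn
  have hn' : (0 : ℝ) < n := by linarith
  have hγ0 : 0 < γ := hγ'.trans hγ
  have hσ := stdDev_nonneg (μ := μ) g
  have hσb : stdDev μ g ≤ b := (stdDev_le hg hb).trans_eq (abs_of_pos hb0)
  set σ := stdDev μ g
  have hL : 0 ≤ Real.log n / n := by positivity
  set L := Real.log n / n with hLdef
  have hx2 : x ^ 2 = 2 * γ' * L := by
    rw [hx, Real.sq_sqrt (by positivity), hLdef]; ring
  have hx0 : 0 ≤ x := hx ▸ Real.sqrt_nonneg _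
  have hS := sampleVar_nonneg g hn X
  have hV : σ ^ 2 ≤ inflatedVar γ b g X := by
    rw [inflatedVar, ← hLdef]
    rcases hσ.eq_or_lt with h0 | h0
    · rw [← h0]
      have : 0 ≤ sampleVar g X + 2 * b * √(2 * γ * sampleVar g X * L) + 8 * γ * b ^ 2 * L := by
        positivity
      simpa using this
    · have h3 : σ ^ 2 - 2 * b * σ * x ≤ 1 / (n : ℝ) * ∑ i, (g (X i) - ∫ x, g x ∂μ) ^ 2 := by
        by_contra hcon
        exact h2 ⟨h0, (not_le.1 hcon).le⟩
      have hq2 : √(2 * γ * L) ^ 2 = 2 * γ * L := Real.sq_sqrt (by positivity)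
      have h4 := sq_le_inflated (q := √(2 * γ * L)) hσ hb0 hσb hx0 (Real.sqrt_nonneg _)
        (by rw [hq2]; refine hsmall.trans_eq ?_; rw [hx2]; field_simp) hS
        (sampleVar_ge g hn X (∫ x, g x ∂μ)) h3 h1
      rw [hq2] at h4
      have e1 : 2 * γ * L * sampleVar g X = 2 * γ * sampleVar g X * L := by ring
      rw [e1] at h4
      linarith
  refine h1.trans ?_
  have hκ : √(γ' / γ) ^ 2 = γ' / γ := Real.sq_sqrt (by positivity)
  have hκ1 : √(γ' / γ) ≤ 1 := Real.sqrt_le_one.2 ((div_le_one hγ0).2 hγ.le)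
  have hκ0 : 0 ≤ √(γ' / γ) := Real.sqrt_nonneg _
  have hV0 : 0 ≤ inflatedVar γ b g X := (sq_nonneg σ).trans hV
  rw [meanThreshold, mul_add]
  refine add_le_add ?_ ?_
  · rw [← Real.sqrt_mul (by positivity)]
    refine Real.le_sqrt_of_sq_le ?_
    rw [mul_pow, hx2]
    calc σ ^ 2 * (2 * γ' * L) ≤ inflatedVar γ b g X * (2 * γ' * L) :=
          mul_le_mul_of_nonneg_right hV (by positivity)
      _ = γ' / γ * (2 * γ * inflatedVar γ b g X * (Real.log n / n)) := by
          rw [hLdef]; field_simp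
  · have h5 : γ' ≤ √(γ' / γ) * γ := by
      have : √(γ' / γ) ^ 2 * γ = γ' := by rw [hκ]; field_simp
      nlinarith
    have h6 : √(γ' / γ) * (2 * b * γ * Real.log n / (3 * n)) = 2 / 3 * b * L * (√(γ' / γ) * γ) := by
      rw [hLdef]; field_simp
    rw [h6, hx2]
    have h7 : 2 / 3 * b * L * γ' ≤ 2 / 3 * b * L * (√(γ' / γ) * γ) :=
      mul_le_mul_of_nonneg_left h5 (by positivity)
    linarith

end Deviation

section Deviation

variable {Ω : Type*} [MeasurableSpace Ω]

theorem tendsto_log_div_nat : Tendsto (fun n : ℕ => Real.log n / n) atTop (𝓝 0) := by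
  have h := (Real.isLittleO_log_id_atTop.tendsto_div_nhds_zero).comp
    (tendsto_natCast_atTop_atTop (R := ℝ))
  exact h

theorem half_le_log_nat {n : ℕ} (hn : 2 ≤ n) : 1 / 2 ≤ Real.log n := by
  have hn2 : (2 : ℝ) ≤ n := by exact_mod_cast hn
  have h1 := Real.log_two_gt_d9
  have h2 := Real.log_le_log (by norm_num) hn2
  linarith

theorem sq_bernstein_bound_le {σ x b F L γ' l : ℝ} (hF : 0 ≤ F) (hL : 0 ≤ L) (hl : 0 ≤ l)
    (hγ' : 1 ≤ γ') (hσ2 : σ ^ 2 ≤ b ^ 2 * F) (hx2 : x ^ 2 = 2 * γ' * L) (hLF : L ≤ F * l) :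
    (σ * x + b * x ^ 2 / 3) ^ 2 ≤ 4 * γ' ^ 2 * (b ^ 2 * F * L * (1 + l)) := by
  have h1 : (σ * x + b * x ^ 2 / 3) ^ 2 ≤ 2 * (σ ^ 2 * x ^ 2) + 2 / 9 * b ^ 2 * (x ^ 2) ^ 2 := by
    nlinarith [sq_nonneg (σ * x - b * x ^ 2 / 3)]
  rw [hx2] at h1 ⊢
  have h2 : σ ^ 2 * (2 * γ' * L) ≤ b ^ 2 * F * (2 * γ' * L) :=
    mul_le_mul_of_nonneg_right hσ2 (by positivity)
  have h3 : b ^ 2 * γ' ^ 2 * L * L ≤ b ^ 2 * γ' ^ 2 * L * (F * l) :=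
    mul_le_mul_of_nonneg_left hLF (by positivity)
  have h4 : γ' * (b ^ 2 * F * L) ≤ γ' ^ 2 * (b ^ 2 * F * L) :=
    mul_le_mul_of_nonneg_right (by nlinarith) (by positivity)
  have h5 : 0 ≤ b ^ 2 * γ' ^ 2 * L * (F * l) := by positivity
  calc _ ≤ _ := h1
    _ = 2 * (σ ^ 2 * (2 * γ' * L)) + 8 / 9 * (b ^ 2 * γ' ^ 2 * L * L) := by ring
    _ ≤ 2 * (b ^ 2 * F * (2 * γ' * L)) + 8 / 9 * (b ^ 2 * γ' ^ 2 * L * (F * l)) := by linarith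
    _ = 4 * (γ' * (b ^ 2 * F * L)) + 8 / 9 * (b ^ 2 * γ' ^ 2 * L * (F * l)) := by ring
    _ ≤ 4 * (γ' ^ 2 * (b ^ 2 * F * L)) + 4 * (b ^ 2 * γ' ^ 2 * L * (F * l)) := by linarith
    _ = _ := by ring

/-- The bound must carry the mass `F` of the support. If `n F ≤ 1`, it comes from the count of hits.
If `n F ≥ 1`, then `L ≤ F log n`, and the squared Bernstein radius is itself at most of order `b ^ 2
F L (1 + log n)`. -/
theorem setLIntegral_sq_deviation_le {γ γ' : ℝ} (hγ' : 1 ≤ γ') (hγ : γ' < γ) {n : ℕ} (hn : 2 ≤ n)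
    {μ : Measure Ω} [IsProbabilityMeasure μ] {g : Ω → ℝ} {b : ℝ} (hg : Measurable g) (hb0 : 0 < b)
    (hb : ∀ᵐ x ∂μ, |g x| ≤ b) {x z : ℝ} (hx : x = √(2 * (γ' * Real.log n) / n))
    (hz : z = stdDev μ g * x + b * x ^ 2 / 3) (hu2 : Real.exp (-(γ' * Real.log n)) ≤ 1 / 2) :
    ∫⁻ X in ({X : Fin n → Ω | z < |sampleMean g X - ∫ x, g x ∂μ|} ∪
        {X : Fin n → Ω | 0 < stdDev μ g ∧ 1 / (n : ℝ) * ∑ i, (g (X i) - ∫ x, g x ∂μ) ^ 2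
          ≤ stdDev μ g ^ 2 - 2 * b * stdDev μ g * x}) ∩
        {X : Fin n → Ω | meanThreshold γ b g X ≤ |sampleMean g X|},
      ENNReal.ofReal ((sampleMean g X - ∫ x, g x ∂μ) ^ 2) ∂(Measure.pi fun _ : Fin n => μ) ≤
    ENNReal.ofReal ((8 * (Real.exp 3 * Real.exp (Real.exp 3)) + 4 * γ' ^ 2 * (2 * layerConst + 1)) *
      (b ^ 2 * μ.real {x | g x ≠ 0} * (Real.log n / n) * (1 + Real.log n)
        * Real.exp (-(γ' * Real.log n)))) := by
  have hn2 : (2 : ℝ) ≤ n := by exact_mod_cast hn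
  have hn' : (0 : ℝ) < n := by linarith
  have hnpos : 0 < n := by omega
  have hlog := half_le_log_nat hn
  have hlc := layerConst_nonneg
  have hγ'0 : 0 < γ' := by linarith
  set P := Measure.pi fun _ : Fin n => μ with hP
  set m := ∫ x, g x ∂μ with hm
  set F := μ.real {x | g x ≠ 0} with hF
  have hF0 : 0 ≤ F := measureReal_nonneg
  set u := γ' * Real.log n with hu
  have hu0 : 0 < u := by positivity
  set σ := stdDev μ g with hσdef
  set e := Real.exp (-u) with he
  have he0 : 0 < e := Real.exp_pos _
  set E := Real.exp 3 * Real.exp (Real.exp 3) with hE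
  have hE0 : 0 < E := by positivity
  set A₁ := {X : Fin n → Ω | z < |sampleMean g X - m|} with hA₁
  set A₂ := {X : Fin n → Ω | 0 < σ ∧ 1 / (n : ℝ) * ∑ i, (g (X i) - m) ^ 2
        ≤ σ ^ 2 - 2 * b * σ * x} with hA₂
  have hmean : Measurable fun X : Fin n → Ω => sampleMean g X - m :=
    (measurable_sampleMean hg).sub_const m
  have hA₁m : MeasurableSet A₁ := measurableSet_lt measurable_const hmean.abs
  have hA₂m : MeasurableSet A₂ := by
    have hm2 : Measurable fun X : Fin n → Ω => 1 / (n : ℝ) * ∑ i, (g (X i) - m) ^ 2 :=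
      (Finset.measurable_fun_sum _ fun i _ =>
      ((hg.comp (measurable_pi_apply i)).sub_const m).pow_const 2).const_mul _
    by_cases h0 : 0 < σ
    · simpa [hA₂, h0] using measurableSet_le hm2 measurable_const
    · simp [hA₂, h0]
  have hA₂P : P A₂ ≤ ENNReal.ofReal e := by
    rw [hA₂, hx]; exact measure_mean_sq_deviation_le' hg hb hb0 hnpos hu0
  set T := {X : Fin n → Ω | meanThreshold γ b g X ≤ |sampleMean g X|} with hT
  set L := Real.log n / n with hL
  have hL0 : 0 ≤ L := by positivity
  have hbase : 0 ≤ b ^ 2 * F * L * (1 + Real.log n) * e := by positivity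
  rcases le_total ((n : ℝ) * F) 1 with hnF | hnF
  · refine (lintegral_mono_set Set.inter_subset_right).trans
      ((setLIntegral_sq_large_mean_le hg hb hb0 hn (hγ'.trans hγ.le) hnF).trans
        (ENNReal.ofReal_le_ofReal ?_))
    have h1 : Real.exp (-(4 * γ * Real.log n)) ≤ e := by
      rw [he, hu]; exact Real.exp_le_exp.2 (by nlinarith)
    have h2 : b ^ 2 * F / n ≤ 2 * (b ^ 2 * F * L * (1 + Real.log n)) := by
      have h3 : b ^ 2 * F / n * 1 ≤ b ^ 2 * F / n * (2 * (Real.log n * (1 + Real.log n))) :=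
        mul_le_mul_of_nonneg_left (by nlinarith) (by positivity)
      have h4 : b ^ 2 * F / n * (2 * (Real.log n * (1 + Real.log n)))
        = 2 * (b ^ 2 * F * L * (1 + Real.log n)) := by rw [hL]; ring
      linarith
    calc 4 * E * (b ^ 2 * F / n * Real.exp (-(4 * γ * Real.log n)))
        ≤ 4 * E * (2 * (b ^ 2 * F * L * (1 + Real.log n)) * e) := by gcongr
      _ = 8 * E * (b ^ 2 * F * L * (1 + Real.log n) * e) := by ring
      _ ≤ _ := by
        refine mul_le_mul_of_nonneg_right ?_ hbase
        have : 0 ≤ 4 * γ' ^ 2 * (2 * layerConst + 1) := by positivity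
        linarith
  · have hz2 : z ^ 2 ≤ 4 * γ' ^ 2 * (b ^ 2 * F * L * (1 + Real.log n)) := by
      have hσ2 : σ ^ 2 ≤ b ^ 2 * F := (sq_stdDev_le hg hb).trans (integral_sq_le_mul_real hg hb)
      have hx2 : x ^ 2 = 2 * γ' * L := by
        rw [hx, Real.sq_sqrt (by positivity), hu, hL]; ring
      have hLF : L ≤ F * Real.log n := by
        rw [hL, div_le_iff₀ hn']
        calc Real.log n = 1 * Real.log n := (one_mul _).symm
          _ ≤ n * F * Real.log n := mul_le_mul_of_nonneg_right hnF (by linarith)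
          _ = _ := by ring
      rw [hz]
      exact sq_bernstein_bound_le hF0 hL0 (by linarith) hγ' hσ2 hx2 hLF
    have hsplit : ∫⁻ X in (A₁ ∪ A₂) ∩ T, ENNReal.ofReal ((sampleMean g X - m) ^ 2) ∂P
        ≤ ∫⁻ X in A₁, ENNReal.ofReal ((sampleMean g X - m) ^ 2) ∂P + ∫⁻ _ in A₂, ENNReal.ofReal (z ^ 2) ∂P := by
      refine (lintegral_mono_set Set.inter_subset_left).trans ?_
      have h0 : A₁ ∪ A₂ = A₁ ∪ (A₁ᶜ ∩ A₂) := by rw [← Set.sdiff_eq_compl_inter, Set.union_sdiff_self]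
      rw [h0]
      -- On `A₂` outside `A₁` the deviation is at most `z`, so only the probability of `A₂` matters.
      refine (lintegral_union_le _ _ _).trans (add_le_add_right ?_ _)
      calc _ ≤ ∫⁻ _ in A₁ᶜ ∩ A₂, ENNReal.ofReal (z ^ 2) ∂P := by
            refine setLIntegral_mono_ae' (hA₁m.compl.inter hA₂m) (ae_of_all _ fun X hX => ?_)
            refine ENNReal.ofReal_le_ofReal ?_
            rw [← sq_abs]
            have hXz : ¬ z < |sampleMean g X - m| := hX.1
            exact pow_le_pow_left₀ (abs_nonneg _) (not_lt.1 hXz) 2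
        _ ≤ _ := lintegral_mono_set Set.inter_subset_right
    have h1 := setLIntegral_sq_sampleMean_deviation hg hb hb0 hnpos hu0 hu2 (hz.trans (by rw [hx]))
    have h2 : ∫⁻ _ in A₂, ENNReal.ofReal (z ^ 2) ∂P ≤ ENNReal.ofReal (z ^ 2 * e) := by
      rw [setLIntegral_const, ENNReal.ofReal_mul (sq_nonneg z)]
      gcongr
    refine hsplit.trans ((add_le_add h1 h2).trans ?_)
    rw [← ENNReal.ofReal_add (by positivity) (by positivity)]
    refine ENNReal.ofReal_le_ofReal ?_
    calc 2 * layerConst * (z ^ 2 * e) + z ^ 2 * e = (2 * layerConst + 1) * (z ^ 2 * e) := by ring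
      _ ≤ (2 * layerConst + 1) * (4 * γ' ^ 2 * (b ^ 2 * F * L * (1 + Real.log n)) * e) := by gcongr
      _ = 4 * γ' ^ 2 * (2 * layerConst + 1) * (b ^ 2 * F * L * (1 + Real.log n) * e) := by ring
      _ ≤ _ := by
        refine mul_le_mul_of_nonneg_right ?_ hbase
        linarith

theorem weighted_sum_le {M S R K K₂ G : ℝ} (hM : 0 ≤ M) (hS : 0 ≤ S * G) (hR : 0 ≤ R)
    {k : ℝ} (hK : 0 ≤ K * k) (hK₂ : 0 ≤ K₂) :
    K * (k * M) + (S * (3 * G) + K₂ * R) ≤ (K * k + 3 + K₂) * (M + S * G + R) := by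
  have d1 := mul_nonneg hK hS
  have d2 := mul_nonneg hK hR
  have d3 := mul_nonneg hK₂ hS
  have d4 := mul_nonneg hK₂ hM
  linarith

/-- The risk of a thresholded sample mean. -/
theorem exists_thresholdedMean_risk_bound {γ γ' : ℝ} (hγ' : 1 ≤ γ') (hγ : γ' < γ) :
    ∃ C : ℝ, 0 < C ∧ ∃ n₀ : ℕ, ∀ n : ℕ, n₀ ≤ n → 2 ≤ n → ∀ (μ : Measure Ω) [IsProbabilityMeasure μ]
      (g : Ω → ℝ) (b : ℝ), Measurable g → 0 < b → (∀ᵐ x ∂μ, |g x| ≤ b) →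
      ∫⁻ X, ENNReal.ofReal ((thresholdedMean γ b g X - ∫ x, g x ∂μ) ^ 2)
          ∂(Measure.pi fun _ : Fin n => μ) ≤
        ENNReal.ofReal (C * (min ((∫ x, g x ∂μ) ^ 2)
            (b ^ 2 * μ.real {x | g x ≠ 0} * (Real.log n / n))
          + (∫ x, g x ∂μ) ^ 2 * Real.exp (-(γ' * Real.log n))
          + b ^ 2 * μ.real {x | g x ≠ 0} * (Real.log n / n) * (1 + Real.log n)
            * Real.exp (-(γ' * Real.log n)))) := by
  have hγ'0 : 0 < γ' := by linarith
  have hγ0 : 0 < γ := by linarith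
  obtain ⟨δ, hδ, hsmall⟩ := exists_small_deviation_scale (a := γ / γ') ((one_lt_div hγ'0).2 hγ)
  have htend : Tendsto (fun n : ℕ => √(2 * (γ' * Real.log n) / n)) atTop (𝓝 0) := by
    have h := ((tendsto_log_div_nat.const_mul (2 * γ')).sqrt)
    simp only [mul_zero, Real.sqrt_zero] at h
    refine h.congr fun n => ?_
    congr 1; ring
  obtain ⟨n₀, hn₀⟩ := eventually_atTop.1 (htend.eventually_le_const hδ)
  set κ := √(γ' / γ) with hκ
  have hκ1 : κ < 1 := by
    rw [hκ, Real.sqrt_lt' one_pos, one_pow, div_lt_one hγ0]; exact hγ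
  set K := 4 + 1 / (1 - κ) ^ 2 with hK
  have hK0 : 0 < K := by positivity
  set E := Real.exp 3 * Real.exp (Real.exp 3) with hE
  have hE0 : 0 < E := by positivity
  have hlc := layerConst_nonneg
  refine ⟨K * (123 * γ ^ 2) + 3 + (8 * E + 4 * γ' ^ 2 * (2 * layerConst + 1)), by positivity, n₀,
    fun n hnn hn μ _ g b hg hb0 hb => ?_⟩
  have hn2 : (2 : ℝ) ≤ n := by exact_mod_cast hn
  have hn' : (0 : ℝ) < n := by linarith
  have hnpos : 0 < n := by omega
  have hlog := half_le_log_nat hn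
  set P := Measure.pi fun _ : Fin n => μ with hP
  set m := ∫ x, g x ∂μ with hm
  set F := μ.real {x | g x ≠ 0} with hF
  have hF0 : 0 ≤ F := measureReal_nonneg
  set u := γ' * Real.log n with hu
  have hu0 : 0 < u := by positivity
  set x := √(2 * u / n) with hx
  have hx0 : 0 ≤ x := Real.sqrt_nonneg _
  have hsm := hsmall x hx0 (hn₀ n hnn)
  set σ := stdDev μ g with hσdef
  have hσ : 0 ≤ σ := stdDev_nonneg g
  set z := σ * x + b * x ^ 2 / 3 with hz
  have hz0 : 0 ≤ z := by positivity
  have hu2 : Real.exp (-u) ≤ 1 / 2 := by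
    have h1 : Real.log 2 ≤ u := by
      have := Real.log_le_log (by norm_num) hn2
      nlinarith
    calc Real.exp (-u) ≤ Real.exp (-Real.log 2) := Real.exp_le_exp.2 (by linarith)
      _ = 1 / 2 := by rw [Real.exp_neg, Real.exp_log (by norm_num)]; norm_num
  set e := Real.exp (-u) with he
  have he0 : 0 < e := Real.exp_pos _
  set A₁ := {X : Fin n → Ω | z < |sampleMean g X - m|} with hA₁
  set A₂ := {X : Fin n → Ω | 0 < σ ∧ 1 / (n : ℝ) * ∑ i, (g (X i) - m) ^ 2
        ≤ σ ^ 2 - 2 * b * σ * x} with hA₂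
  have hmean : Measurable fun X : Fin n → Ω => sampleMean g X - m :=
    (measurable_sampleMean hg).sub_const m
  have hA₁m : MeasurableSet A₁ := measurableSet_lt measurable_const hmean.abs
  have hA₂m : MeasurableSet A₂ := by
    have hm2 : Measurable fun X : Fin n → Ω => 1 / (n : ℝ) * ∑ i, (g (X i) - m) ^ 2 :=
      (Finset.measurable_fun_sum _ fun i _ =>
      ((hg.comp (measurable_pi_apply i)).sub_const m).pow_const 2).const_mul _
    by_cases h0 : 0 < σ
    · simpa [hA₂, h0] using measurableSet_le hm2 measurable_const
    · simp [hA₂, h0]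
  have hA₁P : P A₁ ≤ ENNReal.ofReal (2 * e) := measure_sampleMean_deviation hg hb hb0 hnpos hu0
  have hA₂P : P A₂ ≤ ENNReal.ofReal e := measure_mean_sq_deviation_le' hg hb hb0 hnpos hu0
  set T := {X : Fin n → Ω | meanThreshold γ b g X ≤ |sampleMean g X|} with hT
  have hTm : MeasurableSet T :=
    measurableSet_le (measurable_meanThreshold hg γ b) (measurable_sampleMean hg).abs
  have hBm := hA₁m.union hA₂m
  set B := A₁ ∪ A₂ with hB
  have hBP : P B ≤ ENNReal.ofReal (3 * e) := by
    refine (measure_union_le _ _).trans ((add_le_add hA₁P hA₂P).trans_eq ?_)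
    rw [← ENNReal.ofReal_add (by positivity) he0.le]; congr 1; ring
  set Zf : (Fin n → Ω) → ℝ≥0∞ := fun X => ENNReal.ofReal ((sampleMean g X - m) ^ 2) with hZf
  have hZm : Measurable Zf := (hmean.pow_const 2).ennreal_ofReal
  -- Outside `B` the oracle inequality applies. On `B` the error is at most `m ^ 2`, plus the
  -- squared deviation if the coefficient is kept, that is on `B ∩ T`.
  have hpt : ∀ X, ENNReal.ofReal ((thresholdedMean γ b g X - m) ^ 2) ≤
      ENNReal.ofReal K * ENNReal.ofReal (min (m ^ 2) (meanThreshold γ b g X ^ 2))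
        + (B.indicator (fun _ => ENNReal.ofReal (m ^ 2)) X + (B ∩ T).indicator Zf X) := by
    intro X
    by_cases hXB : X ∈ B
    · refine le_add_left ?_
      rw [Set.indicator_of_mem hXB]
      refine (ENNReal.ofReal_le_ofReal
        (sq_threshold_sub_le (meanThreshold γ b g X) (sampleMean g X) m)).trans ?_
      rw [ENNReal.ofReal_add (sq_nonneg _) (by split_ifs <;> positivity)]
      gcongr
      by_cases hXT : X ∈ T
      · rw [Set.indicator_of_mem (Set.mem_inter hXB hXT),
          if_pos (show meanThreshold γ b g X ≤ |sampleMean g X| from hXT)]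
      · rw [if_neg (show ¬ meanThreshold γ b g X ≤ |sampleMean g X| from hXT)]; simp
    · refine le_add_right ?_
      rw [← ENNReal.ofReal_mul hK0.le]
      refine ENNReal.ofReal_le_ofReal ?_
      simp only [hB, Set.mem_union, not_or] at hXB
      have h1 : |sampleMean g X - m| ≤ κ * meanThreshold γ b g X :=
        abs_sampleMean_sub_le_threshold hg hb hb0 hn hγ'0 hγ hx hsm (not_lt.1 hXB.1) hXB.2
      have h2 : 0 ≤ meanThreshold γ b g X :=
        le_trans (by positivity) (meanThreshold_ge g hn (hγ'.trans hγ.le) hb0.le X)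
      exact sq_threshold_sub_le_of_le hκ1 h2 h1
  have hmin := lintegral_min_sq_meanThreshold_le hg hb hb0.le hn (hγ'.trans hγ.le)
  set L := Real.log n / n with hL
  have hL0 : 0 ≤ L := by positivity
  have hTail := setLIntegral_sq_deviation_le hγ' hγ hn hg hb0 hb hx hz hu2
  calc _ ≤ ∫⁻ X, (ENNReal.ofReal K * ENNReal.ofReal (min (m ^ 2) (meanThreshold γ b g X ^ 2))
        + (B.indicator (fun _ => ENNReal.ofReal (m ^ 2)) X + (B ∩ T).indicator Zf X)) ∂P :=
        lintegral_mono hpt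
    _ = ENNReal.ofReal K * ∫⁻ X, ENNReal.ofReal (min (m ^ 2) (meanThreshold γ b g X ^ 2)) ∂P
        + (ENNReal.ofReal (m ^ 2) * P B + ∫⁻ X in B ∩ T, Zf X ∂P) := by
        have hmm : Measurable fun X => B.indicator (fun _ => ENNReal.ofReal (m ^ 2)) X
            + (B ∩ T).indicator Zf X :=
          (measurable_const.indicator hBm).add (hZm.indicator (hBm.inter hTm))
        rw [lintegral_add_right _ hmm, lintegral_const_mul' _ _ ENNReal.ofReal_ne_top,
          lintegral_add_left (measurable_const.indicator hBm), lintegral_indicator_const hBm,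
          lintegral_indicator (hBm.inter hTm)]
    _ ≤ ENNReal.ofReal K * ENNReal.ofReal (123 * γ ^ 2 * min (m ^ 2) (b ^ 2 * F * L))
        + (ENNReal.ofReal (m ^ 2) * ENNReal.ofReal (3 * e) + ENNReal.ofReal
      ((8 * E + 4 * γ' ^ 2 * (2 * layerConst + 1)) * (b ^ 2 * F * L * (1 + Real.log n) * e))) := by
        gcongr
    _ ≤ _ := by
        have hmin0 : 0 ≤ min (m ^ 2) (b ^ 2 * F * L) := le_min (sq_nonneg _) (by positivity)
        rw [← ENNReal.ofReal_mul hK0.le, ← ENNReal.ofReal_mul (sq_nonneg m),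
          ← ENNReal.ofReal_add (by positivity) (by positivity),
          ← ENNReal.ofReal_add (by positivity) (by positivity)]
        refine ENNReal.ofReal_le_ofReal ?_
        have c1 : 0 ≤ K * (123 * γ ^ 2) := by positivity
        have c2 : 0 ≤ 8 * E + 4 * γ' ^ 2 * (2 * layerConst + 1) := by positivity
        have c3 : 0 ≤ m ^ 2 * e := by positivity
        have c4 : 0 ≤ b ^ 2 * F * L * (1 + Real.log n) * e := by positivity
        exact weighted_sum_le hmin0 c3 c4 c1 c2

/-- A crude bound for every positive `n`, used only to know that the risk is finite for the finitely
many small sample sizes. -/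
theorem lintegral_sq_thresholdedMean_le {μ : Measure Ω} [IsProbabilityMeasure μ] {g : Ω → ℝ}
    (hg : Measurable g) {b : ℝ} (hb : ∀ᵐ x ∂μ, |g x| ≤ b) {n : ℕ} (hn : 0 < n) (γ b' : ℝ) :
    ∫⁻ X, ENNReal.ofReal ((thresholdedMean γ b' g X - ∫ x, g x ∂μ) ^ 2)
        ∂(Measure.pi fun _ : Fin n => μ) ≤
      ENNReal.ofReal (2 * (b ^ 2 * μ.real {x | g x ≠ 0}) + 2 * (∫ x, g x ∂μ) ^ 2) := by
  have hn' : (0 : ℝ) < n := by exact_mod_cast hn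
  set m := ∫ x, g x ∂μ
  have hpt : ∀ X : Fin n → Ω, ENNReal.ofReal ((thresholdedMean γ b' g X - m) ^ 2) ≤
      2 * ENNReal.ofReal (1 / n * ∑ i, g (X i) ^ 2) + ENNReal.ofReal (2 * m ^ 2) := by
    intro X
    have h0 : 0 ≤ 1 / (n : ℝ) * ∑ i, g (X i) ^ 2 :=
      mul_nonneg (by positivity) (Finset.sum_nonneg fun i _ => sq_nonneg _)
    have h2 : (2 : ℝ≥0∞) = ENNReal.ofReal 2 := by simp
    rw [h2, ← ENNReal.ofReal_mul (by norm_num), ← ENNReal.ofReal_add (by positivity) (by positivity)]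
    refine ENNReal.ofReal_le_ofReal ?_
    have h1 : sampleMean g X ^ 2 ≤ 1 / n * ∑ i, g (X i) ^ 2 := by
      have := sq_sum_le_card_mul_sum_sq (s := (Finset.univ : Finset (Fin n))) (f := fun i => g (X i))
      simp only [Finset.card_univ, Fintype.card_fin] at this
      rw [sampleMean, mul_pow]
      calc (1 / (n : ℝ)) ^ 2 * (∑ i, g (X i)) ^ 2
          ≤ (1 / (n : ℝ)) ^ 2 * (n * ∑ i, g (X i) ^ 2) := by gcongr
        _ = _ := by field_simp
    have h3 : thresholdedMean γ b' g X ^ 2 ≤ sampleMean g X ^ 2 := by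
      unfold thresholdedMean
      split_ifs
      · exact le_rfl
      · simpa using sq_nonneg (sampleMean g X)
    nlinarith [sq_nonneg (thresholdedMean γ b' g X + m)]
  calc _ ≤ ∫⁻ X, (2 * ENNReal.ofReal (1 / n * ∑ i, g (X i) ^ 2) + ENNReal.ofReal (2 * m ^ 2))
        ∂(Measure.pi fun _ : Fin n => μ) := lintegral_mono hpt
    _ ≤ 2 * ENNReal.ofReal (b ^ 2 * μ.real {x | g x ≠ 0}) + ENNReal.ofReal (2 * m ^ 2) := by
        rw [lintegral_add_right _ measurable_const, lintegral_const_mul' _ _ (by simp)]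
        simp only [lintegral_const, measure_univ, mul_one]
        gcongr
        exact lintegral_mean_sq_le hg hb hn
    _ = _ := by
        have : 0 ≤ μ.real {x | g x ≠ 0} := measureReal_nonneg
        have h2 : (2 : ℝ≥0∞) = ENNReal.ofReal 2 := by simp
        rw [h2, ← ENNReal.ofReal_mul (by norm_num), ← ENNReal.ofReal_add (by positivity) (by positivity)]

end Deviation

/-! ### Sums over the levels of a sequence in a Besov ball -/

/-- The level numbers `0` and `1` share the scale `2 ^ 0`, which is counted twice. -/
theorem tsum_comp_pred_le (f : ℕ → ℝ≥0∞) : ∑' j, f (j - 1) ≤ 2 * ∑' e, f e := by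
  rw [tsum_eq_zero_add' ENNReal.summable, two_mul]
  simp only [Nat.zero_sub, Nat.add_sub_cancel]
  exact add_le_add_left (ENNReal.le_tsum 0) _

/-- The two bounds cross where `2 ^ e = M = (B / A) ^ (1 / (1 + a))`. The increasing one is summed
below the crossing and the decreasing one above; both geometric sums are of the order of the common
value `A * M`. -/
theorem exists_tsum_min_le {a : ℝ} (ha : 0 < a) : ∃ C : ℝ, 0 < C ∧ ∀ A B : ℝ, 0 < A → 0 < B →
    ∑' e : ℕ, ENNReal.ofReal (min (A * 2 ^ (e : ℝ)) (B * 2 ^ (-(e : ℝ) * a))) ≤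
      ENNReal.ofReal (C * (A ^ (a / (1 + a)) * B ^ (1 / (1 + a)))) := by
  obtain ⟨θ, hθ⟩ : ∃ θ : ℝ, θ = 2 ^ (-a) := ⟨_, rfl⟩
  have hθ0 : 0 < θ := by rw [hθ]; positivity
  have hθ1 : θ < 1 := hθ ▸ Real.rpow_lt_one_of_one_lt_of_neg (by norm_num) (by linarith)
  have hS : 0 < 1 - θ := by linarith
  refine ⟨2 + (1 - θ)⁻¹, by positivity, fun A B hA hB => ?_⟩
  set M := (B / A) ^ (1 / (1 + a)) with hM
  have hM0 : 0 < M := by positivity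
  set V := A ^ (a / (1 + a)) * B ^ (1 / (1 + a)) with hV
  have hV0 : 0 < V := by positivity
  have h1a : (1 : ℝ) + a ≠ 0 := by positivity
  have hVA : V = A * M := by
    rw [hV, hM, Real.div_rpow hB.le hA.le, mul_div_assoc', eq_div_iff (by positivity), mul_right_comm,
      ← Real.rpow_add hA, ← add_div, add_comm a 1, div_self h1a, Real.rpow_one]
  have hVB : V = B * M ^ (-a) := by
    rw [hVA]
    have h : M ^ (1 + a) = B / A := by
      rw [hM, ← Real.rpow_mul (by positivity), one_div_mul_cancel h1a, Real.rpow_one]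
    have h2 : M ^ (1 + a) * M ^ (-a) = M := by
      rw [← Real.rpow_add hM0]; simp
    rw [h] at h2
    have : A * (B / A * M ^ (-a)) = B * M ^ (-a) := by field_simp
    rw [← this, h2]
  have hex : ∃ E : ℕ, M < 2 ^ E := pow_unbounded_of_one_lt M (by norm_num)
  classical
  set E := Nat.find hex with hE
  have hEM : M < 2 ^ E := Nat.find_spec hex
  have hsmall : ∑ e ∈ Finset.range E, ENNReal.ofReal (min (A * 2 ^ (e : ℝ)) (B * 2 ^ (-(e : ℝ) * a)))
      ≤ ENNReal.ofReal (V * 2) := by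
    rw [← ENNReal.ofReal_sum_of_nonneg fun e _ => by positivity]
    refine ENNReal.ofReal_le_ofReal ?_
    rcases Nat.eq_zero_or_pos E with h0 | h0
    · rw [h0]; simp only [Finset.range_zero, Finset.sum_empty]; positivity
    · have hlast : (2 : ℝ) ^ (E - 1) ≤ M := not_lt.1 (Nat.find_min hex (by omega))
      have hp : (2 : ℝ) ^ E = 2 * 2 ^ (E - 1) := by
        rw [← pow_succ']; congr 1; omega
      calc ∑ e ∈ Finset.range E, min (A * 2 ^ (e : ℝ)) (B * 2 ^ (-(e : ℝ) * a))
          ≤ ∑ e ∈ Finset.range E, A * 2 ^ e := by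
            refine Finset.sum_le_sum fun e _ => (min_le_left _ _).trans_eq ?_
            rw [Real.rpow_natCast]
        _ = A * (2 ^ E - 1) := by
            rw [← Finset.mul_sum, geom_sum_eq (by norm_num)]; norm_num
        _ ≤ A * (2 * M) := by
            refine mul_le_mul_of_nonneg_left ?_ hA.le
            linarith
        _ = V * 2 := by rw [hVA]; ring
  have hlarge : ∑' i : ℕ, ENNReal.ofReal (min (A * 2 ^ ((i + E : ℕ) : ℝ))
      (B * 2 ^ (-((i + E : ℕ) : ℝ) * a))) ≤ ENNReal.ofReal (V * (1 - θ)⁻¹) := by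
    calc _ ≤ ∑' i : ℕ, ENNReal.ofReal (V * θ ^ i) := by
          refine ENNReal.tsum_le_tsum fun i => ENNReal.ofReal_le_ofReal ((min_le_right _ _).trans ?_)
          have h2 : (2 : ℝ) ^ (-((i + E : ℕ) : ℝ) * a) = θ ^ i * ((2 : ℝ) ^ E) ^ (-a) := by
            rw [hθ, ← Real.rpow_natCast, ← Real.rpow_natCast, ← Real.rpow_mul (by norm_num),
              ← Real.rpow_mul (by norm_num), ← Real.rpow_add (by norm_num)]
            congr 1; push_cast; ring
          have h3 : ((2 : ℝ) ^ E) ^ (-a) ≤ M ^ (-a) :=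
            Real.rpow_le_rpow_of_nonpos hM0 hEM.le (by linarith)
          rw [h2, hVB]
          calc B * (θ ^ i * ((2 : ℝ) ^ E) ^ (-a)) ≤ B * (θ ^ i * M ^ (-a)) := by gcongr
            _ = _ := by ring
      _ = ENNReal.ofReal (V * (1 - θ)⁻¹) := by
          rw [← ENNReal.ofReal_tsum_of_nonneg (fun i => by positivity)
            ((summable_geometric_of_lt_one hθ0.le hθ1).mul_left V), tsum_mul_left,
            tsum_geometric_of_lt_one hθ0.le hθ1]
  rw [← Summable.sum_add_tsum_nat_add' (k := E) ENNReal.summable]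
  refine (add_le_add hsmall hlarge).trans_eq ?_
  rw [← ENNReal.ofReal_add (by positivity) (by positivity)]
  congr 1; ring

theorem exists_tsum_geometric_tail_le {a : ℝ} (ha : 0 < a) : ∃ C : ℝ, 0 < C ∧ ∀ J : ℕ,
    ∑' e : ℕ, (if J ≤ e then ENNReal.ofReal (2 ^ (-(e : ℝ) * a)) else 0) ≤
      ENNReal.ofReal (C * ((2 : ℝ) ^ J) ^ (-a)) := by
  obtain ⟨θ, hθ⟩ : ∃ θ : ℝ, θ = 2 ^ (-a) := ⟨_, rfl⟩
  have hθ0 : 0 < θ := by rw [hθ]; positivity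
  have hθ1 : θ < 1 := hθ ▸ Real.rpow_lt_one_of_one_lt_of_neg (by norm_num) (by linarith)
  refine ⟨(1 - θ)⁻¹, inv_pos.2 (by linarith), fun J => ?_⟩
  rw [← Summable.sum_add_tsum_nat_add' (k := J) ENNReal.summable, Finset.sum_eq_zero, zero_add]
  · simp only [Nat.le_add_left, if_true]
    have h2 : ∀ i : ℕ, (2 : ℝ) ^ (-((i + J : ℕ) : ℝ) * a) = ((2 : ℝ) ^ J) ^ (-a) * θ ^ i := by
      intro i
      rw [hθ, ← Real.rpow_natCast, ← Real.rpow_natCast, ← Real.rpow_mul (by norm_num),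
        ← Real.rpow_mul (by norm_num), ← Real.rpow_add (by norm_num)]
      congr 1; push_cast; ring
    simp_rw [h2]
    rw [← ENNReal.ofReal_tsum_of_nonneg (fun i => by positivity)
      ((summable_geometric_of_lt_one hθ0.le hθ1).mul_left _), tsum_mul_left,
      tsum_geometric_of_lt_one hθ0.le hθ1, mul_comm]
  · intro e he
    rw [if_neg (by simpa using he)]

/-! ### Inequalities between sequence norms within one level -/

section Level

variable {β : ℤ → ℝ}

theorem tsum_rpow_le_of_eLpNorm_le {p : ℝ≥0∞} (hp1 : 1 ≤ p) (hp : p ≠ ∞) {M : ℝ} (hM : 0 ≤ M)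
    (h : eLpNorm β p Measure.count ≤ ENNReal.ofReal M) :
    ∑' k, ENNReal.ofReal (|β k| ^ p.toReal) ≤ ENNReal.ofReal (M ^ p.toReal) := by
  have hp0 : p ≠ 0 := (zero_lt_one.trans_le hp1).ne'
  have hpr : 0 < p.toReal := ENNReal.toReal_pos hp0 hp
  rw [eLpNorm_eq_lintegral_rpow_enorm_toReal hp0 hp, lintegral_count,
    one_div, ENNReal.rpow_inv_le_iff hpr, ENNReal.ofReal_rpow_of_nonneg hM hpr.le] at h
  refine le_trans (le_of_eq (tsum_congr fun k => ?_)) h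
  rw [Real.enorm_eq_ofReal_abs, ENNReal.ofReal_rpow_of_nonneg (abs_nonneg _) hpr.le]

theorem abs_le_of_eLpNorm_count_le {p : ℝ≥0∞} (hp1 : 1 ≤ p) {M : ℝ} (hM : 0 ≤ M)
    (h : eLpNorm β p Measure.count ≤ ENNReal.ofReal M) (k : ℤ) : |β k| ≤ M := by
  rcases eq_or_ne p ∞ with rfl | hp
  · rw [eLpNorm_exponent_top] at h
    have h1 := ae_le_eLpNormEssSup (f := β) (μ := Measure.count)
    rw [Measure.ae_count_iff] at h1
    have h2 := (h1 k).trans h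
    rw [Real.enorm_eq_ofReal_abs] at h2
    exact (ENNReal.ofReal_le_ofReal_iff hM).1 h2
  · have hpr : 0 < p.toReal := ENNReal.toReal_pos (zero_lt_one.trans_le hp1).ne' hp
    have h1 := (ENNReal.le_tsum k).trans (tsum_rpow_le_of_eLpNorm_le hp1 hp hM h)
    rw [ENNReal.ofReal_le_ofReal_iff (by positivity)] at h1
    exact (Real.rpow_le_rpow_iff (abs_nonneg _) hM hpr).1 h1

theorem min_sq_le_rpow {x t p : ℝ} (hx : 0 ≤ x) (ht : 0 < t) (hp : p ≤ 2) (hp0 : 0 < p) :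
    min (x ^ 2) (t ^ 2) ≤ t ^ (2 - p) * x ^ p := by
  have hsq : ∀ y : ℝ, 0 ≤ y → y ^ 2 = y ^ (2 - p) * y ^ p := fun y hy => by
    rw [← Real.rpow_add_of_nonneg hy (by linarith) hp0.le, sub_add_cancel]
    exact (Real.rpow_natCast y 2).symm
  rcases le_total x t with h | h
  · refine (min_le_left _ _).trans ?_
    rw [hsq x hx]
    exact mul_le_mul_of_nonneg_right (Real.rpow_le_rpow hx h (by linarith)) (by positivity)
  · refine (min_le_right _ _).trans ?_
    rw [hsq t ht.le]
    exact mul_le_mul_of_nonneg_left (Real.rpow_le_rpow ht.le h hp0.le) (by positivity)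

theorem sq_le_linear_add_rpow {x t p : ℝ} (hx : 0 ≤ x) (ht : 0 < t) (hp : 2 ≤ p) :
    x ^ 2 ≤ t * x + t ^ (2 - p) * x ^ p := by
  rcases le_total x t with h | h
  · have : 0 ≤ t ^ (2 - p) * x ^ p := by positivity
    nlinarith
  · have hx0 : 0 < x := ht.trans_le h
    have h1 : x ^ (2 - p) ≤ t ^ (2 - p) := Real.rpow_le_rpow_of_nonpos ht h (by linarith)
    have h2 : x ^ 2 = x ^ (2 - p) * x ^ p := by
      rw [← Real.rpow_add hx0, sub_add_cancel]; exact (Real.rpow_natCast x 2).symm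
    have h3 : x ^ (2 - p) * x ^ p ≤ t ^ (2 - p) * x ^ p :=
      mul_le_mul_of_nonneg_right h1 (by positivity)
    have h4 : 0 ≤ t * x := by positivity
    linarith

theorem tsum_min_sq_le_of_eLpNorm_le {p : ℝ≥0∞} (hp1 : 1 ≤ p) (hp2 : p ≤ 2) {M t : ℝ} (hM : 0 ≤ M)
    (ht : 0 < t) (h : eLpNorm β p Measure.count ≤ ENNReal.ofReal M) :
    ∑' k, ENNReal.ofReal (min (β k ^ 2) (t ^ 2)) ≤
      ENNReal.ofReal (t ^ (2 - p.toReal) * M ^ p.toReal) := by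
  have hp : p ≠ ∞ := ne_top_of_le_ne_top (by simp) hp2
  have hpr : 0 < p.toReal := ENNReal.toReal_pos (zero_lt_one.trans_le hp1).ne' hp
  have hpr2 : p.toReal ≤ 2 := by simpa using ENNReal.toReal_mono (by simp) hp2
  calc _ ≤ ∑' k, ENNReal.ofReal (t ^ (2 - p.toReal)) * ENNReal.ofReal (|β k| ^ p.toReal) := by
        refine ENNReal.tsum_le_tsum fun k => ?_
        rw [← ENNReal.ofReal_mul (by positivity), ← sq_abs (β k)]
        exact ENNReal.ofReal_le_ofReal (min_sq_le_rpow (abs_nonneg _) ht hpr2 hpr)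
    _ ≤ _ := by
        rw [ENNReal.tsum_mul_left, ENNReal.ofReal_mul (by positivity)]
        exact mul_le_mul_right (tsum_rpow_le_of_eLpNorm_le hp1 hp hM h) _

theorem tsum_sq_le_of_eLpNorm_le {p : ℝ≥0∞} (hp1 : 1 ≤ p) (hp2 : p ≤ 2) {M : ℝ} (hM : 0 < M)
    (h : eLpNorm β p Measure.count ≤ ENNReal.ofReal M) :
    ∑' k, ENNReal.ofReal (β k ^ 2) ≤ ENNReal.ofReal (M ^ 2) := by
  have h1 := tsum_min_sq_le_of_eLpNorm_le hp1 hp2 hM.le hM h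
  rw [← Real.rpow_add hM, sub_add_cancel] at h1
  refine le_trans (le_of_eq (tsum_congr fun k => ?_)) (h1.trans_eq (by norm_num))
  have h2 := abs_le_of_eLpNorm_count_le hp1 hM.le h k
  rw [min_eq_left]
  rw [← sq_abs]; exact pow_le_pow_left₀ (abs_nonneg _) h2 2

/-- Entries below `t` are charged to the `ℓ_1` norm and entries above `t` to the `ℓ_p` norm; `t`
stays free, to be balanced at each level. -/
theorem tsum_sq_le_interpolation {p : ℝ≥0∞} (hp2 : 2 < p) (hp : p ≠ ∞) {M S t : ℝ} (hM : 0 ≤ M)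
    (hS : 0 ≤ S) (ht : 0 < t) (h : eLpNorm β p Measure.count ≤ ENNReal.ofReal M)
    (h1 : ∑' k, ENNReal.ofReal |β k| ≤ ENNReal.ofReal S) :
    ∑' k, ENNReal.ofReal (β k ^ 2) ≤
      ENNReal.ofReal (t * S + t ^ (2 - p.toReal) * M ^ p.toReal) := by
  have hp1 : 1 ≤ p := le_trans (by norm_num) hp2.le
  have hpr2 : 2 ≤ p.toReal := by simpa using ENNReal.toReal_mono hp hp2.le
  calc _ ≤ ∑' k, (ENNReal.ofReal t * ENNReal.ofReal |β k|
        + ENNReal.ofReal (t ^ (2 - p.toReal)) * ENNReal.ofReal (|β k| ^ p.toReal)) := by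
        refine ENNReal.tsum_le_tsum fun k => ?_
        rw [← ENNReal.ofReal_mul ht.le, ← ENNReal.ofReal_mul (by positivity),
          ← ENNReal.ofReal_add (by positivity) (by positivity), ← sq_abs (β k)]
        exact ENNReal.ofReal_le_ofReal (sq_le_linear_add_rpow (abs_nonneg _) ht hpr2)
    _ ≤ ENNReal.ofReal t * ENNReal.ofReal S
        + ENNReal.ofReal (t ^ (2 - p.toReal)) * ENNReal.ofReal (M ^ p.toReal) := by
        rw [ENNReal.tsum_add, ENNReal.tsum_mul_left, ENNReal.tsum_mul_left]
        gcongr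
        exact tsum_rpow_le_of_eLpNorm_le hp1 hp hM h
    _ = _ := by
        rw [← ENNReal.ofReal_mul ht.le, ← ENNReal.ofReal_mul (by positivity),
          ← ENNReal.ofReal_add (by positivity) (by positivity)]

theorem tsum_sq_le_sup_mul {M S : ℝ} (hM : 0 ≤ M) (h : ∀ k, |β k| ≤ M)
    (h1 : ∑' k, ENNReal.ofReal |β k| ≤ ENNReal.ofReal S) :
    ∑' k, ENNReal.ofReal (β k ^ 2) ≤ ENNReal.ofReal (M * S) := by
  calc _ ≤ ∑' k, ENNReal.ofReal M * ENNReal.ofReal |β k| := by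
        refine ENNReal.tsum_le_tsum fun k => ?_
        rw [← ENNReal.ofReal_mul hM, ← sq_abs, sq]
        exact ENNReal.ofReal_le_ofReal (mul_le_mul_of_nonneg_right (h k) (abs_nonneg _))
    _ ≤ _ := by
        rw [ENNReal.tsum_mul_left, ENNReal.ofReal_mul hM]
        exact mul_le_mul_right h1 _

end Level

theorem sqrt_two_pow (e : ℕ) : √(2 ^ e : ℝ) = 2 ^ ((e : ℝ) * (1 / 2)) := by
  rw [Real.sqrt_eq_rpow, ← Real.rpow_natCast, ← Real.rpow_mul (by norm_num)]

theorem inv_toReal_le_one {p : ℝ≥0∞} (hp : 1 ≤ p) : (p⁻¹).toReal ≤ 1 := by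
  have := ENNReal.toReal_mono (by simp) (ENNReal.inv_le_inv.2 hp)
  simpa using this

theorem tsum_abs_le_of_mass {β F : ℤ → ℝ} {e : ℕ} {D : ℝ} (hD : 0 ≤ D)
    (hβ : ∀ k, |β k| ≤ D * √(2 ^ e) * F k) (hF : ∑' k, ENNReal.ofReal (F k) ≤ ENNReal.ofReal D) :
    ∑' k, ENNReal.ofReal |β k| ≤ ENNReal.ofReal (D ^ 2 * 2 ^ ((e : ℝ) * (1 / 2))) := by
  calc _ ≤ ∑' k, ENNReal.ofReal (D * √(2 ^ e)) * ENNReal.ofReal (F k) := by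
        refine ENNReal.tsum_le_tsum fun k => ?_
        rw [← ENNReal.ofReal_mul (by positivity)]
        exact ENNReal.ofReal_le_ofReal (hβ k)
    _ ≤ ENNReal.ofReal (D * √(2 ^ e)) * ENNReal.ofReal D := by
        rw [ENNReal.tsum_mul_left]; exact mul_le_mul_right hF _
    _ = _ := by
        rw [← ENNReal.ofReal_mul (by positivity), sqrt_two_pow]; congr 1; ring

/-- In the dense regime `p > 2` the total mass of a density controls the energy of a level. -/
theorem exists_level_energy_bound {α R D : ℝ} {p : ℝ≥0∞} (hR : 0 < R) (hD : 0 < D)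
    (hp : 2 < p) : ∃ K : ℝ, 0 < K ∧ ∀ (e : ℕ) (β F : ℤ → ℝ),
      (∀ k, |β k| ≤ D * √(2 ^ e) * F k) → ∑' k, ENNReal.ofReal (F k) ≤ ENNReal.ofReal D →
      eLpNorm β p Measure.count
        ≤ ENNReal.ofReal (R * 2 ^ (-(e : ℝ) * (α + 1 / 2 - (p⁻¹).toReal))) →
      ∑' k, ENNReal.ofReal (β k ^ 2)
        ≤ ENNReal.ofReal (K * 2 ^ (-(e : ℝ) * (α / (1 - (p⁻¹).toReal)))) := by
  rcases eq_or_ne p ∞ with rfl | hpt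
  · refine ⟨R * D ^ 2, by positivity, fun e β F hβ hF hn => ?_⟩
    have h1 := tsum_sq_le_sup_mul (by positivity)
      (abs_le_of_eLpNorm_count_le le_top (by positivity) hn) (tsum_abs_le_of_mass hD.le hβ hF)
    refine h1.trans_eq ?_
    congr 1
    have h2 : (2 : ℝ) ^ (-(e : ℝ) * (α + 1 / 2 - ((∞ : ℝ≥0∞)⁻¹).toReal)) * 2 ^ ((e : ℝ) * (1 / 2))
        = 2 ^ (-(e : ℝ) * (α / (1 - ((∞ : ℝ≥0∞)⁻¹).toReal))) := by
      rw [← Real.rpow_add (by norm_num)]; congr 1; simp; ring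
    rw [← h2]; ring
  · have hp1 : 1 ≤ p := le_trans (by norm_num) hp.le
    set P := p.toReal with hP
    have hpr2 : 2 < P := by simpa using (ENNReal.toReal_lt_toReal (by simp) hpt).2 hp
    have hπ : (p⁻¹).toReal = P⁻¹ := ENNReal.toReal_inv p
    refine ⟨D ^ 2 + R ^ P, by positivity, fun e β F hβ hF hn => ?_⟩
    rw [hπ] at hn ⊢
    -- The cutoff `t = 2 ^ (-e s')` balances the `ℓ_1` and the `ℓ_p` contributions: both decay like
    -- `2 ^ (-e α / (1 - P⁻¹))`.
    set s' : ℝ := 1 / 2 + α / (1 - P⁻¹) with hs'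
    have hne : 1 - P⁻¹ ≠ 0 := by
      have : P⁻¹ < 1 := inv_lt_one_of_one_lt₀ (by linarith)
      linarith
    have h1 := tsum_sq_le_interpolation hp hpt (t := 2 ^ (-(e : ℝ) * s')) (by positivity)
      (by positivity) (by positivity) hn (tsum_abs_le_of_mass hD.le hβ hF)
    refine h1.trans_eq ?_
    congr 1
    have e1 : (2 : ℝ) ^ (-(e : ℝ) * s') * 2 ^ ((e : ℝ) * (1 / 2))
        = 2 ^ (-(e : ℝ) * (α / (1 - P⁻¹))) := by
      rw [← Real.rpow_add (by norm_num)]; congr 1; rw [hs']; ring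
    have e2 : ((2 : ℝ) ^ (-(e : ℝ) * s')) ^ (2 - P)
        * (R * 2 ^ (-(e : ℝ) * (α + 1 / 2 - P⁻¹))) ^ P
        = R ^ P * 2 ^ (-(e : ℝ) * (α / (1 - P⁻¹))) := by
      rw [Real.mul_rpow hR.le (by positivity), ← Real.rpow_mul (by norm_num),
        ← Real.rpow_mul (by norm_num), mul_left_comm, ← Real.rpow_add (by norm_num)]
      congr 2
      have hP0 : P ≠ 0 := by linarith
      have hP1 : P - 1 ≠ 0 := by linarith
      have h3 : 1 - P⁻¹ = (P - 1) / P := by field_simp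
      rw [hs', h3]
      field_simp
      ring
    rw [e2, add_mul, ← e1]
    ring

/-- The bias and the thresholding error of a sequence in a Besov ball. -/
theorem exists_sequence_bound {α R D c : ℝ} {p : ℝ≥0∞} (hα : 0 < α) (hp : 1 ≤ p) (hR : 0 < R)
    (hD : 1 ≤ D) (hc : 1 ≤ c)
    (hcond : (p⁻¹).toReal - 1 / 2 ≤ α * (1 - 1 / (c * (1 + 2 * α)))) :
    ∃ C : ℝ, 0 < C ∧ ∀ L : ℝ, 0 < L → L ≤ 1 → ∀ J : ℕ, L ^ (-c) ≤ 2 ^ (J + 1) →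
      ∀ β F : ℕ → ℤ → ℝ, (∀ j k, 0 ≤ F j k) → (∀ j k, |β j k| ≤ D * √(2 ^ (j - 1)) * F j k) →
      (∀ j, ∑' k, ENNReal.ofReal (F j k) ≤ ENNReal.ofReal D) → (∀ j k, 2 ^ (j - 1) * F j k ≤ D) →
      (∀ j, eLpNorm (β j) p Measure.count
        ≤ ENNReal.ofReal (R * 2 ^ (-((j - 1 : ℕ) : ℝ) * (α + 1 / 2 - (p⁻¹).toReal)))) →
      ∑' j, ∑' k, (if j < J + 2 then ENNReal.ofReal (min (β j k ^ 2) (2 ^ (j - 1) * F j k * L))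
          else ENNReal.ofReal (β j k ^ 2)) ≤ ENNReal.ofReal (C * L ^ rateExponent α p) := by
  have hD0 : 0 < D := by linarith
  set π := (p⁻¹).toReal with hπ
  -- The noise of a whole level, bounded through the total mass and not through a number of
  -- coefficients, which is infinite.
  have hmass : ∀ {L : ℝ}, 0 < L → ∀ {e : ℕ} {β F : ℤ → ℝ},
      ∑' k, ENNReal.ofReal (F k) ≤ ENNReal.ofReal D →
      ∑' k, ENNReal.ofReal (min (β k ^ 2) (2 ^ e * F k * L)) ≤ ENNReal.ofReal (D * (L * 2 ^ (e : ℝ))) := by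
    intro L hL e β F hF
    calc _ ≤ ∑' k, ENNReal.ofReal (L * 2 ^ e) * ENNReal.ofReal (F k) := by
          refine ENNReal.tsum_le_tsum fun k => ?_
          rw [← ENNReal.ofReal_mul (by positivity)]
          exact ENNReal.ofReal_le_ofReal ((min_le_right _ _).trans_eq (by ring))
      _ ≤ ENNReal.ofReal (L * 2 ^ e) * ENNReal.ofReal D := by
          rw [ENNReal.tsum_mul_left]; exact mul_le_mul_right hF _
      _ = _ := by
          rw [← ENNReal.ofReal_mul (by positivity), Real.rpow_natCast]; congr 1; ring
  rcases le_or_gt p 2 with hp2 | hp2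
  · -- sparse or homogeneous regime
    have hpt : p ≠ ∞ := ne_top_of_le_ne_top (by simp) hp2
    set P := p.toReal with hP
    have hπP : π = P⁻¹ := ENNReal.toReal_inv p
    have hP1 : 1 ≤ P := by simpa using ENNReal.toReal_mono hpt hp
    have hP2 : P ≤ 2 := by simpa using ENNReal.toReal_mono (by simp) hp2
    have hπ2 : 1 / 2 ≤ π := by
      rw [hπP, one_div]; exact inv_anti₀ (by linarith) hP2
    set s := α + 1 / 2 - π with hs
    have h12 : 0 < 1 + 2 * α := by linarith
    -- This is `hcond` rewritten. It makes the bias beyond `2 ^ (J + 1) ≥ L ^ (-c)`, of order at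
    -- most `L ^ (2 c s)`, no larger than the rate.
    have hcs : α / (1 + 2 * α) ≤ c * s := by
      have h1 : α * (1 - 1 / (c * (1 + 2 * α))) = α - α / (1 + 2 * α) / c := by
        field_simp
      have h2 : α / (1 + 2 * α) / c ≤ s := by rw [h1] at hcond; linarith
      rw [div_le_iff₀ (by linarith)] at h2
      linarith
    have hs0 : 0 < s := by
      have : 0 < α / (1 + 2 * α) := by positivity
      by_contra hcon
      nlinarith
    have hrate : rateExponent α p = α / (α + 1 / 2) := by
      rw [rateExponent, ← hπ, max_eq_right (by linarith), add_zero]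
    set a := P * s with ha
    have ha0 : 0 < a := by positivity
    obtain ⟨C₁, hC₁, hmin⟩ := exists_tsum_min_le ha0
    obtain ⟨C₂, hC₂, htail⟩ := exists_tsum_geometric_tail_le (a := 2 * s) (by positivity)
    set K := D + D ^ (1 - P / 2) * R ^ P with hK
    have hK0 : 0 < K := by positivity
    refine ⟨2 * (K * C₁) + 2 * (R ^ 2 * C₂), by positivity, fun L hL hL1 J hJ β F hF0 hβ hF hFD hn => ?_⟩
    have hlev : ∀ j, ∑' k, (if j < J + 2 then
        ENNReal.ofReal (min (β j k ^ 2) (2 ^ (j - 1) * F j k * L)) else ENNReal.ofReal (β j k ^ 2))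
        ≤ ENNReal.ofReal K * ENNReal.ofReal (min (L * 2 ^ ((j - 1 : ℕ) : ℝ))
            (L ^ (1 - P / 2) * 2 ^ (-((j - 1 : ℕ) : ℝ) * a)))
          + ENNReal.ofReal (R ^ 2) *
            (if J + 1 ≤ j - 1 then ENNReal.ofReal (2 ^ (-((j - 1 : ℕ) : ℝ) * (2 * s))) else 0) := by
      intro j
      by_cases hj : j < J + 2
      · simp only [hj, if_true]
        refine le_add_right ?_
        rw [← ENNReal.ofReal_mul hK0.le]
        have b1 := hmass hL (e := j - 1) (β := β j) (hF j)
        -- Boundedness of the density replaces `2 ^ e F L` by the constant level `D L`, to which the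
        -- `ℓ_p` bound with truncation at `√(D L)` applies.
        have b2 : ∑' k, ENNReal.ofReal (min (β j k ^ 2) (2 ^ (j - 1) * F j k * L))
            ≤ ENNReal.ofReal (D ^ (1 - P / 2) * R ^ P *
              (L ^ (1 - P / 2) * 2 ^ (-((j - 1 : ℕ) : ℝ) * a))) := by
          have h1 := tsum_min_sq_le_of_eLpNorm_le hp hp2 (t := √(D * L)) (by positivity)
            (by positivity) (hn j)
          refine le_trans (ENNReal.tsum_le_tsum fun k => ENNReal.ofReal_le_ofReal ?_)
            (h1.trans_eq ?_)
          · refine min_le_min le_rfl ?_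
            rw [Real.sq_sqrt (by positivity)]
            exact mul_le_mul_of_nonneg_right (hFD j k) hL.le
          · congr 1
            rw [Real.sqrt_eq_rpow, ← Real.rpow_mul (by positivity), Real.mul_rpow hR.le (by positivity),
              ← Real.rpow_mul (by norm_num), Real.mul_rpow hD0.le hL.le, ← hP]
            have e1 : 1 / 2 * (2 - P) = 1 - P / 2 := by ring
            have e2 : -((j - 1 : ℕ) : ℝ) * s * P = -((j - 1 : ℕ) : ℝ) * a := by rw [ha]; ring
            rw [e1, e2]; ring
        rcases le_total (L * 2 ^ ((j - 1 : ℕ) : ℝ))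
            (L ^ (1 - P / 2) * 2 ^ (-((j - 1 : ℕ) : ℝ) * a)) with h | h
        · rw [min_eq_left h]
          refine b1.trans (ENNReal.ofReal_le_ofReal (mul_le_mul_of_nonneg_right ?_ (by positivity)))
          have : 0 ≤ D ^ (1 - P / 2) * R ^ P := by positivity
          linarith
        · rw [min_eq_right h]
          refine b2.trans (ENNReal.ofReal_le_ofReal (mul_le_mul_of_nonneg_right ?_ (by positivity)))
          linarith
      · simp only [hj, if_false]
        refine le_add_left ?_
        rw [if_pos (by omega), ← ENNReal.ofReal_mul (by positivity)]
        refine (tsum_sq_le_of_eLpNorm_le hp hp2 (by positivity) (hn j)).trans_eq ?_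
        congr 1
        rw [mul_pow, ← Real.rpow_natCast (2 ^ _) 2, ← Real.rpow_mul (by norm_num)]
        congr 2; push_cast; ring
    have hsum1 : ∑' j : ℕ, ENNReal.ofReal K * ENNReal.ofReal (min (L * 2 ^ ((j - 1 : ℕ) : ℝ))
            (L ^ (1 - P / 2) * 2 ^ (-((j - 1 : ℕ) : ℝ) * a)))
        ≤ ENNReal.ofReal (2 * (K * C₁) * L ^ rateExponent α p) := by
      rw [ENNReal.tsum_mul_left]
      have h1 := (tsum_comp_pred_le fun e : ℕ => ENNReal.ofReal (min (L * 2 ^ (e : ℝ))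
            (L ^ (1 - P / 2) * 2 ^ (-(e : ℝ) * a)))).trans
            (mul_le_mul_right (hmin L (L ^ (1 - P / 2)) hL (by positivity)) 2)
      refine (mul_le_mul_right h1 _).trans_eq ?_
      have h2 : (2 : ℝ≥0∞) = ENNReal.ofReal 2 := by simp
      rw [h2, ← ENNReal.ofReal_mul (by norm_num), ← ENNReal.ofReal_mul hK0.le]
      congr 1
      have h3 : L ^ (a / (1 + a)) * (L ^ (1 - P / 2)) ^ (1 / (1 + a)) = L ^ rateExponent α p := by
        rw [← Real.rpow_mul hL.le, ← Real.rpow_add hL, hrate]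
        congr 1
        have hP0 : P ≠ 0 := by linarith
        have e1 : a = P * α + P / 2 - 1 := by rw [ha, hs, hπP]; field_simp
        have e3 : (1 : ℝ) + a ≠ 0 := by positivity
        have e4 : 1 + a = P * (α + 1 / 2) := by rw [e1]; ring
        rw [mul_one_div, ← add_div, e4, e1]
        have e5 : P * α + P / 2 - 1 + (1 - P / 2) = P * α := by ring
        rw [e5, mul_div_mul_left _ _ hP0]
      rw [h3]; ring
    have hsum2 : ∑' j : ℕ, ENNReal.ofReal (R ^ 2) *
            (if J + 1 ≤ j - 1 then ENNReal.ofReal (2 ^ (-((j - 1 : ℕ) : ℝ) * (2 * s))) else 0)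
        ≤ ENNReal.ofReal (2 * (R ^ 2 * C₂) * L ^ rateExponent α p) := by
      rw [ENNReal.tsum_mul_left]
      have h1 := (tsum_comp_pred_le fun e : ℕ => if J + 1 ≤ e then
        ENNReal.ofReal ((2 : ℝ) ^ (-(e : ℝ) * (2 * s))) else 0).trans
          (mul_le_mul_right (htail (J + 1)) 2)
      refine (mul_le_mul_right h1 _).trans ?_
      have h2 : (2 : ℝ≥0∞) = ENNReal.ofReal 2 := by simp
      rw [h2, ← ENNReal.ofReal_mul (by norm_num), ← ENNReal.ofReal_mul (by positivity)]
      refine ENNReal.ofReal_le_ofReal ?_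
      have h3 : ((2 : ℝ) ^ (J + 1)) ^ (-(2 * s)) ≤ L ^ rateExponent α p := by
        calc ((2 : ℝ) ^ (J + 1)) ^ (-(2 * s)) ≤ (L ^ (-c)) ^ (-(2 * s)) :=
              Real.rpow_le_rpow_of_nonpos (by positivity) hJ (by linarith)
          _ = L ^ (2 * (c * s)) := by rw [← Real.rpow_mul hL.le]; congr 1; ring
          _ ≤ L ^ rateExponent α p := by
              refine Real.rpow_le_rpow_of_exponent_ge hL hL1 ?_
              rw [hrate]
              have : α / (α + 1 / 2) = 2 * (α / (1 + 2 * α)) := by field_simp; ring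
              rw [this]; linarith
      calc R ^ 2 * (2 * (C₂ * ((2 : ℝ) ^ (J + 1)) ^ (-(2 * s))))
          = 2 * (R ^ 2 * C₂) * ((2 : ℝ) ^ (J + 1)) ^ (-(2 * s)) := by ring
        _ ≤ _ := mul_le_mul_of_nonneg_left h3 (by positivity)
    refine (ENNReal.tsum_le_tsum hlev).trans ?_
    rw [ENNReal.tsum_add]
    refine (add_le_add hsum1 hsum2).trans_eq ?_
    rw [← ENNReal.ofReal_add (by positivity) (by positivity)]
    congr 1; ring
  · -- dense regime
    have hπ2 : π < 1 / 2 := by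
      have := (ENNReal.toReal_lt_toReal (by simp [(zero_lt_two.trans hp2).ne']) (by simp)).2
        (ENNReal.inv_lt_inv.2 hp2)
      simpa [hπ] using this
    have hπ0 : 0 ≤ π := ENNReal.toReal_nonneg
    have h1π : 0 < 1 - π := by linarith
    have hrate : rateExponent α p = α / (α + (1 - π)) := by
      rw [rateExponent, ← hπ, max_eq_left (by linarith)]; congr 1; ring
    -- With this decay the crossing value `L ^ (a / (1 + a))` is `L ^ rateExponent α p`.
    set a := α / (1 - π) with ha
    have ha0 : 0 < a := by positivity
    obtain ⟨C₁, hC₁, hmin⟩ := exists_tsum_min_le ha0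
    obtain ⟨K₂, hK₂, hen⟩ := exists_level_energy_bound (α := α) hR hD0 hp2
    set K := D + K₂ with hK
    have hK0 : 0 < K := by positivity
    refine ⟨2 * (K * C₁), by positivity, fun L hL hL1 J hJ β F hF0 hβ hF hFD hn => ?_⟩
    have hlev : ∀ j, ∑' k, (if j < J + 2 then
        ENNReal.ofReal (min (β j k ^ 2) (2 ^ (j - 1) * F j k * L)) else ENNReal.ofReal (β j k ^ 2))
        ≤ ENNReal.ofReal K * ENNReal.ofReal (min (L * 2 ^ ((j - 1 : ℕ) : ℝ))
            (1 * 2 ^ (-((j - 1 : ℕ) : ℝ) * a))) := by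
      intro j
      have b2 : ∑' k, ENNReal.ofReal (β j k ^ 2)
          ≤ ENNReal.ofReal (K * (1 * 2 ^ (-((j - 1 : ℕ) : ℝ) * a))) := by
        refine (hen (j - 1) (β j) (F j) (hβ j) (hF j) (hn j)).trans (ENNReal.ofReal_le_ofReal ?_)
        rw [one_mul]
        exact mul_le_mul_of_nonneg_right (by linarith) (by positivity)
      rw [← ENNReal.ofReal_mul hK0.le]
      by_cases hj : j < J + 2
      · simp only [hj, if_true]
        rcases le_total (L * 2 ^ ((j - 1 : ℕ) : ℝ)) (1 * 2 ^ (-((j - 1 : ℕ) : ℝ) * a)) with h | h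
        · rw [min_eq_left h]
          refine (hmass hL (e := j - 1) (β := β j) (hF j)).trans
            (ENNReal.ofReal_le_ofReal (mul_le_mul_of_nonneg_right (by linarith) (by positivity)))
        · rw [min_eq_right h]
          refine le_trans (ENNReal.tsum_le_tsum fun k => ENNReal.ofReal_le_ofReal (min_le_left _ _)) b2
      · simp only [hj, if_false]
        rw [min_eq_right]
        · exact b2
        -- Beyond `J` the noise bound exceeds `1`, so the energy bound is the minimum and the bias
        -- joins the same sum; only `1 ≤ c` is needed.
        · have h1 : (1 : ℝ) ≤ L * 2 ^ ((j - 1 : ℕ) : ℝ) := by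
            have h2 : L⁻¹ ≤ L ^ (-c) := by
              rw [← Real.rpow_neg_one]
              exact Real.rpow_le_rpow_of_exponent_ge hL hL1 (by linarith)
            have h3 : (2 : ℝ) ^ (J + 1) ≤ 2 ^ ((j - 1 : ℕ) : ℝ) := by
              rw [Real.rpow_natCast]
              exact pow_le_pow_right₀ (by norm_num) (by omega)
            have h4 := mul_le_mul_of_nonneg_left (h2.trans (hJ.trans h3)) hL.le
            rwa [mul_inv_cancel₀ hL.ne'] at h4
          rw [one_mul]
          refine le_trans ?_ h1
          exact Real.rpow_le_one_of_one_le_of_nonpos (by norm_num)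
            (mul_nonpos_of_nonpos_of_nonneg (by simp) ha0.le)
    refine (ENNReal.tsum_le_tsum hlev).trans ?_
    rw [ENNReal.tsum_mul_left]
    have h1 := (tsum_comp_pred_le fun e : ℕ => ENNReal.ofReal (min (L * 2 ^ (e : ℝ))
          (1 * 2 ^ (-(e : ℝ) * a)))).trans (mul_le_mul_right (hmin L 1 hL one_pos) 2)
    refine (mul_le_mul_right h1 _).trans_eq ?_
    have h2 : (2 : ℝ≥0∞) = ENNReal.ofReal 2 := by simp
    rw [h2, ← ENNReal.ofReal_mul (by norm_num), ← ENNReal.ofReal_mul hK0.le, Real.one_rpow, mul_one]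
    congr 1
    have h3 : a / (1 + a) = rateExponent α p := by
      rw [hrate, ha]; field_simp; ring
    rw [h3]; ring

namespace BiorthogonalWaveletBasis

variable {r : ℝ} (W : BiorthogonalWaveletBasis r)

/-! ### The estimator as a finite expansion -/

theorem measurable_threshCoeff (γ : ℝ) (n : ℕ) (i : ℕ × ℤ) :
    Measurable fun X : Fin n → ℝ => W.threshCoeff γ X i :=
  measurable_thresholdedMean (W.measurable_dec i) γ (W.supNorm i)

theorem isEstimator_estimator (γ c c' : ℝ) (n : ℕ) : IsEstimator n (W.estimator γ c c' n) := by
  obtain ⟨A, B, -, -, -, -, -, hre⟩ := W.exists_bounds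
  unfold IsEstimator Function.uncurry estimator
  refine Finset.measurable_fun_sum _ fun j _ => ?_
  have hterm : ∀ k : ℤ, Measurable fun z : (Fin n → ℝ) × ℝ =>
      W.threshCoeff γ z.1 (j, k) * W.recon (j, k) z.2 := fun k =>
    ((W.measurable_threshCoeff γ n (j, k)).comp measurable_fst).mul
      ((W.measurable_recon (j, k)).comp measurable_snd)
  refine measurable_of_tendsto_metrizable
    (f := fun (N : ℕ) (z : (Fin n → ℝ) × ℝ) => ∑ k ∈ Finset.Icc (-N : ℤ) N,
      W.threshCoeff γ z.1 (j, k) * W.recon (j, k) z.2)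
    (fun N => Finset.measurable_fun_sum _ fun k _ => hterm k) ?_
  rw [tendsto_pi_nhds]
  intro z
  have hfin := finite_windows A j z.2
  obtain ⟨N₀, hN₀⟩ : ∃ N₀ : ℕ, ∀ k ∈ {k : ℤ | z.2 ∈ dyadicWindow A (j, k)}, k.natAbs ≤ N₀ := by
    obtain ⟨N₀, hN₀⟩ := (hfin.image Int.natAbs).bddAbove
    exact ⟨N₀, fun k hk => hN₀ ⟨k, hk, rfl⟩⟩
  refine tendsto_const_nhds.congr' ?_
  filter_upwards [eventually_ge_atTop N₀] with N hN
  refine tsum_eq_sum fun k hk => ?_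
  by_contra hne
  have h1 := hN₀ k (hre (j, k) z.2 (right_ne_zero_of_mul hne))
  rw [Finset.mem_Icc] at hk
  omega

theorem finite_threshCoeff_ne_zero (γ : ℝ) {n : ℕ} (X : Fin n → ℝ) (j : ℕ) :
    {k : ℤ | W.threshCoeff γ X (j, k) ≠ 0}.Finite := by
  obtain ⟨A, B, -, -, -, hd, -, -⟩ := W.exists_bounds
  refine (Set.finite_iUnion fun m : Fin n => finite_windows A j (X m)).subset fun k hk => ?_
  rw [Set.mem_iUnion]
  by_contra hcon
  push Not at hcon
  have h0 : ∀ m, W.dec (j, k) (X m) = 0 := fun m => by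
    by_contra hne
    exact hcon m (hd (j, k) (X m) hne)
  apply hk
  unfold threshCoeff empCoeff
  simp [h0]

/-- For a given sample only finitely many empirical coefficients of a level are nonzero, and a zero
one stays zero whatever the threshold. The estimator is thus a finite expansion, to which the frame
bound applies. -/
theorem exists_riesz_estimator_bound : ∃ c₂ : ℝ, 0 < c₂ ∧ ∀ (γ c c' : ℝ) (n : ℕ) (X : Fin n → ℝ)
    (f : ℝ → ℝ), MemLp f 2 volume →
    eLpNorm (fun x => W.estimator γ c c' n X x - f x) 2 volume ^ 2 ≤
      ENNReal.ofReal c₂ * ∑' j, ∑' k, ENNReal.ofReal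
        (((if j < topLevel c c' n + 2 then W.threshCoeff γ X (j, k) else 0) - W.coeff f (j, k)) ^ 2) := by
  obtain ⟨c₁, c₂, -, hc₂, -, hup⟩ := W.exists_riesz_bounds
  refine ⟨c₂, hc₂, fun γ c c' n X f hf => ?_⟩
  set J := topLevel c c' n
  have hfin : (⋃ j ∈ Finset.range (J + 2), {k : ℤ | W.threshCoeff γ X (j, k) ≠ 0}).Finite :=
    Set.Finite.biUnion (Finset.finite_toSet _) fun j _ => W.finite_threshCoeff_ne_zero γ X j
  set K := hfin.toFinset with hK
  have hout : ∀ j < J + 2, ∀ k, k ∉ K → W.threshCoeff γ X (j, k) = 0 := by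
    intro j hj k hk
    by_contra hne
    apply hk
    rw [hK, Set.Finite.mem_toFinset, Set.mem_iUnion₂]
    exact ⟨j, Finset.mem_range.2 hj, hne⟩
  have hest : ∀ x, W.estimator γ c c' n X x
      = ∑ i ∈ Finset.range (J + 2) ×ˢ K, W.threshCoeff γ X i * W.recon i x := by
    intro x
    rw [Finset.sum_product, estimator]
    refine Finset.sum_congr rfl fun j hj => tsum_eq_sum fun k hk => ?_
    rw [hout j (Finset.mem_range.1 hj) k hk, zero_mul]
  have h := hup f hf (Finset.range (J + 2) ×ˢ K) (W.threshCoeff γ X)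
  simp_rw [hest]
  refine h.trans_eq ?_
  rw [ENNReal.tsum_prod']
  congr 1
  refine tsum_congr fun j => tsum_congr fun k => ?_
  rw [Real.enorm_eq_ofReal_abs, ← ENNReal.ofReal_pow (abs_nonneg _), sq_abs]
  congr 3
  simp only [Finset.mem_product, Finset.mem_range]
  by_cases hj : j < J + 2
  · by_cases hk : k ∈ K
    · simp [hj, hk]
    · simp [hj, hk, hout j hj k hk]
  · simp [hj]

theorem supNorm_le {B : ℝ} (i : ℕ × ℤ) (hB : ∀ x, |W.dec i x| ≤ B) : W.supNorm i ≤ B := by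
  have hB0 : 0 ≤ B := (abs_nonneg _).trans (hB 0)
  unfold supNorm
  refine ENNReal.toReal_le_of_le_ofReal hB0 ?_
  rw [eLpNorm_exponent_top]
  refine eLpNormEssSup_le_of_ae_enorm_bound (ae_of_all _ fun x => ?_)
  rw [Real.enorm_eq_ofReal_abs]
  exact ENNReal.ofReal_le_ofReal (hB x)

theorem abs_dec_le_supNorm_ae (i : ℕ × ℤ) : ∀ᵐ x, |W.dec i x| ≤ W.supNorm i := by
  have hfin : eLpNorm (W.dec i) ∞ volume ≠ ∞ := (W.memLp_dec i ∞).2.ne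
  have h := ae_le_eLpNormEssSup (f := W.dec i) (μ := (volume : Measure ℝ))
  filter_upwards [h] with x hx
  rw [← eLpNorm_exponent_top, Real.enorm_eq_ofReal_abs] at hx
  exact (ENNReal.ofReal_le_iff_le_toReal hfin).1 hx

theorem supNorm_pos (i : ℕ × ℤ) : 0 < W.supNorm i := by
  refine lt_of_le_of_ne ENNReal.toReal_nonneg fun h => ?_
  have h1 := W.integral_dec_mul_recon i i
  rw [integral_eq_zero_of_ae] at h1
  · simp at h1
  · filter_upwards [W.abs_dec_le_supNorm_ae i] with x hx
    rw [← h] at hx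
    simp [abs_nonpos_iff.1 hx]

end BiorthogonalWaveletBasis

/-! ### Bounded densities -/

/-- The law with density `f`. -/
noncomputable abbrev densityLaw (f : ℝ → ℝ) : Measure ℝ :=
  volume.withDensity fun x => ENNReal.ofReal (f x)

theorem IsDensity.isProbabilityMeasure {f : ℝ → ℝ} (hf : IsDensity f) :
    IsProbabilityMeasure (densityLaw f) := by
  constructor
  rw [withDensity_apply _ MeasurableSet.univ, Measure.restrict_univ]
  exact hf.2.2

theorem IsDensity.integral_densityLaw {f : ℝ → ℝ} (hf : IsDensity f) (g : ℝ → ℝ) :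
    ∫ x, g x ∂(densityLaw f) = ∫ x, f x * g x := by
  rw [integral_withDensity_eq_integral_toReal_smul hf.1.ennreal_ofReal (by simp)]
  refine integral_congr_ae (ae_of_all _ fun x => ?_)
  simp [ENNReal.toReal_ofReal (hf.2.1 x)]

theorem IsDensity.memLp {f : ℝ → ℝ} (hf : IsDensity f) {R : ℝ}
    (h : eLpNorm f 2 volume ≤ ENNReal.ofReal R) : MemLp f 2 volume :=
  ⟨hf.1.aestronglyMeasurable, h.trans_lt ENNReal.ofReal_lt_top⟩

theorem densityLaw_le {f : ℝ → ℝ} (hf : IsDensity f) {R : ℝ}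
    (h : eLpNorm f ∞ volume ≤ ENNReal.ofReal R) (s : Set ℝ) (hs : MeasurableSet s) :
    densityLaw f s ≤ ENNReal.ofReal R * volume s := by
  rw [withDensity_apply _ hs]
  calc _ ≤ ∫⁻ _ in s, ENNReal.ofReal R := by
        refine setLIntegral_mono_ae measurable_const.aemeasurable ?_
        filter_upwards [ae_le_eLpNormEssSup (f := f) (μ := (volume : Measure ℝ))] with x hx _
        rw [eLpNorm_exponent_top] at h
        have := hx.trans h
        rwa [Real.enorm_eq_ofReal_abs, abs_of_nonneg (hf.2.1 x)] at this
    _ = _ := by rw [setLIntegral_const]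

theorem tsum_measure_dyadicWindow_le (μ : Measure ℝ) [IsProbabilityMeasure μ] (A j : ℕ) :
    ∑' k : ℤ, μ (dyadicWindow A (j, k)) ≤ 2 * A + 1 := by
  have h : ∀ k : ℤ, μ (dyadicWindow A (j, k))
      = ∫⁻ x, (dyadicWindow A (j, k)).indicator (1 : ℝ → ℝ≥0∞) x ∂μ := fun k =>
    (lintegral_indicator_one (measurableSet_dyadicWindow A (j, k))).symm
  simp_rw [h]
  rw [← lintegral_tsum fun k =>
    (measurable_one.indicator (measurableSet_dyadicWindow A (j, k))).aemeasurable]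
  calc _ ≤ ∫⁻ _, (2 * A + 1 : ℝ≥0∞) ∂μ :=
        lintegral_mono fun x => tsum_indicator_dyadicWindow_le A j x
    _ = _ := by simp

theorem inv_toReal_antitone {p p' : ℝ≥0∞} (hp : 1 ≤ p) (h : p ≤ p') :
    (p'⁻¹).toReal ≤ (p⁻¹).toReal :=
  ENNReal.toReal_mono (by simp; rintro rfl; simp at hp) (ENNReal.inv_le_inv.2 h)

/-- The condition relating `c` and `αstar` passes to every larger smoothness, which makes one choice
of `c` serve the whole scale. -/
theorem mul_one_sub_inv_mono {c α₀ α : ℝ} (hc : 1 ≤ c) (h0 : 0 < α₀) (h : α₀ ≤ α) :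
    α₀ * (1 - 1 / (c * (1 + 2 * α₀))) ≤ α * (1 - 1 / (c * (1 + 2 * α))) := by
  have hc0 : 0 < c := by linarith
  have hα : 0 < α := by linarith
  have key : α * (1 - 1 / (c * (1 + 2 * α))) - α₀ * (1 - 1 / (c * (1 + 2 * α₀)))
      = (α - α₀) * (1 - 1 / (c * (1 + 2 * α) * (1 + 2 * α₀))) := by
    field_simp
    ring
  have h1 : 1 / (c * (1 + 2 * α) * (1 + 2 * α₀)) ≤ 1 := by
    rw [div_le_one (by positivity)]
    nlinarith [mul_pos hα h0, mul_nonneg (sub_nonneg.2 hc) hα.le, mul_pos hc0 hα,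
      mul_pos (mul_pos hc0 hα) h0, mul_pos hc0 h0]
  have := mul_nonneg (sub_nonneg.2 h) (sub_nonneg.2 h1)
  linarith

theorem rateExponent_pos {α : ℝ} (hα : 0 < α) (p : ℝ≥0∞) : 0 < rateExponent α p := by
  unfold rateExponent
  have := le_max_right (1 / 2 - (p⁻¹).toReal) 0
  positivity

theorem rateExponent_le_one {α : ℝ} (hα : 0 < α) (p : ℝ≥0∞) : rateExponent α p ≤ 1 := by
  unfold rateExponent
  have := le_max_right (1 / 2 - (p⁻¹).toReal) 0
  rw [div_le_one (by positivity)]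
  linarith

/-- Finitely many finite values are absorbed by enlarging the constant. -/
theorem exists_const_of_eventually_le {a : ℕ → ℝ≥0∞} {u : ℕ → ℝ} (hu : ∀ n, 2 ≤ n → 0 < u n)
    (ha : ∀ n, 2 ≤ n → a n ≠ ∞)
    (h : ∃ C : ℝ, 0 < C ∧ ∃ n₀ : ℕ, ∀ n, n₀ ≤ n → 2 ≤ n → a n ≤ ENNReal.ofReal (C * u n)) :
    ∃ C : ℝ, 0 < C ∧ ∀ n, 2 ≤ n → a n ≤ ENNReal.ofReal (C * u n) := by
  obtain ⟨C, hC, n₀, h⟩ := h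
  have hnn : ∀ n ∈ (Finset.range n₀).filter (2 ≤ ·), 0 ≤ (a n).toReal / u n := fun n hn =>
    div_nonneg ENNReal.toReal_nonneg (hu n (Finset.mem_filter.1 hn).2).le
  have hS := Finset.sum_nonneg hnn
  refine ⟨C + ∑ n ∈ (Finset.range n₀).filter (2 ≤ ·), (a n).toReal / u n, by positivity,
    fun n hn => ?_⟩
  rcases le_or_gt n₀ n with hle | hlt
  · refine (h n hle hn).trans (ENNReal.ofReal_le_ofReal ?_)
    have := hu n hn
    gcongr
    linarith
  · rw [← ENNReal.ofReal_toReal (ha n hn)]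
    refine ENNReal.ofReal_le_ofReal ?_
    rw [← div_le_iff₀ (hu n hn)]
    have := Finset.single_le_sum hnn (Finset.mem_filter.2 ⟨Finset.mem_range.2 hlt, hn⟩)
    linarith

theorem two_pow_topLevel_le {c c' : ℝ} {n : ℕ} (h : 1 ≤ (n : ℝ) ^ c * Real.log n ^ c') :
    (2 : ℝ) ^ BiorthogonalWaveletBasis.topLevel c c' n ≤ (n : ℝ) ^ c * Real.log n ^ c' := by
  have h1 : 1 ≤ ⌊(n : ℝ) ^ c * Real.log n ^ c'⌋₊ := Nat.le_floor (by simpa using h)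
  have h2 := Nat.pow_log_le_self 2 (x := ⌊(n : ℝ) ^ c * Real.log n ^ c'⌋₊) (by omega)
  have h3 : ((2 ^ Nat.log 2 ⌊(n : ℝ) ^ c * Real.log n ^ c'⌋₊ : ℕ) : ℝ)
      ≤ (⌊(n : ℝ) ^ c * Real.log n ^ c'⌋₊ : ℝ) := by exact_mod_cast h2
  rw [BiorthogonalWaveletBasis.topLevel]
  push_cast at h3
  exact h3.trans (Nat.floor_le (by linarith))

theorem le_two_pow_topLevel (c c' : ℝ) (n : ℕ) :
    (n : ℝ) ^ c * Real.log n ^ c' ≤ 2 ^ (BiorthogonalWaveletBasis.topLevel c c' n + 1) := by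
  have h2 := Nat.lt_pow_succ_log_self (b := 2) (by norm_num) ⌊(n : ℝ) ^ c * Real.log n ^ c'⌋₊
  have h3 : ((⌊(n : ℝ) ^ c * Real.log n ^ c'⌋₊ + 1 : ℕ) : ℝ)
      ≤ ((2 ^ (Nat.log 2 ⌊(n : ℝ) ^ c * Real.log n ^ c'⌋₊ + 1) : ℕ) : ℝ) := by exact_mod_cast h2
  rw [BiorthogonalWaveletBasis.topLevel]
  push_cast at h3
  exact (Nat.lt_floor_add_one _).le.trans h3

theorem rpow_mul_log_rpow_neg {n : ℕ} (hn : 2 ≤ n) (c : ℝ) :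
    (n : ℝ) ^ c * Real.log n ^ (-c) = (Real.log n / n) ^ (-c) := by
  have := half_le_log_nat hn
  rw [Real.div_rpow (by linarith) (by positivity), Real.rpow_neg (Nat.cast_nonneg n), div_inv_eq_mul,
    mul_comm]

theorem sum_two_pow_pred (J : ℕ) : ∑ j ∈ Finset.range (J + 2), (2 : ℝ) ^ (j - 1) = 2 ^ (J + 1) := by
  induction J with
  | zero => norm_num [Finset.sum_range_succ]
  | succ J ih => rw [Finset.sum_range_succ, ih]; simp; ring

/-- The residual term of the thresholding risk is negligible when `c < γ'`. -/
theorem one_add_log_mul_exp_mul_le {c γ' : ℝ} (hc : 0 ≤ c) (hγ : c < γ') {n : ℕ} (hn : 2 ≤ n) :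
    (1 + Real.log n) * Real.exp (-(γ' * Real.log n)) * (Real.log n / n) ^ (-c)
      ≤ 2 ^ c * (1 + 1 / (γ' - c)) := by
  have hl := half_le_log_nat hn
  have hn0 : (0 : ℝ) < n := by positivity
  have hn1 : (1 : ℝ) ≤ n := by exact_mod_cast (by omega : 1 ≤ n)
  have hδ : 0 < γ' - c := by linarith
  have h1 : Real.exp (-(γ' * Real.log n)) = (n : ℝ) ^ (-γ') := by
    rw [Real.rpow_def_of_pos hn0]; ring_nf
  have h2 : Real.log n ^ (-c) ≤ 2 ^ c := by
    calc Real.log n ^ (-c) ≤ (1 / 2 : ℝ) ^ (-c) :=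
          Real.rpow_le_rpow_of_nonpos (by norm_num) hl (by linarith)
      _ = 2 ^ c := by rw [one_div, Real.inv_rpow (by norm_num), Real.rpow_neg (by norm_num), inv_inv]
  have h3 : Real.log n ≤ (n : ℝ) ^ (γ' - c) / (γ' - c) := Real.log_le_rpow_div hn0.le hδ
  have h4 : (1 : ℝ) ≤ (n : ℝ) ^ (γ' - c) := Real.one_le_rpow hn1 hδ.le
  have h5 : (n : ℝ) ^ (-γ') * (n : ℝ) ^ c * (n : ℝ) ^ (γ' - c) = 1 := by
    rw [← Real.rpow_add hn0, ← Real.rpow_add hn0]; ring_nf; simp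
  rw [← rpow_mul_log_rpow_neg hn, h1]
  have hP : 0 < (n : ℝ) ^ (-γ') := by positivity
  have hQ : 0 < (n : ℝ) ^ c := by positivity
  have hl2 : 0 ≤ Real.log n ^ (-c) := Real.rpow_nonneg (by linarith) _
  calc _ = (1 + Real.log n) * ((n : ℝ) ^ (-γ') * (n : ℝ) ^ c) * Real.log n ^ (-c) := by ring
    _ ≤ ((n : ℝ) ^ (γ' - c) + (n : ℝ) ^ (γ' - c) / (γ' - c)) * ((n : ℝ) ^ (-γ') * (n : ℝ) ^ c) * 2 ^ c := by
        gcongr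
    _ = ((n : ℝ) ^ (-γ') * (n : ℝ) ^ c * (n : ℝ) ^ (γ' - c)) * (1 + 1 / (γ' - c)) * 2 ^ c := by ring
    _ = _ := by rw [h5]; ring

theorem log_div_nat_mem {n : ℕ} (hn : 2 ≤ n) : 0 < Real.log n / n ∧ Real.log n / n ≤ 1 := by
  have hl := half_le_log_nat hn
  have hn0 : (0 : ℝ) < n := by positivity
  refine ⟨by positivity, ?_⟩
  rw [div_le_one hn0]
  exact (Real.log_le_sub_one_of_pos hn0).trans (by linarith)

theorem exp_neg_mul_log_le {γ' : ℝ} (hγ : 1 ≤ γ') {n : ℕ} (hn : 2 ≤ n) :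
    Real.exp (-(γ' * Real.log n)) ≤ 2 * (Real.log n / n) := by
  have hl := half_le_log_nat hn
  have hn0 : (0 : ℝ) < n := by positivity
  calc _ ≤ Real.exp (-Real.log n) := by
        apply Real.exp_le_exp.2
        nlinarith
    _ = 1 / n := by rw [Real.exp_neg, Real.exp_log hn0, one_div]
    _ ≤ _ := by
        rw [mul_div_assoc', div_le_div_iff_of_pos_right hn0]
        linarith

/-! ### Maximal risk of the thresholding estimator -/

namespace BiorthogonalWaveletBasis

variable {r : ℝ} (W : BiorthogonalWaveletBasis r)

/-- The probability that `ψ_{jk}(X) ≠ 0` plays the role of a local mass. Bounded overlap of the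
supports bounds its sum over `k`; the sup bound of the density, on a window of length `2 * A / 2 ^
(j - 1)`, bounds each single one. -/
theorem exists_coeff_bounds (R' : ℝ) : ∃ D : ℝ, 1 ≤ D ∧ ∀ f ∈ boundedDensities R', ∀ j : ℕ,
    (∀ k, W.supNorm (j, k) ^ 2 ≤ D ^ 2 * 2 ^ (j - 1)) ∧
    (∀ k, |W.coeff f (j, k)| ≤ D * √(2 ^ (j - 1)) * (densityLaw f).real {x | W.dec (j, k) x ≠ 0}) ∧
    ∑' k, ENNReal.ofReal ((densityLaw f).real {x | W.dec (j, k) x ≠ 0}) ≤ ENNReal.ofReal D ∧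
    ∀ k, 2 ^ (j - 1) * (densityLaw f).real {x | W.dec (j, k) x ≠ 0} ≤ D := by
  obtain ⟨A, B, -, hB, hdec, hsupp, -, -⟩ := W.exists_bounds
  refine ⟨max B (max (2 * A + 1) (2 * A * R')), hB.trans (le_max_left _ _), ?_⟩
  set D := max B (max (2 * A + 1 : ℝ) (2 * A * R'))
  have hBD : B ≤ D := le_max_left _ _
  intro f hf j
  have := hf.1.isProbabilityMeasure
  have hF : ∀ k, (densityLaw f).real {x | W.dec (j, k) x ≠ 0}
      ≤ (densityLaw f).real (dyadicWindow A (j, k)) := fun k =>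
    measureReal_mono (fun x hx => hsupp (j, k) x hx)
  refine ⟨fun k => ?_, fun k => ?_, ?_, fun k => ?_⟩
  · have h1 := W.supNorm_le (j, k) (hdec (j, k))
    calc _ ≤ (D * √(2 ^ (j - 1))) ^ 2 :=
          pow_le_pow_left₀ (W.supNorm_pos _).le (h1.trans (by gcongr)) 2
      _ = _ := by rw [mul_pow, Real.sq_sqrt (by positivity)]
  · rw [coeff, ← hf.1.integral_densityLaw]
    refine (abs_integral_le_mul_real (W.measurable_dec (j, k)) (ae_of_all _ (hdec (j, k)))).trans ?_
    gcongr
  · calc _ ≤ ∑' k, densityLaw f (dyadicWindow A (j, k)) := by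
          refine ENNReal.tsum_le_tsum fun k => ?_
          rw [← ofReal_measureReal]
          exact ENNReal.ofReal_le_ofReal (hF k)
      _ ≤ 2 * A + 1 := tsum_measure_dyadicWindow_le _ A j
      _ = ENNReal.ofReal (2 * A + 1) := by
          rw [ENNReal.ofReal_add (by positivity) (by norm_num), ENNReal.ofReal_mul (by norm_num)]
          simp
      _ ≤ _ := ENNReal.ofReal_le_ofReal ((le_max_left _ _).trans (le_max_right _ _))
  · refine le_trans ?_ ((le_max_right _ _).trans (le_max_right B _))
    -- A negative radius would force `f = 0` almost everywhere, which is no density.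
    have h0 : (0 : ℝ) ≤ R' := by
      by_contra hneg
      have := hf.2.1
      rw [ENNReal.ofReal_of_nonpos (by linarith), nonpos_iff_eq_zero,
        eLpNorm_eq_zero_iff hf.1.1.aestronglyMeasurable (by norm_num)] at this
      have h1 := hf.1.2.2
      rw [lintegral_congr_ae (g := 0)] at h1
      · simp at h1
      · filter_upwards [this] with x hx
        simp [hx]
    have h1 := densityLaw_le hf.1 hf.2.2 _ (measurableSet_dyadicWindow A (j, k))
    rw [volume_dyadicWindow, ← ENNReal.ofReal_mul h0] at h1
    have h2 := ENNReal.toReal_le_of_le_ofReal (by positivity) h1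
    have h3 := (hF k).trans h2
    calc _ ≤ (2 : ℝ) ^ (j - 1) * (R' * (2 * A / 2 ^ (j - 1))) := by gcongr
      _ = _ := by field_simp

theorem eLpNorm_coeff_le {α R : ℝ} {p q : ℝ≥0∞} (hq : 1 ≤ q)
    {f : ℝ → ℝ} (hf : f ∈ W.besovBall α p q R) (j : ℕ) :
    eLpNorm (fun k => W.coeff f (j, k)) p Measure.count ≤
      ENNReal.ofReal (R * 2 ^ (-((j - 1 : ℕ) : ℝ) * (α + 1 / 2 - (p⁻¹).toReal))) := by
  have hb := hf.2
  unfold besovNorm at hb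
  rcases j with - | j
  · simpa using le_self_add.trans hb
  · have h1 := le_add_self.trans hb
    set G : ℕ → ℝ≥0∞ := fun j => (2 : ℝ≥0∞) ^ ((j : ℝ) * (α + 1 / 2 - (p⁻¹).toReal)) *
      eLpNorm (fun k : ℤ => W.coeff f (j + 1, k)) p Measure.count with hG
    have h2 : G j ≤ eLpNorm G q Measure.count := by
      have h0 : (q ≠ 0) := by positivity
      calc G j = eLpNorm (({j} : Set ℕ).indicator G) q Measure.count := by
            rw [show ({j} : Set ℕ).indicator G = ({j} : Set ℕ).indicator (fun _ => G j) by
              ext i; by_cases h : i = j <;> simp [h], eLpNorm_indicator_const' (by simp) (by simp) h0]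
            simp
        _ ≤ _ := eLpNorm_indicator_le G
    have h3 := h2.trans h1
    rw [hG] at h3
    simp only at h3
    have h4 : (2 : ℝ≥0∞) ^ ((j : ℝ) * (α + 1 / 2 - (p⁻¹).toReal))
        = ENNReal.ofReal (2 ^ ((j : ℝ) * (α + 1 / 2 - (p⁻¹).toReal))) := by
      rw [← ENNReal.ofReal_rpow_of_pos (by norm_num)]; simp
    rw [h4, mul_comm, ← ENNReal.le_div_iff_mul_le (Or.inl (by simp; positivity)) (Or.inl (by simp)),
      ← ENNReal.ofReal_div_of_pos (by positivity)] at h3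
    refine h3.trans_eq ?_
    simp only [Nat.add_sub_cancel]
    rw [neg_mul, Real.rpow_neg (by norm_num), div_eq_mul_inv]

theorem exists_risk_le_tsum : ∃ c₂ : ℝ, 0 < c₂ ∧ ∀ (γ c c' : ℝ) (n : ℕ) (f : ℝ → ℝ),
    IsDensity f → MemLp f 2 volume →
    risk n (W.estimator γ c c' n) f ≤ ENNReal.ofReal c₂ * ∑' j, ∑' k,
      if j < topLevel c c' n + 2 then
        ∫⁻ X, ENNReal.ofReal ((W.threshCoeff γ X (j, k) - W.coeff f (j, k)) ^ 2) ∂(sampleLaw n f)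
      else ENNReal.ofReal (W.coeff f (j, k) ^ 2) := by
  obtain ⟨c₂, hc₂, h⟩ := W.exists_riesz_estimator_bound
  refine ⟨c₂, hc₂, fun γ c c' n f hf hf2 => ?_⟩
  have := hf.isProbabilityMeasure
  have hprob : IsProbabilityMeasure (sampleLaw n f) := by unfold sampleLaw; infer_instance
  set J := topLevel c c' n
  have hm : ∀ j k, Measurable fun X : Fin n → ℝ => ENNReal.ofReal
      (((if j < J + 2 then W.threshCoeff γ X (j, k) else 0) - W.coeff f (j, k)) ^ 2) := by
    intro j k
    have := W.measurable_threshCoeff γ n (j, k)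
    split_ifs
    · fun_prop
    · fun_prop
  calc risk n (W.estimator γ c c' n) f
      ≤ ∫⁻ X, ENNReal.ofReal c₂ * ∑' j, ∑' k, ENNReal.ofReal
        (((if j < J + 2 then W.threshCoeff γ X (j, k) else 0) - W.coeff f (j, k)) ^ 2)
          ∂(sampleLaw n f) := lintegral_mono fun X => h γ c c' n X f hf2
    _ = _ := by
      rw [lintegral_const_mul' _ _ ENNReal.ofReal_ne_top,
        lintegral_tsum fun j => (Measurable.tsum fun k => hm j k).aemeasurable]
      congr 1
      refine tsum_congr fun j => ?_
      rw [lintegral_tsum fun k => (hm j k).aemeasurable]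
      refine tsum_congr fun k => ?_
      split_ifs with hj
      · rfl
      · simp

theorem exists_tsum_coeff_sq_le (R' : ℝ) : ∃ S : ℝ, 0 < S ∧ ∀ f ∈ boundedDensities R',
    ∑' j, ∑' k, ENNReal.ofReal (W.coeff f (j, k) ^ 2) ≤ ENNReal.ofReal S := by
  obtain ⟨c₁, c₂, hc₁, -, h, -⟩ := W.exists_riesz_bounds
  refine ⟨(R' ^ 2 + 1) / c₁, by positivity, fun f hf => ?_⟩
  have h1 := h f (hf.1.memLp hf.2.1)
  rw [ENNReal.tsum_prod', mul_comm, ← ENNReal.le_div_iff_mul_le (Or.inl (by simpa using hc₁))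
    (Or.inl (by simp))] at h1
  calc _ = ∑' j, ∑' k, ‖W.coeff f (j, k)‖ₑ ^ 2 := by
        refine tsum_congr fun j => tsum_congr fun k => ?_
        rw [Real.enorm_eq_ofReal_abs, ← ENNReal.ofReal_pow (abs_nonneg _), sq_abs]
    _ ≤ _ := h1
    _ ≤ ENNReal.ofReal (|R'| ^ 2) / ENNReal.ofReal c₁ := by
        gcongr
        rw [ENNReal.ofReal_pow (abs_nonneg _)]
        exact pow_le_pow_left' (hf.2.1.trans (ENNReal.ofReal_le_ofReal (le_abs_self _))) 2
    _ = ENNReal.ofReal (|R'| ^ 2 / c₁) := (ENNReal.ofReal_div_of_pos hc₁).symm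
    _ ≤ _ := by
        refine ENNReal.ofReal_le_ofReal ?_
        rw [sq_abs]
        gcongr
        linarith

theorem tsum_mass_le {D : ℝ} (hD : 0 ≤ D) {F : ℕ → ℤ → ℝ}
    (hF : ∀ j, ∑' k, ENNReal.ofReal (F j k) ≤ ENNReal.ofReal D) (J : ℕ) :
    ∑' j, ∑' k, (if j < J + 2 then ENNReal.ofReal (2 ^ (j - 1) * F j k) else 0)
      ≤ ENNReal.ofReal (D * 2 ^ (J + 1)) := by
  rw [tsum_eq_sum (s := Finset.range (J + 2)) fun j hj => by
    simp [show ¬ j < J + 2 from fun h => hj (Finset.mem_range.2 h)]]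
  calc _ ≤ ∑ j ∈ Finset.range (J + 2), ENNReal.ofReal (2 ^ (j - 1) * D) := by
        refine Finset.sum_le_sum fun j hj => ?_
        simp only [Finset.mem_range.1 hj, if_true]
        simp_rw [fun k => ENNReal.ofReal_mul (p := (2 : ℝ) ^ (j - 1)) (q := F j k) (by positivity)]
        rw [ENNReal.tsum_mul_left, ENNReal.ofReal_mul (by positivity)]
        exact mul_le_mul_right (hF j) _
    _ = ENNReal.ofReal (D * 2 ^ (J + 1)) := by
        rw [← ENNReal.ofReal_sum_of_nonneg fun j _ => by positivity, ← Finset.sum_mul,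
          sum_two_pow_pred, mul_comm]

theorem lintegral_threshCoeff_sub_sq_le {n : ℕ} (hn : 0 < n) (γ : ℝ) {f : ℝ → ℝ} (hf : IsDensity f)
    (i : ℕ × ℤ) :
    ∫⁻ X, ENNReal.ofReal ((W.threshCoeff γ X i - W.coeff f i) ^ 2) ∂(sampleLaw n f) ≤
      ENNReal.ofReal (2 * (W.supNorm i ^ 2 * (densityLaw f).real {x | W.dec i x ≠ 0})
        + 2 * W.coeff f i ^ 2) := by
  have := hf.isProbabilityMeasure
  have h := lintegral_sq_thresholdedMean_le (μ := densityLaw f) (W.measurable_dec i)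
    ((withDensity_absolutelyContinuous _ _).ae_le (W.abs_dec_le_supNorm_ae i)) hn γ (W.supNorm i)
  rw [hf.integral_densityLaw] at h
  exact h

theorem maxRisk_ne_top {n : ℕ} (hn : 2 ≤ n) (γ c c' α R R' : ℝ) (p q : ℝ≥0∞) :
    maxRisk n (W.besovBall α p q R ∩ boundedDensities R') (W.estimator γ c c' n) ≠ ∞ := by
  obtain ⟨c₂, hc₂, hrisk⟩ := W.exists_risk_le_tsum
  obtain ⟨S, hS, hcoeff⟩ := W.exists_tsum_coeff_sq_le R'
  obtain ⟨D, hD, hDb⟩ := W.exists_coeff_bounds R'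
  have hD0 : 0 ≤ D := by linarith
  refine ne_top_of_le_ne_top (b := ENNReal.ofReal c₂ * (ENNReal.ofReal (2 * D ^ 2) *
    ENNReal.ofReal (D * 2 ^ (topLevel c c' n + 1)) + 2 * ENNReal.ofReal S)) (by finiteness) ?_
  refine iSup₂_le fun f hf => (hrisk γ c c' n f hf.2.1 (hf.2.1.memLp hf.2.2.1)).trans ?_
  refine mul_le_mul_right ?_ _
  refine le_trans ?_ (add_le_add (mul_le_mul_right (tsum_mass_le hD0
    (F := fun j k => (densityLaw f).real {x | W.dec (j, k) x ≠ 0})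
    (fun j => (hDb f hf.2 j).2.2.1) _) _) (mul_le_mul_right (hcoeff f hf.2) _))
  rw [← ENNReal.tsum_mul_left, ← ENNReal.tsum_mul_left, ← ENNReal.tsum_add]
  refine ENNReal.tsum_le_tsum fun j => ?_
  rw [← ENNReal.tsum_mul_left, ← ENNReal.tsum_mul_left, ← ENNReal.tsum_add]
  refine ENNReal.tsum_le_tsum fun k => ?_
  split_ifs with hj
  · refine (W.lintegral_threshCoeff_sub_sq_le (by omega) γ hf.2.1 (j, k)).trans ?_
    rw [← ENNReal.ofReal_mul (by positivity), ENNReal.ofReal_add (by positivity) (by positivity)]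
    refine add_le_add (ENNReal.ofReal_le_ofReal ?_) ?_
    · have := (hDb f hf.2 j).1 k
      calc _ ≤ 2 * (D ^ 2 * 2 ^ (j - 1) * (densityLaw f).real {x | W.dec (j, k) x ≠ 0}) := by gcongr
        _ = _ := by ring
    · rw [ENNReal.ofReal_mul (by norm_num)]; simp
  · rw [mul_zero, zero_add, two_mul]
    exact le_self_add

theorem level_risk_le {B2 mn t F b2 β2 E l : ℝ} (hB : 1 ≤ B2) (hF : 0 ≤ F) (hE : 0 ≤ E)
    (hl : 0 ≤ l) (hβ : 0 ≤ β2) (hb : b2 ≤ B2 * t) {L : ℝ} (hL : 0 ≤ L)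
    (hmn : mn = min β2 (b2 * F * L)) :
    mn + β2 * E + b2 * F * L * l * E ≤
      B2 * min β2 (t * F * L) + E * β2 + B2 * L * l * E * (t * F) := by
  have h1 : b2 * F * L ≤ B2 * (t * F * L) := by
    calc b2 * F * L ≤ (B2 * t) * F * L := by gcongr
      _ = _ := by ring
  have h2 : mn ≤ B2 * min β2 (t * F * L) := by
    rw [hmn, mul_min_of_nonneg _ _ (by linarith)]
    exact min_le_min (by nlinarith) h1
  have h3 : b2 * F * L * l * E ≤ B2 * L * l * E * (t * F) := by
    calc b2 * F * L * l * E = b2 * F * L * (l * E) := by ring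
      _ ≤ B2 * (t * F * L) * (l * E) := by gcongr
      _ = _ := by ring
  linarith

/-- The intermediate `γ'` is used on both sides: `γ' < γ` gives the oracle inequality for each
coefficient, and `c < γ'` makes the residual terms, summed up to `2 ^ J ≤ L ^ (-c)`, of order `L`.
-/
theorem exists_maxRisk_le {c γ : ℝ} (hc : 1 ≤ c) (hγ : c < γ) {α R R' : ℝ} {p q : ℝ≥0∞} (hα : 0 < α)
    (hp : 1 ≤ p) (hq : 1 ≤ q) (hR : 0 < R)
    (hcond : (p⁻¹).toReal - 1 / 2 ≤ α * (1 - 1 / (c * (1 + 2 * α)))) :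
    ∃ C : ℝ, 0 < C ∧ ∀ n : ℕ, 2 ≤ n →
      maxRisk n (W.besovBall α p q R ∩ boundedDensities R') (W.estimator γ c (-c) n)
        ≤ ENNReal.ofReal (C * (Real.log n / n) ^ rateExponent α p) := by
  refine exists_const_of_eventually_le (fun n hn => Real.rpow_pos_of_pos (log_div_nat_mem hn).1 _)
    (fun n hn => W.maxRisk_ne_top hn γ c (-c) α R R' p q) ?_
  obtain ⟨γ', hγ1, hγ2⟩ := exists_between hγ
  have hγ'1 : 1 ≤ γ' := by linarith
  obtain ⟨c₂, hc₂, hrisk⟩ := W.exists_risk_le_tsum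
  obtain ⟨S, hS, hcoeff⟩ := W.exists_tsum_coeff_sq_le R'
  obtain ⟨D, hD, hDb⟩ := W.exists_coeff_bounds R'
  have hD0 : 0 < D := by linarith
  obtain ⟨C₁, hC₁, n₀, hone⟩ := exists_thresholdedMean_risk_bound (Ω := ℝ) hγ'1 hγ2
  obtain ⟨C₃, hC₃, hseq⟩ := exists_sequence_bound hα hp hR hD hc hcond
  have hδ : 0 < γ' - c := by linarith
  refine ⟨c₂ * ((C₁ * D ^ 2 + 1) * C₃ + 2 * C₁ * S + C₁ * D ^ 3 * 2 * (2 ^ c * (1 + 1 / (γ' - c)))),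
    by positivity, n₀, fun n hn₀ hn => ?_⟩
  refine iSup₂_le fun f hf => (hrisk γ c (-c) n f hf.2.1 (hf.2.1.memLp hf.2.2.1)).trans ?_
  have hprob := hf.2.1.isProbabilityMeasure
  obtain ⟨hL, hL1⟩ := log_div_nat_mem hn
  have hl := half_le_log_nat hn
  have hE := exp_neg_mul_log_le hγ'1 hn
  have hres := one_add_log_mul_exp_mul_le (by linarith) hγ1 hn
  have hJ1 := le_two_pow_topLevel c (-c) n
  have hJ2 := two_pow_topLevel_le (c := c) (c' := -c) (n := n) (by
    rw [rpow_mul_log_rpow_neg hn]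
    exact Real.one_le_rpow_of_pos_of_le_one_of_nonpos hL hL1 (by linarith))
  rw [rpow_mul_log_rpow_neg hn] at hJ1 hJ2
  set J := topLevel c (-c) n
  set L := Real.log n / n with hLdef
  set E := Real.exp (-(γ' * Real.log n)) with hEdef
  have hE0 : 0 < E := Real.exp_pos _
  have hρ : L ≤ L ^ rateExponent α p := by
    calc L = L ^ (1 : ℝ) := (Real.rpow_one L).symm
      _ ≤ _ := Real.rpow_le_rpow_of_exponent_ge hL hL1 (rateExponent_le_one hα p)
  have hρ0 : 0 < L ^ rateExponent α p := by positivity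
  set F : ℕ → ℤ → ℝ := fun j k => (densityLaw f).real {x | W.dec (j, k) x ≠ 0} with hF
  set β : ℕ → ℤ → ℝ := fun j k => W.coeff f (j, k) with hβ
  have hF0 : ∀ j k, 0 ≤ F j k := fun _ _ => measureReal_nonneg
  have hA := hseq L hL hL1 J hJ1 β F hF0 (fun j k => (hDb f hf.2 j).2.1 k)
    (fun j => (hDb f hf.2 j).2.2.1) (fun j k => (hDb f hf.2 j).2.2.2 k)
    (fun j => W.eLpNorm_coeff_le hq hf.1 j)
  have hM := tsum_mass_le hD0.le (fun j => (hDb f hf.2 j).2.2.1) J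
  have hS' := hcoeff f hf.2
  have hT : ∑' j, ∑' k, (if j < J + 2 then
        ∫⁻ X, ENNReal.ofReal ((W.threshCoeff γ X (j, k) - W.coeff f (j, k)) ^ 2) ∂(sampleLaw n f)
      else ENNReal.ofReal (W.coeff f (j, k) ^ 2)) ≤
      ENNReal.ofReal (C₁ * D ^ 2 + 1) * ENNReal.ofReal (C₃ * L ^ rateExponent α p) +
      ENNReal.ofReal (C₁ * E) * ENNReal.ofReal S +
      ENNReal.ofReal (C₁ * (D ^ 2 * L * (1 + Real.log n) * E)) * ENNReal.ofReal (D * 2 ^ (J + 1)) := by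
    refine le_trans ?_ (add_le_add (add_le_add (mul_le_mul_right hA _) (mul_le_mul_right hS' _))
      (mul_le_mul_right hM _))
    simp_rw [← ENNReal.tsum_mul_left, ← ENNReal.tsum_add]
    refine ENNReal.tsum_le_tsum fun j => ENNReal.tsum_le_tsum fun k => ?_
    split_ifs with hj
    · have h1 := hone n hn₀ hn (densityLaw f) (W.dec (j, k)) (W.supNorm (j, k))
        (W.measurable_dec _) (W.supNorm_pos _)
        ((withDensity_absolutelyContinuous _ _).ae_le (W.abs_dec_le_supNorm_ae _))
      rw [hf.2.1.integral_densityLaw] at h1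
      refine le_trans h1 ?_
      have hmin : 0 ≤ min (β j k ^ 2) (2 ^ (j - 1) * F j k * L) :=
        le_min (sq_nonneg _) (by have := hF0 j k; positivity)
      have := hF0 j k
      rw [← ENNReal.ofReal_mul (by positivity), ← ENNReal.ofReal_mul (by positivity),
        ← ENNReal.ofReal_mul (by positivity), ← ENNReal.ofReal_add (by positivity) (by positivity),
        ← ENNReal.ofReal_add (by positivity) (by positivity)]
      refine ENNReal.ofReal_le_ofReal ?_
      have h2 := level_risk_le (B2 := D ^ 2) (t := 2 ^ (j - 1)) (F := F j k) (E := E)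
        (l := 1 + Real.log n) (β2 := β j k ^ 2) (L := L) (by nlinarith) (hF0 j k)
        hE0.le (by linarith) (sq_nonneg _) ((hDb f hf.2 j).1 k) hL.le rfl
      calc _ ≤ C₁ * (D ^ 2 * min (β j k ^ 2) (2 ^ (j - 1) * F j k * L) + E * β j k ^ 2
            + D ^ 2 * L * (1 + Real.log n) * E * (2 ^ (j - 1) * F j k)) :=
            mul_le_mul_of_nonneg_left h2 hC₁.le
        _ ≤ _ := by linarith
    · rw [mul_zero, add_zero]
      refine le_add_right ?_
      refine le_mul_of_one_le_left (zero_le) ?_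
      rw [ENNReal.one_le_ofReal]
      nlinarith [mul_pos hC₁ (pow_pos hD0 2)]
  refine (mul_le_mul_right hT _).trans ?_
  rw [← ENNReal.ofReal_mul (by positivity), ← ENNReal.ofReal_mul (by positivity),
    ← ENNReal.ofReal_mul (by positivity), ← ENNReal.ofReal_add (by positivity) (by positivity),
    ← ENNReal.ofReal_add (by positivity) (by positivity), ← ENNReal.ofReal_mul (by positivity)]
  refine ENNReal.ofReal_le_ofReal ?_
  rw [mul_assoc c₂]
  refine mul_le_mul_of_nonneg_left ?_ hc₂.le
  have h3 : C₁ * E * S ≤ 2 * C₁ * S * L ^ rateExponent α p := by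
    calc C₁ * E * S ≤ C₁ * (2 * L ^ rateExponent α p) * S := by gcongr; linarith
      _ = _ := by ring
  have h4 : C₁ * (D ^ 2 * L * (1 + Real.log n) * E) * (D * 2 ^ (J + 1))
      ≤ C₁ * D ^ 3 * 2 * (2 ^ c * (1 + 1 / (γ' - c))) * L ^ rateExponent α p := by
    calc _ = C₁ * D ^ 3 * 2 * L * ((1 + Real.log n) * E * 2 ^ J) := by ring
      _ ≤ C₁ * D ^ 3 * 2 * L ^ rateExponent α p * ((1 + Real.log n) * E * L ^ (-c)) := by gcongr
      _ ≤ C₁ * D ^ 3 * 2 * L ^ rateExponent α p * (2 ^ c * (1 + 1 / (γ' - c))) := by gcongr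
      _ = _ := by ring
  linarith

end BiorthogonalWaveletBasis

/-! ### Two-point bounds for product laws -/

theorem lintegral_mul_sq_le {Ω : Type*} [MeasurableSpace Ω] (μ : Measure Ω) {f g : Ω → ℝ≥0∞}
    (hf : Measurable f) (hg : Measurable g) :
    (∫⁻ x, f x * g x ∂μ) ^ 2 ≤ (∫⁻ x, f x ^ 2 ∂μ) * ∫⁻ x, g x ^ 2 ∂μ := by
  have h := ENNReal.lintegral_mul_le_Lp_mul_Lq μ Real.HolderConjugate.two_two hf.aemeasurable
    hg.aemeasurable
  have h2 := pow_le_pow_left' h 2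
  simp only [Pi.mul_apply] at h2
  refine h2.trans_eq ?_
  rw [mul_pow]
  simp only [ENNReal.rpow_two, ← ENNReal.rpow_natCast, ← ENNReal.rpow_mul]
  norm_num

theorem IsDensity.sampleLaw_eq {f : ℝ → ℝ} (hf : IsDensity f) (n : ℕ) :
    sampleLaw n f = (Measure.pi fun _ : Fin n => (volume : Measure ℝ)).withDensity
      fun X => ∏ i, ENNReal.ofReal (f (X i)) := by
  have := hf.isProbabilityMeasure
  refine (Measure.pi_eq fun s hs => ?_)
  rw [withDensity_apply _ (MeasurableSet.univ_pi hs), ← lintegral_indicator (MeasurableSet.univ_pi hs)]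
  have h : ∀ X : Fin n → ℝ, (Set.univ.pi s).indicator (fun X => ∏ i, ENNReal.ofReal (f (X i))) X
      = ∏ i, (s i).indicator (fun x => ENNReal.ofReal (f x)) (X i) := by
    intro X
    by_cases hX : X ∈ Set.univ.pi s
    · rw [Set.indicator_of_mem hX]
      exact Finset.prod_congr rfl fun i _ => by rw [Set.indicator_of_mem (hX i (Set.mem_univ i))]
    · rw [Set.indicator_of_notMem hX]
      simp only [Set.mem_pi, Set.mem_univ, true_imp_iff, not_forall] at hX
      obtain ⟨i, hi⟩ := hX
      exact (Finset.prod_eq_zero (Finset.mem_univ i) (Set.indicator_of_notMem hi _)).symm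
  simp_rw [h]
  rw [lintegral_pi_prod volume n (fun i => (s i).indicator fun x => ENNReal.ofReal (f x))
    fun i => hf.1.ennreal_ofReal.indicator (hs i)]
  refine Finset.prod_congr rfl fun i _ => ?_
  rw [lintegral_indicator (hs i), withDensity_apply _ (hs i)]

/-- Le Cam's two-point bound in terms of the Hellinger affinity. -/
theorem two_point_bound {f g : ℝ → ℝ} (hf : IsDensity f) (hg : IsDensity g) (n : ℕ)
    {T : (Fin n → ℝ) → ℝ} (hT : Measurable T) (u v : ℝ) :
    ((∫⁻ x, ENNReal.ofReal √(f x * g x)) ^ n) ^ 2 * ENNReal.ofReal ((u - v) ^ 2) ≤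
      2 * (∫⁻ X, ENNReal.ofReal ((T X - u) ^ 2) ∂(sampleLaw n f) +
        ∫⁻ X, ENNReal.ofReal ((T X - v) ^ 2) ∂(sampleLaw n g)) := by
  set P : Measure (Fin n → ℝ) := Measure.pi fun _ : Fin n => (volume : Measure ℝ)
  have hroot : ∀ {k : ℝ → ℝ}, IsDensity k → Measurable fun X : Fin n → ℝ =>
      ∏ i, ENNReal.ofReal √(k (X i)) := fun hk =>
    Finset.measurable_fun_prod _ fun i _ =>
      (hk.1.sqrt.ennreal_ofReal).comp (measurable_pi_apply i)
  have hroot_sq : ∀ {k : ℝ → ℝ}, IsDensity k → ∀ X : Fin n → ℝ,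
      (∏ i, ENNReal.ofReal √(k (X i))) ^ 2 = ∏ i, ENNReal.ofReal (k (X i)) := by
    intro k hk X
    rw [← Finset.prod_pow]
    refine Finset.prod_congr rfl fun i _ => ?_
    rw [← ENNReal.ofReal_pow (Real.sqrt_nonneg _), Real.sq_sqrt (hk.2.1 _)]
  have hprod : ∀ {k : ℝ → ℝ}, IsDensity k → Measurable fun X : Fin n → ℝ =>
      ∏ i, ENNReal.ofReal (k (X i)) := fun hk =>
    Finset.measurable_fun_prod _ fun i _ => hk.1.ennreal_ofReal.comp (measurable_pi_apply i)
  have hmass : ∀ {k : ℝ → ℝ}, IsDensity k → ∫⁻ X, ∏ i, ENNReal.ofReal (k (X i)) ∂P = 1 := by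
    intro k hk
    rw [lintegral_pi_prod volume n (fun _ x => ENNReal.ofReal (k x)) fun _ => hk.1.ennreal_ofReal]
    simp [hk.2.2]
  have haff : (∫⁻ x, ENNReal.ofReal √(f x * g x)) ^ n
      = ∫⁻ X, (∏ i, ENNReal.ofReal √(f (X i))) * ∏ i, ENNReal.ofReal √(g (X i)) ∂P := by
    have h1 := lintegral_pi_prod volume n (fun _ x => ENNReal.ofReal √(f x * g x))
      fun _ => (hf.1.mul hg.1).sqrt.ennreal_ofReal
    simp only [Finset.prod_const, Finset.card_univ, Fintype.card_fin] at h1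
    rw [← h1]
    refine lintegral_congr fun X => ?_
    rw [← Finset.prod_mul_distrib]
    refine Finset.prod_congr rfl fun i _ => ?_
    rw [Real.sqrt_mul (hf.2.1 _), ENNReal.ofReal_mul (Real.sqrt_nonneg _)]
  -- Cauchy–Schwarz; the root of the product density `l` has `L²` norm one.
  have hcs : ∀ {k l : ℝ → ℝ}, IsDensity k → IsDensity l → ∀ w : ℝ,
      (∫⁻ X, (ENNReal.ofReal |T X - w| * ∏ i, ENNReal.ofReal √(k (X i))) *
        ∏ i, ENNReal.ofReal √(l (X i)) ∂P) ^ 2 ≤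
      ∫⁻ X, ENNReal.ofReal ((T X - w) ^ 2) ∂(sampleLaw n k) := by
    intro k l hk hl w
    have hTw : Measurable fun X => ENNReal.ofReal |T X - w| :=
      (hT.sub_const w).abs.ennreal_ofReal
    refine (lintegral_mul_sq_le P (hTw.mul (hroot hk)) (hroot hl)).trans_eq ?_
    simp only [Pi.mul_apply]
    simp_rw [hroot_sq hl, hmass hl, mul_one, mul_pow, hroot_sq hk]
    rw [hk.sampleLaw_eq n, lintegral_withDensity_eq_lintegral_mul _ (hprod hk) (by fun_prop)]
    refine lintegral_congr fun X => ?_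
    rw [Pi.mul_apply, mul_comm, ← ENNReal.ofReal_pow (abs_nonneg _), sq_abs]
  -- The triangle inequality `|u - v| ≤ |T - u| + |T - v|`, integrated against the geometric mean of
  -- the two product densities.
  have hmain : (∫⁻ x, ENNReal.ofReal √(f x * g x)) ^ n * ENNReal.ofReal |u - v| ≤
      ∫⁻ X, (ENNReal.ofReal |T X - u| * ∏ i, ENNReal.ofReal √(f (X i))) *
        ∏ i, ENNReal.ofReal √(g (X i)) ∂P +
      ∫⁻ X, (ENNReal.ofReal |T X - v| * ∏ i, ENNReal.ofReal √(g (X i))) *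
        ∏ i, ENNReal.ofReal √(f (X i)) ∂P := by
    have hTu : Measurable fun X => ENNReal.ofReal |T X - u| :=
      (hT.sub_const u).abs.ennreal_ofReal
    have hm1 : Measurable fun X : Fin n → ℝ =>
        (∏ i, ENNReal.ofReal √(f (X i))) * ∏ i, ENNReal.ofReal √(g (X i)) :=
      (hroot hf).mul (hroot hg)
    have hm2 : Measurable fun X : Fin n → ℝ =>
        (ENNReal.ofReal |T X - u| * ∏ i, ENNReal.ofReal √(f (X i))) *
          ∏ i, ENNReal.ofReal √(g (X i)) := (hTu.mul (hroot hf)).mul (hroot hg)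
    rw [haff, mul_comm, ← lintegral_const_mul _ hm1, ← lintegral_add_left hm2]
    refine lintegral_mono fun X => ?_
    have htri : ENNReal.ofReal |u - v| ≤ ENNReal.ofReal |T X - u| + ENNReal.ofReal |T X - v| := by
      rw [← ENNReal.ofReal_add (abs_nonneg _) (abs_nonneg _), abs_sub_comm (T X) u]
      exact ENNReal.ofReal_le_ofReal (abs_sub_le _ _ _)
    calc _ ≤ (ENNReal.ofReal |T X - u| + ENNReal.ofReal |T X - v|) *
          ((∏ i, ENNReal.ofReal √(f (X i))) * ∏ i, ENNReal.ofReal √(g (X i))) :=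
          mul_le_mul_left htri _
      _ = _ := by ring
  calc _ = ((∫⁻ x, ENNReal.ofReal √(f x * g x)) ^ n * ENNReal.ofReal |u - v|) ^ 2 := by
        rw [mul_pow, ← ENNReal.ofReal_pow (abs_nonneg (u - v)), sq_abs]
    _ ≤ _ := pow_le_pow_left' hmain 2
    _ ≤ 2 * (_ ^ 2 + _ ^ 2) := by
        have := ENNReal.rpow_add_le_mul_rpow_add_rpow (p := 2)
          (∫⁻ X, (ENNReal.ofReal |T X - u| * ∏ i, ENNReal.ofReal √(f (X i))) *
            ∏ i, ENNReal.ofReal √(g (X i)) ∂P)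
          (∫⁻ X, (ENNReal.ofReal |T X - v| * ∏ i, ENNReal.ofReal √(g (X i))) *
            ∏ i, ENNReal.ofReal √(f (X i)) ∂P) (by norm_num)
        norm_num at this
        exact this
    _ ≤ _ := mul_le_mul_right (add_le_add (hcs hf hg u) (hcs hg hf v)) _

/-- `(√a - √b) ^ 2 = (a - b) ^ 2 / (√a + √b) ^ 2`, and the denominator is at least `a + b ≥ m`. -/
theorem add_le_two_mul_sqrt_add {a b m : ℝ} (ha : 0 ≤ a) (hb : 0 ≤ b) (hm : 0 < m)
    (h : a = b ∨ m ≤ a + b) : a + b ≤ 2 * √(a * b) + (a - b) ^ 2 / m := by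
  rcases h with rfl | h
  · rw [Real.sqrt_mul_self ha]; simp; linarith
  · rw [Real.sqrt_mul ha]
    have h1 := Real.sq_sqrt ha
    have h2 := Real.sq_sqrt hb
    have hx := Real.sqrt_nonneg a
    have hy := Real.sqrt_nonneg b
    set x := √a
    set y := √b
    have h3 : (x - y) ^ 2 ≤ (a - b) ^ 2 / m := by
      rw [le_div_iff₀ hm, ← h1, ← h2]
      calc (x - y) ^ 2 * m ≤ (x - y) ^ 2 * (x ^ 2 + y ^ 2) := by gcongr; linarith
        _ ≤ (x - y) ^ 2 * (x + y) ^ 2 := by gcongr; nlinarith [mul_nonneg hx hy]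
        _ = _ := by ring
    nlinarith

/-- A lower bound of the affinity of two densities which differ only where their sum is large. -/
theorem one_sub_le_affinity {f g : ℝ → ℝ} (hf : IsDensity f) (hg : IsDensity g) {m t : ℝ}
    (hm : 0 < m) (ht0 : 0 ≤ t) (h : ∀ x, f x = g x ∨ m ≤ f x + g x)
    (ht : ∫⁻ x, ENNReal.ofReal ((f x - g x) ^ 2 / m) ≤ ENNReal.ofReal (2 * t)) :
    ENNReal.ofReal (1 - t) ≤ ∫⁻ x, ENNReal.ofReal √(f x * g x) := by
  have hmf := hf.1
  have hmg := hg.1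
  have key : (2 : ℝ≥0∞) ≤ 2 * (∫⁻ x, ENNReal.ofReal √(f x * g x)) + ENNReal.ofReal (2 * t) := by
    calc (2 : ℝ≥0∞) = ∫⁻ x, (ENNReal.ofReal (f x) + ENNReal.ofReal (g x)) := by
          rw [lintegral_add_left hmf.ennreal_ofReal, hf.2.2, hg.2.2]; norm_num
      _ ≤ ∫⁻ x, (2 * ENNReal.ofReal √(f x * g x) + ENNReal.ofReal ((f x - g x) ^ 2 / m)) := by
          refine lintegral_mono fun x => ?_
          have h2 : (2 : ℝ≥0∞) = ENNReal.ofReal 2 := by simp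
          rw [h2, ← ENNReal.ofReal_mul (by norm_num), ← ENNReal.ofReal_add (hf.2.1 x) (hg.2.1 x),
            ← ENNReal.ofReal_add (by positivity) (by positivity)]
          exact ENNReal.ofReal_le_ofReal
            (add_le_two_mul_sqrt_add (hf.2.1 x) (hg.2.1 x) hm (h x))
      _ = 2 * (∫⁻ x, ENNReal.ofReal √(f x * g x)) + ∫⁻ x, ENNReal.ofReal ((f x - g x) ^ 2 / m) := by
          rw [lintegral_add_left (by fun_prop), lintegral_const_mul _ (by fun_prop)]
      _ ≤ _ := by gcongr
  set a := ∫⁻ x, ENNReal.ofReal √(f x * g x)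
  rcases eq_or_ne a ∞ with ha | ha
  · simp [ha]
  have h1 := ENNReal.toReal_mono (by finiteness) key
  refine ENNReal.ofReal_le_of_le_toReal ?_
  rw [ENNReal.toReal_add (by finiteness) (by finiteness), ENNReal.toReal_mul,
    ENNReal.toReal_ofReal (by linarith)] at h1
  simp at h1
  linarith

/-- Bernoulli's inequality: `(1 - t) ^ (2 n) ≥ 1 - 2 n t`. -/
theorem half_le_pow_sq_affinity {a : ℝ≥0∞} {n : ℕ} {t : ℝ} (ht1 : t ≤ 1) (hnt : n * t ≤ 1 / 4)
    (ha : ENNReal.ofReal (1 - t) ≤ a) : ENNReal.ofReal (1 / 2) ≤ (a ^ n) ^ 2 := by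
  calc ENNReal.ofReal (1 / 2) ≤ ENNReal.ofReal (((1 - t) ^ n) ^ 2) := by
        refine ENNReal.ofReal_le_ofReal ?_
        rw [← pow_mul]
        have := one_add_mul_le_pow (a := -t) (by linarith) (n * 2)
        push_cast at this
        rw [← sub_eq_add_neg] at this
        linarith
    _ = (ENNReal.ofReal (1 - t) ^ n) ^ 2 := by
        rw [← ENNReal.ofReal_pow (by linarith), ← ENNReal.ofReal_pow (by positivity)]
    _ ≤ _ := by gcongr

/-! ### Assouad's lemma -/

/-- Averaging over all vertices: flipping one coordinate is an involution of the cube, so the two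
terms in `h2` have the same average. -/
theorem assouad_average {M : ℕ} {ρ : (Fin M → Bool) → Fin M → ℝ≥0∞} {m κ : ℝ≥0∞}
    (h1 : ∀ s, ∑ i, ρ s i ≤ m)
    (h2 : ∀ s i, κ ≤ ρ s i + ρ (Function.update s i (!s i)) i) : M * κ ≤ 2 * m := by
  have hflip : ∀ i, ∑ s, ρ (Function.update s i (!s i)) i = ∑ s, ρ s i := by
    intro i
    have hinv : Function.Involutive fun s : Fin M → Bool => Function.update s i (!s i) := by
      intro s; simp
    exact Equiv.sum_comp hinv.toPerm fun s => ρ s i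
  have hcard : (Finset.univ : Finset (Fin M → Bool)).card = 2 ^ M := by simp
  have h3 : (2 ^ M : ℝ≥0∞) * (M * κ) ≤ 2 ^ M * (2 * m) := by
    calc (2 ^ M : ℝ≥0∞) * (M * κ) = ∑ s : Fin M → Bool, ∑ i : Fin M, κ := by
          simp
      _ ≤ ∑ s, ∑ i, (ρ s i + ρ (Function.update s i (!s i)) i) :=
          Finset.sum_le_sum fun s _ => Finset.sum_le_sum fun i _ => h2 s i
      _ = ∑ i, (∑ s, ρ s i + ∑ s, ρ (Function.update s i (!s i)) i) := by
          rw [Finset.sum_comm]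
          simp_rw [Finset.sum_add_distrib]
      _ = 2 * ∑ s, ∑ i, ρ s i := by
          simp_rw [hflip, ← two_mul]
          rw [← Finset.mul_sum, Finset.sum_comm]
      _ ≤ 2 * ∑ s : Fin M → Bool, m := by gcongr with s; exact h1 s
      _ = _ := by simp; ring
  exact (ENNReal.mul_le_mul_iff_right (by positivity) (by finiteness)).1 h3

theorem measurable_lintegral_sampleLaw {n : ℕ} {fhat : (Fin n → ℝ) → ℝ → ℝ} (hT : IsEstimator n fhat)
    {f : ℝ → ℝ} (hf : IsDensity f) :
    Measurable fun x => ∫⁻ X, ENNReal.ofReal ((fhat X x - f x) ^ 2) ∂(sampleLaw n f) := by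
  have := hf.isProbabilityMeasure
  have : SFinite (sampleLaw n f) := by unfold sampleLaw; infer_instance
  have h1 : Measurable fun z : ℝ × (Fin n → ℝ) => fhat z.2 z.1 := hT.comp measurable_swap
  have h2 : Measurable fun z : ℝ × (Fin n → ℝ) => f z.1 := hf.1.comp measurable_fst
  exact Measurable.lintegral_prod_right' (f := fun z : ℝ × (Fin n → ℝ) =>
    ENNReal.ofReal ((fhat z.2 z.1 - f z.1) ^ 2)) ((h1.sub h2).pow_const 2).ennreal_ofReal

theorem risk_eq_lintegral {n : ℕ} {fhat : (Fin n → ℝ) → ℝ → ℝ} (hT : IsEstimator n fhat)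
    {f : ℝ → ℝ} (hf : IsDensity f) : risk n fhat f =
      ∫⁻ x, ∫⁻ X, ENNReal.ofReal ((fhat X x - f x) ^ 2) ∂(sampleLaw n f) := by
  have := hf.isProbabilityMeasure
  have : SFinite (sampleLaw n f) := by unfold sampleLaw; infer_instance
  have h1 : Measurable fun z : (Fin n → ℝ) × ℝ => fhat z.1 z.2 := hT
  have h2 : Measurable fun z : (Fin n → ℝ) × ℝ => f z.2 := hf.1.comp measurable_snd
  rw [risk, ← lintegral_lintegral_swap]
  · refine lintegral_congr fun X => ?_
    rw [eLpNorm_two_sq]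
    refine lintegral_congr fun x => ?_
    rw [Real.enorm_eq_ofReal_abs, ← ENNReal.ofReal_pow (abs_nonneg _), sq_abs]
  · exact Measurable.aemeasurable ((h1.sub h2).pow_const 2).ennreal_ofReal

/-- Assouad's lower bound over a hypercube of densities whose perturbations live on disjoint sets. -/
theorem assouad_bound {n M : ℕ} {f : (Fin M → Bool) → ℝ → ℝ} (hf : ∀ s, IsDensity (f s))
    {g : Fin M → ℝ → ℝ} {S : Fin M → Set ℝ} (hS : ∀ i, MeasurableSet (S i))
    (hdisj : Pairwise (Function.onFun Disjoint S))
    (hg : ∀ i x, x ∉ S i → g i x = 0) (hgm : ∀ i, Measurable (g i))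
    (hdiff : ∀ s i x, (f s x - f (Function.update s i (!s i)) x) ^ 2 = g i x ^ 2)
    {v : ℝ≥0∞} (hv : ∀ i, v ≤ ∫⁻ x, ENNReal.ofReal (g i x ^ 2))
    (haff : ∀ s i, ENNReal.ofReal (1 / 2) ≤
      ((∫⁻ x, ENNReal.ofReal √(f s x * f (Function.update s i (!s i)) x)) ^ n) ^ 2)
    {F : Set (ℝ → ℝ)} (hF : ∀ s, f s ∈ F) :
    M * (ENNReal.ofReal (1 / 4) * v) ≤ 2 * minimaxRisk n F := by
  rw [minimaxRisk, ENNReal.mul_iInf_of_ne (by norm_num) (by norm_num)]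
  refine le_iInf fun fhat => ?_
  rw [ENNReal.mul_iInf_of_ne (by norm_num) (by norm_num)]
  refine le_iInf fun hT => ?_
  set e : (Fin M → Bool) → ℝ → ℝ≥0∞ := fun s x =>
    ∫⁻ X, ENNReal.ofReal ((fhat X x - f s x) ^ 2) ∂(sampleLaw n (f s)) with he
  have hem : ∀ s, Measurable (e s) := fun s => measurable_lintegral_sampleLaw hT (hf s)
  refine assouad_average (ρ := fun s i => ∫⁻ x in S i, e s x) (fun s => ?_) (fun s i => ?_)
  · calc ∑ i, ∫⁻ x in S i, e s x = ∫⁻ x in ⋃ i, S i, e s x := by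
          rw [lintegral_iUnion hS hdisj, tsum_fintype]
      _ ≤ ∫⁻ x, e s x := setLIntegral_le_lintegral _ _
      _ = risk n fhat (f s) := (risk_eq_lintegral hT (hf s)).symm
      _ ≤ _ := le_iSup₂ (f := fun f (_ : f ∈ F) => risk n fhat f) (f s) (hF s)
  · rw [← lintegral_add_left (hem s)]
    -- The two-point bound is used at each `x` separately, with `fhat X x` as a real-valued
    -- estimator; integrating over `S i` then localises the risk.
    have hpt : ∀ x, ENNReal.ofReal (1 / 4) * ENNReal.ofReal (g i x ^ 2) ≤
        e s x + e (Function.update s i (!s i)) x := by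
      intro x
      have hTx : Measurable fun X => fhat X x := hT.comp (measurable_prodMk_right)
      have h := two_point_bound (hf s) (hf (Function.update s i (!s i))) n hTx (f s x)
        (f (Function.update s i (!s i)) x)
      rw [hdiff] at h
      have h2 := (mul_le_mul_left (haff s i) _).trans h
      have h3 : ENNReal.ofReal (1 / 2) * ENNReal.ofReal (g i x ^ 2)
          = 2 * (ENNReal.ofReal (1 / 4) * ENNReal.ofReal (g i x ^ 2)) := by
        rw [← mul_assoc]
        congr 1
        rw [show (2 : ℝ≥0∞) = ENNReal.ofReal 2 by simp, ← ENNReal.ofReal_mul (by norm_num)]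
        norm_num
      rw [h3] at h2
      exact (ENNReal.mul_le_mul_iff_right (by norm_num) (by norm_num)).1 h2
    calc _ ≤ ENNReal.ofReal (1 / 4) * ∫⁻ x, ENNReal.ofReal (g i x ^ 2) := by gcongr; exact hv i
      _ = ENNReal.ofReal (1 / 4) * ∫⁻ x in S i, ENNReal.ofReal (g i x ^ 2) := by
          congr 1
          rw [← lintegral_indicator (hS i)]
          refine lintegral_congr fun x => ?_
          by_cases hx : x ∈ S i
          · simp [hx]
          · simp [hx, hg i x hx]
      _ = ∫⁻ x in S i, ENNReal.ofReal (1 / 4) * ENNReal.ofReal (g i x ^ 2) := by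
          rw [lintegral_const_mul _ (by have := hgm i; fun_prop)]
      _ ≤ _ := lintegral_mono fun x => hpt x

/-! ### A two-sided geometric distribution -/

/-- The probability weights proportional to `w ^ |k|` on `ℤ`. -/
noncomputable def geomWeight (w : ℝ) (k : ℤ) : ℝ := (1 - w) / (1 + w) * w ^ k.natAbs

theorem geomWeight_pos {w : ℝ} (h0 : 0 < w) (h1 : w < 1) (k : ℤ) : 0 < geomWeight w k := by
  unfold geomWeight
  have : 0 < 1 - w := by linarith
  positivity

theorem geomWeight_le {w : ℝ} (h0 : 0 < w) (h1 : w < 1) (k : ℤ) : geomWeight w k ≤ 1 - w := by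
  unfold geomWeight
  have h2 : w ^ k.natAbs ≤ 1 := pow_le_one₀ h0.le h1.le
  have h3 : (1 - w) / (1 + w) ≤ 1 - w := div_le_self (by linarith) (by linarith)
  calc _ ≤ (1 - w) * 1 := mul_le_mul h3 h2 (by positivity) (by linarith)
    _ = _ := mul_one _

theorem hasSum_geomWeight {w : ℝ} (h0 : 0 < w) (h1 : w < 1) : HasSum (geomWeight w) 1 := by
  have hg := hasSum_geometric_of_lt_one h0.le h1
  have h2 : HasSum (fun n : ℕ => geomWeight w n) ((1 - w) / (1 + w) * (1 - w)⁻¹) := by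
    simpa [geomWeight] using hg.mul_left ((1 - w) / (1 + w))
  have h3 : HasSum (fun n : ℕ => geomWeight w (-(n + 1))) ((1 - w) / (1 + w) * w * (1 - w)⁻¹) := by
    refine (hg.mul_left ((1 - w) / (1 + w) * w)).congr_fun fun n => ?_
    have : (-((n : ℤ) + 1)).natAbs = n + 1 := by omega
    rw [geomWeight, this]; ring
  convert h2.of_nat_of_neg_add_one h3 using 1
  have : 1 - w ≠ 0 := by linarith
  have : 1 + w ≠ 0 := by linarith
  field_simp

/-- Over a distance `N` the weights change by a factor of at least `w ^ N ≥ 1 - N (1 - w)`. The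
factor `2` pays for dividing by this quantity, which is at least `1 / 2`. -/
theorem abs_geomWeight_sub_le {w : ℝ} (h0 : 0 < w) (h1 : w < 1) {N : ℕ} (hN : N * (1 - w) ≤ 1 / 2)
    {k m : ℤ} (hkm : |k - m| ≤ N) :
    |geomWeight w k - geomWeight w m| ≤ 2 * (N * (1 - w)) * geomWeight w m := by
  have hk := geomWeight_pos h0 h1 k
  have hm := geomWeight_pos h0 h1 m
  have hstep : ∀ {a b : ℤ}, |a - b| ≤ N → (1 - N * (1 - w)) * geomWeight w a ≤ geomWeight w b := by
    intro a b hab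
    have hb : b.natAbs ≤ a.natAbs + N := by rw [abs_le] at hab; omega
    have h2 : 1 - N * (1 - w) ≤ w ^ N := by
      have := one_add_mul_le_pow (a := -(1 - w)) (by linarith) N
      simp only [neg_sub, add_sub_cancel] at this
      linarith
    have h4 : 0 ≤ (1 - w) / (1 + w) := div_nonneg (by linarith) (by linarith)
    calc (1 - N * (1 - w)) * geomWeight w a ≤ w ^ N * geomWeight w a :=
          mul_le_mul_of_nonneg_right h2 (geomWeight_pos h0 h1 a).le
      _ = (1 - w) / (1 + w) * w ^ (a.natAbs + N) := by rw [geomWeight, pow_add]; ring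
      _ ≤ geomWeight w b :=
          mul_le_mul_of_nonneg_left (pow_le_pow_of_le_one h0.le h1.le hb) h4
  have ha := hstep hkm
  have hb := hstep (a := m) (b := k) (by rwa [abs_sub_comm])
  have hx : 0 ≤ N * (1 - w) := mul_nonneg (Nat.cast_nonneg _) (by linarith)
  set x := N * (1 - w)
  rw [abs_le]
  constructor
  · nlinarith
  · nlinarith

theorem le_geomWeight {w : ℝ} (h0 : 0 < w) (h1 : w < 1) {m : ℤ}
    (hm : (m.natAbs : ℝ) * (1 - w) ≤ 1 / 2) : (1 - w) / 4 ≤ geomWeight w m := by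
  have h2 : 1 - m.natAbs * (1 - w) ≤ w ^ m.natAbs := by
    have := one_add_mul_le_pow (a := -(1 - w)) (by linarith) m.natAbs
    simp only [neg_sub, add_sub_cancel] at this
    linarith
  have h3 : (1 - w) / 2 ≤ (1 - w) / (1 + w) := by gcongr; linarith
  calc (1 - w) / 4 = (1 - w) / 2 * (1 / 2) := by ring
    _ ≤ _ := mul_le_mul h3 (by linarith) (by norm_num) (div_nonneg (by linarith) (by linarith))

/-- Interpolation between total mass one and maximum at most `1 - w`. -/
theorem eLpNorm_geomWeight_le {w : ℝ} (h0 : 0 < w) (h1 : w < 1) {p : ℝ≥0∞} (hp : 1 ≤ p) :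
    eLpNorm (geomWeight w) p Measure.count ≤ ENNReal.ofReal ((1 - w) ^ (1 - (p⁻¹).toReal)) := by
  have hw : 0 < 1 - w := by linarith
  have hpos := geomWeight_pos h0 h1
  have hle := geomWeight_le h0 h1
  rcases eq_or_ne p ∞ with rfl | hptop
  · rw [eLpNorm_exponent_top]
    refine eLpNormEssSup_le_of_ae_enorm_bound (ae_of_all _ fun k => ?_)
    rw [Real.enorm_eq_ofReal_abs, abs_of_pos (hpos k)]
    simpa using ENNReal.ofReal_le_ofReal (hle k)
  · have hp0 : p ≠ 0 := (zero_lt_one.trans_le hp).ne'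
    have hpr : 1 ≤ p.toReal := by simpa using ENNReal.toReal_mono hptop hp
    rw [eLpNorm_eq_lintegral_rpow_enorm_toReal hp0 hptop, lintegral_count, one_div,
      ENNReal.rpow_inv_le_iff (by linarith), ENNReal.ofReal_rpow_of_nonneg (by positivity) (by linarith),
      ← Real.rpow_mul hw.le, ENNReal.toReal_inv]
    have hexp : (1 - p.toReal⁻¹) * p.toReal = p.toReal - 1 := by field_simp
    rw [hexp]
    calc _ ≤ ∑' k, ENNReal.ofReal ((1 - w) ^ (p.toReal - 1)) * ENNReal.ofReal (geomWeight w k) := by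
          refine ENNReal.tsum_le_tsum fun k => ?_
          rw [Real.enorm_eq_ofReal_abs, abs_of_pos (hpos k),
            ENNReal.ofReal_rpow_of_nonneg (hpos k).le (by linarith), ← ENNReal.ofReal_mul (by positivity)]
          refine ENNReal.ofReal_le_ofReal ?_
          calc geomWeight w k ^ p.toReal = geomWeight w k ^ (p.toReal - 1) * geomWeight w k := by
                rw [← Real.rpow_add_one (hpos k).ne']; ring_nf
            _ ≤ _ := mul_le_mul_of_nonneg_right
                (Real.rpow_le_rpow (hpos k).le (hle k) (by linarith)) (hpos k).le
      _ = ENNReal.ofReal ((1 - w) ^ (p.toReal - 1)) := by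
          rw [ENNReal.tsum_mul_left, ← ENNReal.ofReal_tsum_of_nonneg (fun k => (hpos k).le)
            (hasSum_geomWeight h0 h1).summable, (hasSum_geomWeight h0 h1).tsum_eq]
          simp

/-! ### The slowly varying base density -/

namespace BiorthogonalWaveletBasis

variable {r : ℝ} (W : BiorthogonalWaveletBasis r)

/-- A slowly varying density spanned by the translates of the father wavelet. -/
noncomputable def baseDensity (w x : ℝ) : ℝ := ∑' k : ℤ, geomWeight w k * W.recon (0, k) x

theorem baseDensity_eq_sum {A : ℕ} (hre : ∀ i x, W.recon i x ≠ 0 → |2 ^ (i.1 - 1) * x - i.2| ≤ A)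
    (w x : ℝ) {s : Finset ℤ} (hs : ∀ k : ℤ, |x - k| ≤ A → k ∈ s) :
    W.baseDensity w x = ∑ k ∈ s, geomWeight w k * W.recon (0, k) x := by
  refine tsum_eq_sum fun k hk => ?_
  by_contra hne
  have := hre (0, k) x (right_ne_zero_of_mul hne)
  exact hk (hs k (by simpa using this))

theorem measurable_baseDensity (w : ℝ) : Measurable (W.baseDensity w) := by
  obtain ⟨A, B, -, -, -, -, -, hre⟩ := W.exists_bounds
  refine measurable_of_tendsto_metrizable
    (f := fun (N : ℕ) (x : ℝ) => ∑ k ∈ Finset.Icc (-N : ℤ) N, geomWeight w k * W.recon (0, k) x)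
    (fun N => Finset.measurable_fun_sum _ fun k _ => (W.measurable_recon _).const_mul _) ?_
  rw [tendsto_pi_nhds]
  intro x
  obtain ⟨N₀, hN₀⟩ := exists_nat_ge (|x| + A)
  refine tendsto_const_nhds.congr' ?_
  filter_upwards [eventually_ge_atTop N₀] with N hN
  refine W.baseDensity_eq_sum hre w x fun k hk => ?_
  have hN' : (N₀ : ℝ) ≤ N := by exact_mod_cast hN
  have h2 := abs_le.1 hk
  have h3 := abs_le.1 (le_refl |x|)
  rw [Finset.mem_Icc]
  constructor
  · have : ((-N : ℤ) : ℝ) ≤ k := by push_cast; linarith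
    exact_mod_cast this
  · have : (k : ℝ) ≤ ((N : ℤ) : ℝ) := by push_cast; linarith
    exact_mod_cast this

/-- Since the translates of `φ̃` sum to one, the base density minus the weight at `⌊x⌋` is a sum of
differences of nearby weights, each small relative to that weight. Positivity follows although `φ̃`
may change sign. -/
theorem exists_baseDensity_bounds (hr : 0 < r) : ∃ h₀ : ℝ, 0 < h₀ ∧ h₀ < 1 ∧ ∀ w : ℝ, 1 - h₀ ≤ w → w < 1 →
    ∀ x, 1 / 2 * geomWeight w ⌊x⌋ ≤ W.baseDensity w x ∧
      W.baseDensity w x ≤ 3 / 2 * geomWeight w ⌊x⌋ := by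
  obtain ⟨A, B, hA, hB, -, -, hbd, hre⟩ := W.exists_bounds
  have hA0 : (0 : ℝ) ≤ A := Nat.cast_nonneg A
  have hden : 1 < 4 * (A + 1 : ℝ) * (2 * A + 3) * B := by
    have h1 : 1 ≤ (2 * A + 3 : ℝ) * B := by nlinarith
    calc (1 : ℝ) < 4 * (A + 1) * 1 := by linarith
      _ ≤ 4 * (A + 1) * ((2 * A + 3) * B) := by gcongr
      _ = _ := by ring
  -- There are `2 * A + 3` neighbouring indices, each with relative change `2 (A + 1) (1 - w)` and
  -- factor `B`; this choice brings the total to at most `1 / 2`.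
  refine ⟨1 / (4 * (A + 1) * (2 * A + 3) * B), by positivity, (div_lt_one (by linarith)).2 hden,
    fun w hw0 hw1 x => ?_⟩
  have hh : 1 - w ≤ 1 / (4 * (A + 1) * (2 * A + 3) * B) := by linarith
  have hw : 0 < w := by
    have := (div_lt_one (by linarith)).2 hden
    linarith
  rw [le_div_iff₀ (by linarith)] at hh
  set m := ⌊x⌋ with hm
  have hN : ((A + 1 : ℕ) : ℝ) * (1 - w) ≤ 1 / 2 := by
    push_cast
    have h1 : 0 ≤ (A + 1 : ℝ) * (1 - w) := mul_nonneg (by linarith) (by linarith)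
    have h2 : 1 ≤ (2 * A + 3 : ℝ) * B := by nlinarith
    nlinarith
  have hcm := geomWeight_pos hw hw1 m
  have hs : ∀ k : ℤ, |x - k| ≤ A → k ∈ Finset.Icc (m - (A + 1)) (m + (A + 1)) := by
    intro k hk
    have h1 := abs_le.1 hk
    have h2 := Int.floor_le x
    have h3 := Int.lt_floor_add_one x
    rw [← hm] at h2 h3
    rw [Finset.mem_Icc]
    constructor
    · have : ((m - (A + 1) : ℤ) : ℝ) ≤ k := by push_cast; linarith
      exact_mod_cast this
    · have : (k : ℝ) ≤ ((m + (A + 1) : ℤ) : ℝ) := by push_cast; linarith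
      exact_mod_cast this
  have hone : ∑ k ∈ Finset.Icc (m - (A + 1)) (m + (A + 1)), W.recon (0, k) x = 1 := by
    rw [← W.tsum_recon_zero hr x]
    refine (tsum_eq_sum fun k hk => ?_).symm
    by_contra hne
    exact hk (hs k (by simpa using hre (0, k) x hne))
  have hdev : |W.baseDensity w x - geomWeight w m| ≤ 1 / 2 * geomWeight w m := by
    calc |W.baseDensity w x - geomWeight w m|
        = |∑ k ∈ Finset.Icc (m - (A + 1)) (m + (A + 1)),
            (geomWeight w k - geomWeight w m) * W.recon (0, k) x| := by
          rw [W.baseDensity_eq_sum hre w x hs]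
          simp_rw [sub_mul, Finset.sum_sub_distrib, ← Finset.mul_sum]
          rw [hone, mul_one]
      _ ≤ ∑ k ∈ Finset.Icc (m - (A + 1)) (m + (A + 1)),
            2 * (((A + 1 : ℕ) : ℝ) * (1 - w)) * geomWeight w m * B := by
          refine (Finset.abs_sum_le_sum_abs _ _).trans (Finset.sum_le_sum fun k hk => ?_)
          rw [abs_mul]
          rw [Finset.mem_Icc] at hk
          have h1 := abs_geomWeight_sub_le hw hw1 hN (k := k) (m := m) (by
            rw [abs_le]; push_cast; constructor <;> linarith [hk.1, hk.2])
          have h2 : |W.recon (0, k) x| ≤ B := by simpa using hbd (0, k) x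
          exact mul_le_mul h1 h2 (abs_nonneg _) ((abs_nonneg _).trans h1)
      _ = (2 * A + 3) * (2 * ((A + 1) * (1 - w)) * geomWeight w m * B) := by
          rw [Finset.sum_const, Int.card_Icc, nsmul_eq_mul]
          have : (m + (A + 1) + 1 - (m - (A + 1)) : ℤ).toNat = 2 * A + 3 := by omega
          rw [this]
          push_cast
          ring
      _ = 1 / 2 * ((1 - w) * (4 * (A + 1) * (2 * A + 3) * B)) * geomWeight w m := by ring
      _ ≤ 1 / 2 * 1 * geomWeight w m := by gcongr
      _ = _ := by ring
  rw [abs_le] at hdev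
  constructor <;> linarith

theorem integral_baseDensity {w : ℝ} (h0 : 0 < w) (h1 : w < 1) : ∫ x, W.baseDensity w x = 1 := by
  have hint : ∀ k : ℤ, Integrable (fun x => geomWeight w k * W.recon (0, k) x) volume := fun k =>
    (memLp_one_iff_integrable.1 (W.memLp_recon (0, k) 1)).const_mul _
  have hnorm : ∀ k : ℤ, ∫ x, ‖geomWeight w k * W.recon (0, k) x‖
      = geomWeight w k * ∫ x, |W.φt x| := by
    intro k
    simp_rw [Real.norm_eq_abs, abs_mul, abs_of_pos (geomWeight_pos h0 h1 k), integral_const_mul,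
      W.recon_zero]
    rw [integral_sub_right_eq_self fun x => |W.φt x|]
  have h := hasSum_integral_of_summable_integral_norm hint
    (by simp_rw [hnorm]; exact (hasSum_geomWeight h0 h1).summable.mul_right _)
  simp_rw [integral_const_mul, W.integral_recon, if_true, mul_one] at h
  exact h.unique (hasSum_geomWeight h0 h1)

/-- On the support of one decomposition wavelet the base density is a finite expansion. Its
coefficients above the father level vanish, so it leaves the whole high-level budget of the ball to
the bumps. -/
theorem coeff_baseDensity (w : ℝ) (i : ℕ × ℤ) :
    W.coeff (W.baseDensity w) i = if i.1 = 0 then geomWeight w i.2 else 0 := by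
  obtain ⟨A, B, -, -, -, hd, -, hre⟩ := W.exists_bounds
  set N : ℕ := i.2.natAbs + 2 * A
  set s := ({0} : Finset ℕ) ×ˢ Finset.Icc (-N : ℤ) N
  have h := W.coeff_sum_recon s (fun i => geomWeight w i.2) i
  have hcongr : W.coeff (W.baseDensity w) i
      = W.coeff (fun x => ∑ i ∈ s, geomWeight w i.2 * W.recon i x) i := by
    unfold coeff
    refine integral_congr_ae (ae_of_all _ fun x => ?_)
    by_cases hx : W.dec i x = 0
    · simp [hx]
    · simp only
      congr 1
      rw [Finset.sum_product, Finset.sum_singleton]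
      refine W.baseDensity_eq_sum hre w x fun k hk => ?_
      have h1 := hd i x hx
      have hpow : (1 : ℝ) ≤ 2 ^ (i.1 - 1) := one_le_pow₀ (by norm_num)
      have hx' : |x| ≤ |(i.2 : ℝ)| + A := by
        calc |x| ≤ 2 ^ (i.1 - 1) * |x| := le_mul_of_one_le_left (abs_nonneg _) hpow
          _ = |(2 ^ (i.1 - 1) * x - i.2) + i.2| := by
              rw [sub_add_cancel, abs_mul, abs_of_pos (by positivity : (0 : ℝ) < 2 ^ (i.1 - 1))]
          _ ≤ _ := (abs_add_le _ _).trans (by linarith)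
      have hkN : |(k : ℝ)| ≤ N := by
        have h2 : |(k : ℝ)| ≤ |x| + |x - k| := by
          have := abs_sub_abs_le_abs_sub (k : ℝ) x
          rw [abs_sub_comm] at this
          linarith
        have h3 : (N : ℝ) = |(i.2 : ℝ)| + 2 * A := by
          simp [N, Nat.cast_natAbs]
        linarith
      rw [Finset.mem_Icc, ← abs_le]
      exact_mod_cast hkN
  rw [hcongr, h]
  refine if_congr ?_ rfl rfl
  simp only [s, Finset.mem_product, Finset.mem_singleton, Finset.mem_Icc, N]
  constructor
  · exact fun h => h.1
  · intro h
    refine ⟨h, ?_, ?_⟩ <;> omega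

end BiorthogonalWaveletBasis

/-! ### The hypercube of perturbed densities -/

theorem IsDensity.mem_boundedDensities {f : ℝ → ℝ} (hf : IsDensity f) {b R : ℝ} (hR : 0 ≤ R)
    (hb : ∀ x, f x ≤ b) (h1 : b ≤ R) (h2 : b ≤ R ^ 2) : f ∈ boundedDensities R := by
  refine ⟨hf, ?_, ?_⟩
  · rw [← ENNReal.pow_le_pow_left_iff two_ne_zero, eLpNorm_two_sq, ← ENNReal.ofReal_pow hR]
    calc ∫⁻ x, ‖f x‖ₑ ^ 2 ≤ ∫⁻ x, ENNReal.ofReal (R ^ 2) * ENNReal.ofReal (f x) := by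
          refine lintegral_mono fun x => ?_
          rw [Real.enorm_eq_ofReal_abs, abs_of_nonneg (hf.2.1 x), sq]
          exact mul_le_mul_left (ENNReal.ofReal_le_ofReal ((hb x).trans h2)) _
      _ = ENNReal.ofReal (R ^ 2) := by
          rw [lintegral_const_mul _ hf.1.ennreal_ofReal, hf.2.2, mul_one]
  · rw [eLpNorm_exponent_top]
    refine eLpNormEssSup_le_of_ae_enorm_bound (ae_of_all _ fun x => ?_)
    rw [Real.enorm_eq_ofReal_abs, abs_of_nonneg (hf.2.1 x)]
    exact ENNReal.ofReal_le_ofReal ((hb x).trans h1)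

theorem isDensity_of_integral_eq_one {f : ℝ → ℝ} (hf : Measurable f) (h0 : ∀ x, 0 ≤ f x)
    (h1 : ∫ x, f x = 1) : IsDensity f := by
  refine ⟨hf, h0, ?_⟩
  have hint : Integrable f volume := Integrable.of_integral_ne_zero (by rw [h1]; norm_num)
  rw [← ofReal_integral_eq_lintegral_ofReal hint (ae_of_all _ h0), h1, ENNReal.ofReal_one]

/-- The sign attached to a vertex coordinate of the hypercube. -/
def signOfBool (b : Bool) : ℝ := if b then 1 else -1

theorem abs_signOfBool (b : Bool) : |signOfBool b| = 1 := by
  cases b <;> simp [signOfBool]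

theorem signOfBool_not (b : Bool) : signOfBool (!b) = -signOfBool b := by
  cases b <;> simp [signOfBool]

theorem signOfBool_sq (b : Bool) : signOfBool b ^ 2 = 1 := by
  cases b <;> simp [signOfBool]

theorem eLpNorm_count_eq_of_forall_ne {q : ℝ≥0∞} (hq : 1 ≤ q) {G : ℕ → ℝ≥0∞} (j : ℕ)
    (hG : ∀ i, i ≠ j → G i = 0) : eLpNorm G q Measure.count = G j := by
  have h0 : q ≠ 0 := (zero_lt_one.trans_le hq).ne'
  have : G = ({j} : Set ℕ).indicator fun _ => G j := by
    ext i
    by_cases h : i = j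
    · simp [h]
    · simp [h, hG i h]
  rw [this, eLpNorm_indicator_const' (by simp) (by simp) h0]
  simp

/-- Position of the centre of the `i`-th bump; the windows of radius `A` around them are disjoint. -/
def bumpIndex (A j : ℕ) {M : ℕ} (i : Fin M) : ℕ × ℤ := (j + 1, (2 * A + 1) * (i : ℤ))

theorem bumpIndex_injective (A j M : ℕ) : Function.Injective (bumpIndex A j (M := M)) := by
  intro i i' h
  have h2 := congrArg Prod.snd h
  simp only [bumpIndex] at h2
  have h3 : (2 * (A : ℤ) + 1) ≠ 0 := by positivity
  have := mul_left_cancel₀ h3 h2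
  exact Fin.ext (by exact_mod_cast this)

theorem disjoint_bump_windows (A j M : ℕ) :
    Pairwise (Function.onFun Disjoint fun i : Fin M => dyadicWindow A (bumpIndex A j i)) := by
  intro i i' hne
  rw [Function.onFun, Set.disjoint_left]
  intro x hx hx'
  have h1 : |2 ^ (j + 1 - 1) * x - ((2 * A + 1) * (i : ℤ) : ℤ)| ≤ (A : ℝ) := hx
  have h2 : |2 ^ (j + 1 - 1) * x - ((2 * A + 1) * (i' : ℤ) : ℤ)| ≤ (A : ℝ) := hx'
  have h3 : |(((2 * A + 1) * (i : ℤ) : ℤ) : ℝ) - ((2 * A + 1) * (i' : ℤ) : ℤ)| ≤ 2 * A := by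
    rw [abs_le] at *
    constructor <;> linarith
  have h4 : |(2 * (A : ℤ) + 1) * (i : ℤ) - (2 * A + 1) * (i' : ℤ)| ≤ 2 * A := by exact_mod_cast h3
  rw [← mul_sub, abs_mul, abs_of_pos (by positivity : (0 : ℤ) < 2 * A + 1)] at h4
  have h5 : 1 ≤ |((i : ℕ) : ℤ) - (i' : ℕ)| := by
    apply Int.one_le_abs
    intro h
    exact hne (Fin.ext (by omega))
  nlinarith

theorem abs_le_of_mem_bump_window {A j M : ℕ} (hA : 1 ≤ A) {i : Fin M} {x : ℝ}
    (hx : x ∈ dyadicWindow A (bumpIndex A j i)) : 2 ^ j * |x| ≤ 4 * A * M := by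
  have h1 : |2 ^ (j + 1 - 1) * x - ((2 * A + 1) * (i : ℤ) : ℤ)| ≤ (A : ℝ) := hx
  rw [Nat.add_sub_cancel] at h1
  push_cast at h1
  have h2 : ((i : ℕ) : ℝ) + 1 ≤ M := by exact_mod_cast i.2
  have hA' : (1 : ℝ) ≤ A := by exact_mod_cast hA
  have hi : (0 : ℝ) ≤ (i : ℕ) := Nat.cast_nonneg _
  have h3 : |(2 : ℝ) ^ j * x| ≤ A + (2 * A + 1) * (i : ℕ) := by
    rw [abs_le] at *
    constructor <;> nlinarith
  rw [abs_mul, abs_of_pos (by positivity)] at h3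
  nlinarith

namespace BiorthogonalWaveletBasis

variable {r : ℝ} (W : BiorthogonalWaveletBasis r)

/-- The vertices of a hypercube of densities around `baseDensity`. -/
noncomputable def hypercube (w a : ℝ) (A j : ℕ) {M : ℕ} (s : Fin M → Bool) (x : ℝ) : ℝ :=
  W.baseDensity w x + ∑ i, a * signOfBool (s i) * W.recon (bumpIndex A j i) x

theorem coeff_sum_bumps (A j : ℕ) {M : ℕ} (b : Fin M → ℝ) (i' : ℕ × ℤ) :
    W.coeff (fun x => ∑ i, b i * W.recon (bumpIndex A j i) x) i'
      = ∑ i, b i * if i' = bumpIndex A j i then 1 else 0 := by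
  have h : ∀ x, (∑ i, b i * W.recon (bumpIndex A j i) x) * W.dec i' x
      = ∑ i, b i * (W.recon (bumpIndex A j i) x * W.dec i' x) := fun x => by
    rw [Finset.sum_mul]; exact Finset.sum_congr rfl fun i _ => by ring
  unfold coeff
  simp_rw [h]
  rw [integral_finsetSum _ fun i _ => (W.integrable_mul_dec (W.memLp_recon _ 2) i').const_mul _]
  refine Finset.sum_congr rfl fun i _ => ?_
  rw [integral_const_mul, ← W.coeff_recon, coeff]

theorem memLp_sum_bumps (A j : ℕ) {M : ℕ} (b : Fin M → ℝ) (p : ℝ≥0∞) :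
    MemLp (fun x => ∑ i, b i * W.recon (bumpIndex A j i) x) p volume :=
  memLp_finsetSum _ fun i _ => (W.memLp_recon _ p).const_mul (b i)

theorem hypercube_sub_flip (w a : ℝ) (A j : ℕ) {M : ℕ} (s : Fin M → Bool) (i : Fin M) (x : ℝ) :
    W.hypercube w a A j s x - W.hypercube w a A j (Function.update s i (!s i)) x
      = 2 * a * signOfBool (s i) * W.recon (bumpIndex A j i) x := by
  rw [hypercube, hypercube, add_sub_add_left_eq_sub, ← Finset.sum_sub_distrib,
    Finset.sum_eq_single i]
  · rw [Function.update_self, signOfBool_not]; ring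
  · intro i' _ hne
    rw [Function.update_of_ne hne, sub_self]
  · simp

theorem abs_sum_bumps_le {A : ℕ} {B : ℝ} (hbd : ∀ i x, |W.recon i x| ≤ B * √(2 ^ (i.1 - 1)))
    (hB : 0 ≤ B)
    (hre : ∀ i x, W.recon i x ≠ 0 → |2 ^ (i.1 - 1) * x - i.2| ≤ A) {a : ℝ} (ha : 0 ≤ a) (j : ℕ)
    {M : ℕ} (s : Fin M → Bool) (x : ℝ) :
    |∑ i, a * signOfBool (s i) * W.recon (bumpIndex A j i) x| ≤ a * (B * √(2 ^ j)) := by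
  by_cases h : ∃ i : Fin M, W.recon (bumpIndex A j i) x ≠ 0
  · obtain ⟨i, hi⟩ := h
    rw [Finset.sum_eq_single i]
    · rw [abs_mul, abs_mul, abs_signOfBool, mul_one, abs_of_nonneg ha]
      exact mul_le_mul_of_nonneg_left (hbd _ x) ha
    · intro i' _ hne
      by_contra hcon
      exact Set.disjoint_left.1 (disjoint_bump_windows A j M hne)
        (hre _ x (right_ne_zero_of_mul hcon)) (hre _ x hi)
    · simp
  · push Not at h
    simp only [h, mul_zero, Finset.sum_const_zero, abs_zero]
    positivity

/-- The base density occupies only the father level and the bumps only level `j`, where `M`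
coefficients have modulus `a`. Only one level contributes to the `ℓ_q` norm, hence the bound is free
of `q`. -/
theorem besovNorm_hypercube_le {w : ℝ} (h0 : 0 < w) (h1 : w < 1) {a : ℝ} (ha : 0 ≤ a) (A j : ℕ) {M : ℕ}
    (s : Fin M → Bool) (hmem : MemLp (W.baseDensity w) 2 volume) (α : ℝ) {p q : ℝ≥0∞} (hp : 1 ≤ p)
    (hq : 1 ≤ q) :
    W.besovNorm α p q (W.hypercube w a A j s) ≤ ENNReal.ofReal ((1 - w) ^ (1 - (p⁻¹).toReal) +
      2 ^ ((j : ℝ) * (α + 1 / 2 - (p⁻¹).toReal)) * (a * (M : ℝ) ^ (p⁻¹).toReal)) := by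
  have hco : ∀ i', W.coeff (W.hypercube w a A j s) i' = (if i'.1 = 0 then geomWeight w i'.2 else 0) +
      ∑ i, a * signOfBool (s i) * if i' = bumpIndex A j i then 1 else 0 := by
    intro i'
    rw [← W.coeff_baseDensity w i', ← W.coeff_sum_bumps A j (fun i => a * signOfBool (s i)),
      ← W.coeff_add hmem (W.memLp_sum_bumps A j _ 2)]
    rfl
  have hlow : ∀ k : ℤ, W.coeff (W.hypercube w a A j s) (0, k) = geomWeight w k := by
    intro k
    rw [hco]
    simp [bumpIndex]
  have hhigh : ∀ (j' : ℕ) (k : ℤ), W.coeff (W.hypercube w a A j s) (j' + 1, k)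
      = ∑ i, a * signOfBool (s i) * if (j' + 1, k) = bumpIndex A j i then 1 else 0 := by
    intro j' k
    rw [hco]
    simp
  have hw : 0 < 1 - w := by linarith
  rw [ENNReal.ofReal_add (by positivity) (by positivity)]
  unfold besovNorm
  refine add_le_add ?_ ?_
  · simp_rw [hlow]
    exact eLpNorm_geomWeight_le h0 h1 hp
  · rw [eLpNorm_count_eq_of_forall_ne hq j]
    · have h4 : (2 : ℝ≥0∞) ^ ((j : ℝ) * (α + 1 / 2 - (p⁻¹).toReal))
          = ENNReal.ofReal (2 ^ ((j : ℝ) * (α + 1 / 2 - (p⁻¹).toReal))) := by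
        rw [← ENNReal.ofReal_rpow_of_pos (by norm_num)]; simp
      rw [h4, ENNReal.ofReal_mul (by positivity)]
      refine mul_le_mul_right ?_ _
      set K : Finset ℤ := Finset.univ.image fun i : Fin M => (2 * (A : ℤ) + 1) * (i : ℤ) with hK
      calc eLpNorm (fun k : ℤ => W.coeff (W.hypercube w a A j s) (j + 1, k)) p Measure.count
          ≤ eLpNorm ((K : Set ℤ).indicator fun _ => a) p Measure.count := by
            refine eLpNorm_mono_real fun k => ?_
            rw [hhigh, Real.norm_eq_abs]
            by_cases hk : k ∈ K
            · rw [Set.indicator_of_mem (by exact_mod_cast hk)]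
              obtain ⟨i, -, hi⟩ := Finset.mem_image.1 hk
              have hik : bumpIndex A j i = (j + 1, k) := by rw [bumpIndex, hi]
              rw [Finset.sum_eq_single i]
              · rw [hik, if_pos rfl, mul_one, abs_mul, abs_signOfBool, mul_one, abs_of_nonneg ha]
              · intro i' _ hne
                rw [if_neg, mul_zero]
                rw [← hik]
                exact fun h => hne (bumpIndex_injective A j M h).symm
              · simp
            · rw [Set.indicator_of_notMem (by exact_mod_cast hk), Finset.sum_eq_zero, abs_zero]
              intro i _
              rw [if_neg, mul_zero]
              intro h
              exact hk (Finset.mem_image.2 ⟨i, Finset.mem_univ i, (congrArg Prod.snd h).symm⟩)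
        _ ≤ ‖a‖ₑ * Measure.count (K : Set ℤ) ^ (1 / p.toReal) := eLpNorm_indicator_const_le _ _
        _ ≤ ENNReal.ofReal a * (M : ℝ≥0∞) ^ (1 / p.toReal) := by
            rw [Real.enorm_eq_ofReal_abs, abs_of_nonneg ha, Measure.count_apply_finset]
            gcongr
            calc K.card ≤ (Finset.univ : Finset (Fin M)).card := Finset.card_image_le
              _ = M := by simp
        _ = _ := by
            rw [ENNReal.ofReal_mul ha, ← ENNReal.ofReal_rpow_of_nonneg (Nat.cast_nonneg M)
              ENNReal.toReal_nonneg, ENNReal.ofReal_natCast, ENNReal.toReal_inv, one_div]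
    · intro i hne
      have h5 : (fun k : ℤ => W.coeff (W.hypercube w a A j s) (i + 1, k)) = 0 := by
        funext k
        rw [hhigh, Pi.zero_apply]
        refine Finset.sum_eq_zero fun i' _ => ?_
        rw [if_neg, mul_zero]
        intro h
        have := congrArg Prod.fst h
        simp only [bumpIndex] at this
        exact hne (by omega)
      rw [h5, eLpNorm_zero, mul_zero]

end BiorthogonalWaveletBasis

/-- The radius is shared between base density and bumps. The share `h ^ (1 - π)` of the base can be
made small except when `π = 1`, where it equals one and `1 < R` is required. -/
theorem exists_radius_split {π R : ℝ} (hπ1 : π ≤ 1) (hR : 0 < R) (h1 : π = 1 → 1 < R) :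
    ∃ δ R₂ : ℝ, 0 < δ ∧ 0 < R₂ ∧ ∀ h : ℝ, 0 < h → h ≤ δ → h ^ (1 - π) + R₂ ≤ R := by
  rcases hπ1.eq_or_lt with rfl | hlt
  · refine ⟨1, R - 1, one_pos, by linarith [h1 rfl], fun h _ _ => ?_⟩
    simp
  · have hpos : 0 < 1 - π := by linarith
    refine ⟨(R / 2) ^ (1 / (1 - π)), R / 2, by positivity, by positivity, fun h h0 hle => ?_⟩
    have : h ^ (1 - π) ≤ ((R / 2) ^ (1 / (1 - π))) ^ (1 - π) := Real.rpow_le_rpow h0.le hle hpos.le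
    rw [← Real.rpow_mul (by positivity), one_div_mul_cancel hpos.ne', Real.rpow_one] at this
    linarith

namespace BiorthogonalWaveletBasis

variable {r : ℝ} (W : BiorthogonalWaveletBasis r)

/-- A window on which the base density is bounded below by a multiple of `1 - w`. -/
theorem le_baseDensity {w X : ℝ} (h0 : 0 < w) (h1 : w < 1)
    (hbase : ∀ x, 1 / 2 * geomWeight w ⌊x⌋ ≤ W.baseDensity w x) (hX : (X + 1) * (1 - w) ≤ 1 / 2)
    {x : ℝ} (hx : |x| ≤ X) : (1 - w) / 8 ≤ W.baseDensity w x := by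
  have hfl : ((⌊x⌋.natAbs : ℕ) : ℝ) ≤ X + 1 := by
    rw [Nat.cast_natAbs, Int.cast_abs]
    have h2 := Int.floor_le x
    have h3 := Int.lt_floor_add_one x
    have h4 := abs_le.1 hx
    rw [abs_le]
    constructor <;> linarith
  have := le_geomWeight h0 h1 (m := ⌊x⌋) ((mul_le_mul_of_nonneg_right hfl (by linarith)).trans hX)
  linarith [hbase x]

theorem integral_hypercube {w : ℝ} (h0 : 0 < w) (h1 : w < 1) (a : ℝ) (A j : ℕ) {M : ℕ}
    (s : Fin M → Bool) : ∫ x, W.hypercube w a A j s x = 1 := by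
  have hb := W.integral_baseDensity h0 h1
  have hint : Integrable (W.baseDensity w) volume :=
    Integrable.of_integral_ne_zero (by rw [hb]; norm_num)
  have hrec : ∀ i, Integrable (W.recon i) volume := fun i =>
    memLp_one_iff_integrable.1 (W.memLp_recon i 1)
  unfold hypercube
  rw [integral_add hint (integrable_finsetSum _ fun i _ => (hrec _).const_mul _), hb,
    integral_finsetSum _ fun i _ => (hrec _).const_mul _]
  simp [integral_const_mul, W.integral_recon, bumpIndex]

theorem measurable_hypercube (w a : ℝ) (A j : ℕ) {M : ℕ} (s : Fin M → Bool) :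
    Measurable (W.hypercube w a A j s) :=
  (W.measurable_baseDensity w).add
    (Finset.measurable_fun_sum _ fun _ _ => (W.measurable_recon _).const_mul _)

theorem lintegral_sq_bump (a : ℝ) (A j : ℕ) {M : ℕ} (i : Fin M) :
    ∫⁻ x, ENNReal.ofReal ((2 * a * W.recon (bumpIndex A j i) x) ^ 2)
      = ENNReal.ofReal (4 * a ^ 2 * ∫ x, W.ψt x ^ 2) := by
  have hint : Integrable (fun x => (2 * a * W.recon (bumpIndex A j i) x) ^ 2) volume :=
    ((W.memLp_recon _ 2).const_mul (2 * a)).integrable_sq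
  rw [← ofReal_integral_eq_lintegral_ofReal hint (ae_of_all _ fun x => sq_nonneg _)]
  simp_rw [mul_pow, integral_const_mul]
  rw [bumpIndex, W.integral_sq_recon_succ]
  norm_num

/-- The hypercube gives a lower bound of the minimax risk, provided that its vertices belong to the
class and are hard to distinguish. -/
theorem minimaxRisk_ge_of_hypercube {w a : ℝ} {A j n M : ℕ} {B : ℝ} (hA : 1 ≤ A) (hB : 0 ≤ B)
    (hbd : ∀ i x, |W.recon i x| ≤ B * √(2 ^ (i.1 - 1)))
    (hre : ∀ i x, W.recon i x ≠ 0 → |2 ^ (i.1 - 1) * x - i.2| ≤ A)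
    (h0 : 0 < w) (h1 : w < 1)
    (hbase : ∀ x, 1 / 2 * geomWeight w ⌊x⌋ ≤ W.baseDensity w x)
    (hbase' : ∀ x, W.baseDensity w x ≤ 3 / 2 * geomWeight w ⌊x⌋)
    (ha : 0 ≤ a) (hn : 1 ≤ n)
    (hwin : (4 * A * M / 2 ^ j + 1) * (1 - w) ≤ 1 / 2)
    (hamp : a * (B * √(2 ^ j)) ≤ (1 - w) / 16)
    (hhard : n * (16 * a ^ 2 * ∫ x, W.ψt x ^ 2) ≤ 1 / 4 * (1 - w))
    {α R R' : ℝ} {p q : ℝ≥0∞} (hp : 1 ≤ p) (hq : 1 ≤ q) (hR'0 : 0 < R') (hR' : 2 * (1 - w) ≤ R')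
    (hR'2 : 2 * (1 - w) ≤ R' ^ 2)
    (hR : (1 - w) ^ (1 - (p⁻¹).toReal) +
      2 ^ ((j : ℝ) * (α + 1 / 2 - (p⁻¹).toReal)) * (a * (M : ℝ) ^ (p⁻¹).toReal) ≤ R) :
    ENNReal.ofReal (1 / 2 * (M * a ^ 2 * ∫ x, W.ψt x ^ 2)) ≤
      minimaxRisk n (W.besovBall α p q R ∩ boundedDensities R') := by
  set h := 1 - w with hh
  have hh0 : 0 < h := by linarith
  set V := ∫ x, W.ψt x ^ 2 with hV
  have hVpos : 0 < V := W.integral_sq_ψt_pos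
  -- The bumps are at most half of the lower bound `h / 8` of the base density on their windows, so
  -- every vertex stays above `h / 16` there.
  have hsum : ∀ (s : Fin M → Bool) x,
      |∑ i, a * signOfBool (s i) * W.recon (bumpIndex A j i) x| ≤ h / 16 := fun s x =>
    (W.abs_sum_bumps_le hbd hB hre ha j s x).trans hamp
  have hbase0 : ∀ x, 0 < W.baseDensity w x := fun x => by
    have := geomWeight_pos h0 h1 ⌊x⌋
    linarith [hbase x]
  have hbasele : ∀ x, W.baseDensity w x ≤ 3 / 2 * h := fun x => by
    have := geomWeight_le h0 h1 ⌊x⌋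
    linarith [hbase' x]
  have hlow : ∀ (s : Fin M → Bool) (i : Fin M) x, W.recon (bumpIndex A j i) x ≠ 0 →
      h / 16 ≤ W.hypercube w a A j s x := by
    intro s i x hx
    have hx1 := abs_le_of_mem_bump_window hA (hre _ x hx)
    have hx2 : |x| ≤ 4 * A * M / 2 ^ j := by
      rw [le_div_iff₀ (by positivity)]; linarith
    have h2 := W.le_baseDensity h0 h1 hbase hwin hx2
    have h3 := (abs_le.1 (hsum s x)).1
    rw [hypercube]
    linarith
  have hnn : ∀ (s : Fin M → Bool) x, 0 ≤ W.hypercube w a A j s x := by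
    intro s x
    by_cases hx : ∃ i : Fin M, W.recon (bumpIndex A j i) x ≠ 0
    · obtain ⟨i, hi⟩ := hx
      exact le_trans (by positivity) (hlow s i x hi)
    · push Not at hx
      rw [hypercube]
      simp only [hx, mul_zero, Finset.sum_const_zero, add_zero]
      exact (hbase0 x).le
  have hdens : ∀ s : Fin M → Bool, IsDensity (W.hypercube w a A j s) := fun s =>
    isDensity_of_integral_eq_one (W.measurable_hypercube w a A j s) (hnn s)
      (W.integral_hypercube h0 h1 a A j s)
  have hbddens : IsDensity (W.baseDensity w) :=
    isDensity_of_integral_eq_one (W.measurable_baseDensity w) (fun x => (hbase0 x).le)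
      (W.integral_baseDensity h0 h1)
  have hbmem := hbddens.mem_boundedDensities hR'0.le hbasele (by linarith) (by linarith)
  have hL2 : MemLp (W.baseDensity w) 2 volume := hbddens.memLp hbmem.2.1
  have hmem : ∀ s : Fin M → Bool,
      W.hypercube w a A j s ∈ W.besovBall α p q R ∩ boundedDensities R' := by
    intro s
    have hb : ∀ x, W.hypercube w a A j s x ≤ 2 * h := fun x => by
      have := (abs_le.1 (hsum s x)).2
      rw [hypercube]
      linarith [hbasele x]
    have hbm := (hdens s).mem_boundedDensities hR'0.le hb hR' hR'2
    refine ⟨⟨(hdens s).memLp hbm.2.1, ?_⟩, hbm⟩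
    exact (W.besovNorm_hypercube_le h0 h1 ha A j s hL2 α hp hq).trans (ENNReal.ofReal_le_ofReal hR)
  have hn' : (1 : ℝ) ≤ n := by exact_mod_cast hn
  have hdiff : ∀ (s : Fin M → Bool) i x, (W.hypercube w a A j s x -
      W.hypercube w a A j (Function.update s i (!s i)) x) ^ 2
        = (2 * a * W.recon (bumpIndex A j i) x) ^ 2 := by
    intro s i x
    rw [W.hypercube_sub_flip, mul_pow, mul_pow _ (signOfBool _), signOfBool_sq, mul_one, ← mul_pow]
  have hht : n * (16 * a ^ 2 * V / h) ≤ 1 / 4 := by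
    rw [← mul_div_assoc, div_le_iff₀ hh0]; exact hhard
  have ht0 : 0 ≤ 16 * a ^ 2 * V / h := by positivity
  have haff : ∀ (s : Fin M → Bool) i, ENNReal.ofReal (1 / 2) ≤
      ((∫⁻ x, ENNReal.ofReal √(W.hypercube w a A j s x *
        W.hypercube w a A j (Function.update s i (!s i)) x)) ^ n) ^ 2 := by
    intro s i
    -- Neighbouring vertices differ by `2 a ψ̃` at one index, so the squared difference integrates
    -- to `4 a ^ 2 V`. Divided by `m = h / 8`, this is `2 t`.
    refine half_le_pow_sq_affinity (t := 16 * a ^ 2 * V / h) (by nlinarith) hht ?_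
    refine one_sub_le_affinity (hdens s) (hdens _) (m := h / 8) (by positivity) ht0 (fun x => ?_) ?_
    · by_cases hx : W.recon (bumpIndex A j i) x = 0
      · left
        have h2 := W.hypercube_sub_flip w a A j s i x
        rw [hx, mul_zero] at h2
        linarith
      · right
        linarith [hlow s i x hx, hlow (Function.update s i (!s i)) i x hx]
    · refine le_of_eq ?_
      simp_rw [hdiff, fun x => div_eq_inv_mul ((2 * a * W.recon (bumpIndex A j i) x) ^ 2) (h / 8),
        fun x => ENNReal.ofReal_mul (q := (2 * a * W.recon (bumpIndex A j i) x) ^ 2)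
          (show (0 : ℝ) ≤ (h / 8)⁻¹ by positivity)]
      rw [lintegral_const_mul' _ _ ENNReal.ofReal_ne_top, W.lintegral_sq_bump,
        ← ENNReal.ofReal_mul (by positivity)]
      congr 1
      rw [← hV]
      field_simp
      ring
  have key := assouad_bound (n := n) hdens
    (g := fun i x => 2 * a * W.recon (bumpIndex A j i) x)
    (S := fun i => dyadicWindow A (bumpIndex A j i)) (fun i => measurableSet_dyadicWindow _ _)
    (disjoint_bump_windows A j M) (fun i x hx => by
      by_contra hcon
      exact hx (hre _ x (right_ne_zero_of_mul hcon)))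
    (fun i => (W.measurable_recon _).const_mul _) hdiff (fun i => (W.lintegral_sq_bump a A j i).ge)
    haff hmem
  rw [← hV, ← ENNReal.ofReal_mul (by norm_num), ← ENNReal.ofReal_natCast,
    ← ENNReal.ofReal_mul (by positivity)] at key
  refine (ENNReal.mul_le_mul_iff_right (a := 2) (by norm_num) (by norm_num)).1 (le_trans ?_ key)
  rw [show (2 : ℝ≥0∞) = ENNReal.ofReal 2 by simp, ← ENNReal.ofReal_mul (by norm_num)]
  exact ENNReal.ofReal_le_ofReal (by linarith)

/-- The scale `j` and the number `M` of bumps remain free. The displayed condition on them says that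
the bumps fit into the Besov ball, and the bound `M a ^ 2` is of order `2 ^ j / n` whatever `M` is.
-/
theorem exists_minimaxRisk_ge_of_scale (hr : 0 < r) {α R R' : ℝ} {p q : ℝ≥0∞} (hp : 1 ≤ p)
    (hq : 1 ≤ q) (hR : 0 < R) (hR' : 0 < R') (hR1 : p = 1 → 1 < R) :
    ∃ C : ℝ, 0 < C ∧ ∀ n j M : ℕ, 2 ^ j ≤ M → M ≤ n →
      (2 : ℝ) ^ ((j : ℝ) * (α + 1 - (p⁻¹).toReal)) * (M : ℝ) ^ ((p⁻¹).toReal - 1 / 2) ≤ √n →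
      ENNReal.ofReal (C * (2 ^ j / n)) ≤
        minimaxRisk n (W.besovBall α p q R ∩ boundedDensities R') := by
  obtain ⟨A, B, hA, hB, -, -, hbd, hre⟩ := W.exists_bounds
  obtain ⟨h₀, hh₀, hh₀1, hbase⟩ := W.exists_baseDensity_bounds hr
  obtain ⟨δ₁, R₂, hδ₁, hR₂, hsplit⟩ := exists_radius_split (inv_toReal_le_one hp) hR (by
    intro h
    refine hR1 ?_
    rw [ENNReal.toReal_eq_one_iff, ENNReal.inv_eq_one] at h
    exact h)
  set π := (p⁻¹).toReal with hπ
  set V := ∫ x, W.ψt x ^ 2 with hV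
  have hVpos : 0 < V := W.integral_sq_ψt_pos
  have hB0 : 0 < B := by linarith
  obtain ⟨δ, hδ, hδh₀, hδδ₁, hδA, hδR, hδR2⟩ : ∃ δ : ℝ, 0 < δ ∧ δ ≤ h₀ ∧ δ ≤ δ₁ ∧
      (4 * A + 1) * δ ≤ 1 / 2 ∧ 2 * δ ≤ R' ∧ 2 * δ ≤ R' ^ 2 := by
    refine ⟨min h₀ (min δ₁ (min (1 / 2 / (4 * A + 1)) (min (R' / 2) (R' ^ 2 / 2)))),
      by positivity, min_le_left _ _, (min_le_right _ _).trans (min_le_left _ _), ?_, ?_, ?_⟩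
    · rw [mul_comm, ← le_div_iff₀ (by positivity)]
      exact (min_le_right _ _).trans ((min_le_right _ _).trans (min_le_left _ _))
    · rw [mul_comm, ← le_div_iff₀ (by positivity)]
      exact (min_le_right _ _).trans ((min_le_right _ _).trans ((min_le_right _ _).trans
        (min_le_left _ _)))
    · rw [mul_comm, ← le_div_iff₀ (by positivity)]
      exact (min_le_right _ _).trans ((min_le_right _ _).trans ((min_le_right _ _).trans
        (min_le_right _ _)))
  obtain ⟨e, he, heB, heV, heR⟩ : ∃ e : ℝ, 0 < e ∧ 16 * (B * e) ≤ δ ∧ 64 * V * e ^ 2 ≤ δ ∧ e ≤ R₂ := by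
    refine ⟨min (δ / (16 * B)) (min √(δ / (64 * V)) R₂), by positivity, ?_, ?_, ?_⟩
    · rw [← mul_assoc, mul_comm, ← le_div_iff₀ (by positivity)]
      exact min_le_left _ _
    · rw [mul_comm, ← le_div_iff₀ (by positivity)]
      calc _ ≤ √(δ / (64 * V)) ^ 2 :=
            pow_le_pow_left₀ (by positivity) ((min_le_right _ _).trans (min_le_left _ _)) 2
        _ = _ := Real.sq_sqrt (by positivity)
    · exact (min_le_right _ _).trans (min_le_right _ _)
  refine ⟨1 / 2 * (e ^ 2 * V), by positivity, fun n j M hjM hMn hscale => ?_⟩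
  have hM : 1 ≤ M := Nat.one_le_two_pow.trans hjM
  have hn : 1 ≤ n := hM.trans hMn
  have hM0 : (0 : ℝ) < M := by exact_mod_cast hM
  have hn0 : (0 : ℝ) < n := by exact_mod_cast hn
  have hjM' : (2 : ℝ) ^ j ≤ M := by exact_mod_cast hjM
  have hMn' : (M : ℝ) ≤ n := by exact_mod_cast hMn
  have hj0 : (0 : ℝ) < 2 ^ j := by positivity
  -- The bumps occupy a length of order `M / 2 ^ j`, over which the base density has to spread its
  -- unit mass.
  set h := δ * (2 ^ j / M) with hh
  have hh0 : 0 < h := by positivity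
  have hhδ : h ≤ δ := mul_le_of_le_one_right hδ.le ((div_le_one hM0).2 hjM')
  -- The largest order with `n a ^ 2` comparable to `h`, so that neighbours cannot be told apart; `M
  -- ≤ n` then keeps the height `a √(2 ^ j)` of a bump below the order of `h`.
  set a := e * √(2 ^ j) / (√n * √M) with ha
  have ha0 : 0 ≤ a := by positivity
  have hasq : a ^ 2 = e ^ 2 * (2 ^ j / (n * M)) := by
    rw [ha, div_pow, mul_pow, mul_pow, Real.sq_sqrt hj0.le, Real.sq_sqrt hn0.le, Real.sq_sqrt hM0.le,
      mul_div_assoc]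
  have key := W.minimaxRisk_ge_of_hypercube (w := 1 - h) (a := a) (A := A) (j := j) (n := n) (M := M)
    (B := B) hA hB0.le hbd hre (by linarith) (by linarith)
    (fun x => (hbase (1 - h) (by linarith) (by linarith) x).1)
    (fun x => (hbase (1 - h) (by linarith) (by linarith) x).2) ha0 hn
    (α := α) (R := R) (R' := R') (p := p) (q := q)
  rw [sub_sub_cancel, ← hV] at key
  refine le_trans (ENNReal.ofReal_le_ofReal ?_) (key ?_ ?_ ?_ hp hq hR' (by linarith) (by linarith) ?_)
  · rw [hasq]
    refine le_of_eq ?_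
    field_simp
  · calc (4 * A * M / 2 ^ j + 1) * h = 4 * A * δ + h := by rw [hh]; field_simp
      _ ≤ 1 / 2 := by linarith
  · have h2 : √(2 ^ j : ℝ) * √(2 ^ j) = 2 ^ j := Real.mul_self_sqrt hj0.le
    have h3 : (M : ℝ) ≤ √n * √M := by
      calc (M : ℝ) = √M * √M := (Real.mul_self_sqrt hM0.le).symm
        _ ≤ _ := by gcongr
    calc a * (B * √(2 ^ j)) = B * e * (√(2 ^ j : ℝ) * √(2 ^ j)) / (√n * √M) := by rw [ha]; ring
      _ = B * e * 2 ^ j / (√n * √M) := by rw [h2]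
      _ ≤ δ / 16 * 2 ^ j / M := by gcongr; linarith
      _ = h / 16 := by rw [hh]; ring
  · calc n * (16 * a ^ 2 * V) = 1 / 4 * (64 * V * e ^ 2) * (2 ^ j / M) := by
          rw [hasq]; field_simp; ring
      _ ≤ 1 / 4 * δ * (2 ^ j / M) := by gcongr
      _ = 1 / 4 * h := by rw [hh]; ring
  · have h2 : (2 : ℝ) ^ ((j : ℝ) * (α + 1 / 2 - π)) * (a * (M : ℝ) ^ π) ≤ R₂ := by
      have hs : √(2 ^ j : ℝ) = 2 ^ ((j : ℝ) * (1 / 2)) := sqrt_two_pow j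
      have e1 : (2 : ℝ) ^ ((j : ℝ) * (α + 1 / 2 - π)) * 2 ^ ((j : ℝ) * (1 / 2))
          = 2 ^ ((j : ℝ) * (α + 1 - π)) := by
        rw [← Real.rpow_add (by norm_num)]; ring_nf
      have e2 : (M : ℝ) ^ (π - 1 / 2) = (M : ℝ) ^ π / √M := by
        rw [Real.rpow_sub hM0, Real.sqrt_eq_rpow]
      calc _ = e * (2 ^ ((j : ℝ) * (α + 1 - π)) * (M : ℝ) ^ (π - 1 / 2)) / √n := by
            rw [ha, hs, ← e1, e2]
            have : √(M : ℝ) ≠ 0 := by positivity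
            field_simp
        _ ≤ e * √n / √n := by gcongr
        _ = e := by
            have : √(n : ℝ) ≠ 0 := by positivity
            field_simp
        _ ≤ R₂ := heR
    linarith [hsplit h hh0 (by linarith)]

/-- `2 ^ j` is taken of the order `n ^ (1 - ρ)`. The scale condition contains `M ^ (π - 1 / 2)`, so
the best `M` is the smallest admissible one when `π ≥ 1 / 2` and the largest one when `π < 1 / 2`;
the corresponding `ρ` is the one allowed by the condition. -/
theorem exists_minimaxRisk_ge (hr : 0 < r) {α R R' : ℝ} {p q : ℝ≥0∞} (hα : 0 < α) (hp : 1 ≤ p)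
    (hq : 1 ≤ q) (hR : 0 < R) (hR' : 0 < R') (hR1 : p = 1 → 1 < R) :
    ∃ C : ℝ, 0 < C ∧ ∀ n : ℕ, 1 ≤ n → ENNReal.ofReal (C * (n : ℝ) ^ (-rateExponent α p)) ≤
        minimaxRisk n (W.besovBall α p q R ∩ boundedDensities R') := by
  obtain ⟨C, hC, h⟩ := W.exists_minimaxRisk_ge_of_scale hr (α := α) hp hq hR hR' hR1
  refine ⟨C / 2, by positivity, fun n hn => ?_⟩
  set ρ := rateExponent α p with hρ
  set π := (p⁻¹).toReal with hπ
  have hπ1 : π ≤ 1 := inv_toReal_le_one hp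
  have hπ0 : 0 ≤ π := ENNReal.toReal_nonneg
  have hρ1 : ρ ≤ 1 := rateExponent_le_one hα p
  have hρ0 : 0 < ρ := rateExponent_pos hα p
  have hn1 : (1 : ℝ) ≤ n := by exact_mod_cast hn
  have hn0 : (0 : ℝ) < n := by linarith
  have hx1 : 1 ≤ (n : ℝ) ^ (1 - ρ) := Real.one_le_rpow hn1 (by linarith)
  obtain ⟨j, hj1, hj2⟩ := exists_nat_pow_near hx1 (by norm_num : (1 : ℝ) < 2)
  have hjn : (2 : ℝ) ^ j ≤ n := hj1.trans (by
    calc (n : ℝ) ^ (1 - ρ) ≤ (n : ℝ) ^ (1 : ℝ) := Real.rpow_le_rpow_of_exponent_le hn1 (by linarith)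
      _ = n := Real.rpow_one _)
  have hjn' : 2 ^ j ≤ n := by exact_mod_cast hjn
  have hpow : ∀ s : ℝ, 0 ≤ s → (2 : ℝ) ^ ((j : ℝ) * s) ≤ (n : ℝ) ^ ((1 - ρ) * s) := by
    intro s hs
    rw [Real.rpow_mul (by norm_num), Real.rpow_natCast, Real.rpow_mul hn0.le]
    exact Real.rpow_le_rpow (by positivity) hj1 hs
  have hrate : C / 2 * (n : ℝ) ^ (-ρ) ≤ C * (2 ^ j / n) := by
    have h1 : (n : ℝ) ^ (-ρ) = (n : ℝ) ^ (1 - ρ) / n := by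
      rw [show -ρ = (1 - ρ) - 1 by ring, Real.rpow_sub_one hn0.ne']
    rw [h1]
    calc C / 2 * ((n : ℝ) ^ (1 - ρ) / n) ≤ C / 2 * (2 ^ (j + 1) / n) := by gcongr
      _ = _ := by rw [pow_succ]; ring
  refine (ENNReal.ofReal_le_ofReal hrate).trans ?_
  rcases le_or_gt (1 / 2) π with hle | hgt
  -- Bumps on a set of bounded length, where the base density has constant order.
  · refine h n j (2 ^ j) le_rfl hjn' ?_
    push_cast
    have hρe : ρ = α / (α + 1 / 2) := by
      rw [hρ, rateExponent, max_eq_right (by linarith), add_zero]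
    rw [← Real.rpow_natCast 2 j, ← Real.rpow_mul (by norm_num), ← Real.rpow_add (by norm_num),
      ← mul_add]
    refine (hpow _ (by linarith)).trans_eq ?_
    rw [Real.sqrt_eq_rpow, hρe]
    congr 1
    field_simp
    ring
  -- Bumps spread over a length of order `n / 2 ^ j`, each region having mass of order `1 / n`.
  · refine h n j n hjn' le_rfl ?_
    have hρe : ρ = α / (α + 1 - π) := by
      rw [hρ, rateExponent, max_eq_left (by linarith)]
      congr 1
      ring
    calc _ ≤ (n : ℝ) ^ ((1 - ρ) * (α + 1 - π)) * (n : ℝ) ^ (π - 1 / 2) := by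
          gcongr
          exact hpow _ (by linarith)
      _ = √n := by
          rw [← Real.rpow_add hn0, Real.sqrt_eq_rpow, hρe]
          congr 1
          have : α + 1 - π ≠ 0 := by linarith
          field_simp
          ring

end BiorthogonalWaveletBasis

/-! ### The theorem -/

theorem theorem4 (r : ℝ) (hr : 0 < r) (W : BiorthogonalWaveletBasis r) :
    -- lower bound of the minimax risk
    (∀ (R R' α : ℝ) (p q : ℝ≥0∞), 0 < R → 0 < R' → 1 ≤ p → 1 ≤ q → (p = 1 → 1 < R) →
      max 0 ((p⁻¹).toReal - 1 / 2) < α → α < r + 1 →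
      ∃ C : ℝ, 0 < C ∧
        ENNReal.ofReal C ≤ liminf (fun n : ℕ => (n : ℝ≥0∞) ^ rateExponent α p *
          minimaxRisk n (W.besovBall α p q R ∩ boundedDensities R')) atTop) ∧
    -- the thresholding estimator is adaptive minimax up to a logarithmic factor
    (∀ (c γ αstar : ℝ) (pstar : ℝ≥0∞), 1 ≤ c → c < γ → 0 < αstar → 1 ≤ pstar →
      (pstar⁻¹).toReal - 1 / 2 ≤ αstar * (1 - 1 / (c * (1 + 2 * αstar))) →
      (∀ n : ℕ, IsEstimator n (W.estimator γ c (-c) n)) ∧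
      ∀ (R R' α : ℝ) (p q : ℝ≥0∞), 0 < R → 0 < R' → αstar ≤ α → α < r + 1 → pstar ≤ p →
        1 ≤ q →
        ∃ C : ℝ, 0 < C ∧ ∀ n : ℕ, 2 ≤ n →
          maxRisk n (W.besovBall α p q R ∩ boundedDensities R') (W.estimator γ c (-c) n)
            ≤ ENNReal.ofReal (C * (Real.log n / n) ^ rateExponent α p) ∧
          ((p = 1 → 1 < R) →
            maxRisk n (W.besovBall α p q R ∩ boundedDensities R') (W.estimator γ c (-c) n)
            ≤ ENNReal.ofReal (C * Real.log n ^ rateExponent α p) *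
              minimaxRisk n (W.besovBall α p q R ∩ boundedDensities R'))) := by
  refine ⟨fun R R' α p q hR hR' hp hq hR1 hα _ => ?_,
    fun c γ αstar pstar hc hγ hαs hps hcond => ⟨fun n => W.isEstimator_estimator γ c (-c) n,
      fun R R' α p q hR hR' hα _ hpp hq => ?_⟩⟩
  · obtain ⟨C, hC, h⟩ := W.exists_minimaxRisk_ge hr ((le_max_left _ _).trans_lt hα) hp hq hR hR' hR1
    refine ⟨C, hC, le_liminf_of_le (by isBoundedDefault) ?_⟩
    filter_upwards [eventually_ge_atTop 1] with n hn
    have hn0 : (0 : ℝ) < n := by exact_mod_cast hn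
    calc ENNReal.ofReal C
        = (n : ℝ≥0∞) ^ rateExponent α p * ENNReal.ofReal (C * (n : ℝ) ^ (-rateExponent α p)) := by
          rw [← ENNReal.ofReal_natCast, ENNReal.ofReal_rpow_of_pos hn0,
            ← ENNReal.ofReal_mul (by positivity), mul_left_comm, ← Real.rpow_add hn0]
          simp
      _ ≤ _ := mul_le_mul_right (h n hn) _
  · have hα0 : 0 < α := hαs.trans_le hα
    have hp : 1 ≤ p := hps.trans hpp
    have hcond' : (p⁻¹).toReal - 1 / 2 ≤ α * (1 - 1 / (c * (1 + 2 * α))) := by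
      have h1 := inv_toReal_antitone hps hpp
      have h2 := mul_one_sub_inv_mono hc hαs hα
      linarith
    obtain ⟨C₁, hC₁, hup⟩ := W.exists_maxRisk_le (R' := R') (q := q) hc hγ hα0 hp hq hR hcond'
    -- The final constant is fixed before the assumption on `R` is available; where that assumption
    -- fails, any positive value serves.
    obtain ⟨C₂, hC₂, hlow⟩ : ∃ C₂ : ℝ, 0 < C₂ ∧ ((p = 1 → 1 < R) → ∀ n : ℕ, 1 ≤ n →
        ENNReal.ofReal (C₂ * (n : ℝ) ^ (-rateExponent α p)) ≤
          minimaxRisk n (W.besovBall α p q R ∩ boundedDensities R')) := by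
      by_cases hR1 : p = 1 → 1 < R
      · obtain ⟨C₂, hC₂, h⟩ := W.exists_minimaxRisk_ge hr hα0 hp hq hR hR' hR1
        exact ⟨C₂, hC₂, fun _ => h⟩
      · exact ⟨1, one_pos, fun h => absurd h hR1⟩
    -- `C₁` serves the explicit rate, `C₁ / C₂` the comparison with the minimax risk.
    refine ⟨C₁ + C₁ / C₂, by positivity, fun n hn => ?_⟩
    have hn0 : (0 : ℝ) < n := by positivity
    have hl : 0 < Real.log n := by linarith [half_le_log_nat hn]
    have hL := (log_div_nat_mem hn).1
    refine ⟨(hup n hn).trans (ENNReal.ofReal_le_ofReal ?_), fun hR1 => ?_⟩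
    · have : 0 < C₁ / C₂ := by positivity
      gcongr
      linarith
    · calc _ ≤ ENNReal.ofReal (C₁ * (Real.log n / n) ^ rateExponent α p) := hup n hn
        _ ≤ ENNReal.ofReal ((C₁ + C₁ / C₂) * Real.log n ^ rateExponent α p *
              (C₂ * (n : ℝ) ^ (-rateExponent α p))) := by
            refine ENNReal.ofReal_le_ofReal ?_
            rw [Real.div_rpow hl.le hn0.le, div_eq_mul_inv, ← Real.rpow_neg hn0.le]
            have hX : 0 ≤ Real.log n ^ rateExponent α p * (n : ℝ) ^ (-rateExponent α p) := by
              positivity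
            calc _ = C₁ * (Real.log n ^ rateExponent α p * (n : ℝ) ^ (-rateExponent α p)) := by ring
              _ ≤ (C₁ * C₂ + C₁) * (Real.log n ^ rateExponent α p * (n : ℝ) ^ (-rateExponent α p)) := by
                  gcongr
                  nlinarith
              _ = _ := by field_simp
        _ = ENNReal.ofReal ((C₁ + C₁ / C₂) * Real.log n ^ rateExponent α p) *
              ENNReal.ofReal (C₂ * (n : ℝ) ^ (-rateExponent α p)) :=
            ENNReal.ofReal_mul (by positivity)
        _ ≤ _ := mul_le_mul_right (hlow hR1 n (by omega)) _
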